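/- Let $K$ be a link diagram on $S^2$ with $n$ crossings, numbered $1,\dots,n$. ($K$ is recorded combinatorially: the four half-edges at each crossing in counterclockwise order, starting with an end of the under-strand; a fixed-point-free involution gluing the $4n$ half-edges in pairs, such that the resulting $4$-valent map is planar, that is, $V-E+F=2C$ with $C$ its number of connected components; and a number of circles without crossings. No orientation of $K$ is needed.) For $v\in\{0,1\}^n$ let $K_v$ be the resolution of $K$ in which crossing $i$ is replaced by its $v_i$-resolution; number the half-edges at a crossing $0,1,2,3$ counterclockwise so that $0,2$ belong to the under-strand; then the $0$-resolution joins $0$ with $1$ and $2$ with $3$, and the $1$-resolution joins $0$ with $3$ and $1$ with $2$. The cube $\underline{2}^n$ is the poset $\{0,1\}^n$, viewed as a category with one morphism $\varphi_{u,v}\colon u\to v$ whenever $u\ge v$; an edge $u\to v$ is a pair with $u\ge v$ and $|u|-|v|=1$, where $|v|=\sum_i v_i$. The Burnside category $\mathscr B$ has finite sets as objects, finite correspondences $A\xleftarrow{s}X\xrightarrow{t}B$ as morphisms from $A$ to $B$, composition $Y\circ X=Y\times_B X$, and bijections commuting with $s$ and $t$ as $2$-morphisms. A strictly unitary lax $2$-functor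 $F\colon\underline{2}^n\to\mathscr B$ consists of finite sets $F(v)$, correspondences $F(\varphi_{u,v})$ from $F(u)$ to $F(v)$ for $u>v$, and $2$-isomorphisms $F_{u,v,w}\colon F(\varphi_{v,w})\times_{F(v)}F(\varphi_{u,v})\to F(\varphi_{u,w})$ for $u>v>w$, such that for all $u>v>w>z$ $$F_{u,w,z}\circ(\mathrm{Id}\times F_{u,v,w})=F_{u,v,z}\circ(F_{v,w,z}\times\mathrm{Id}).$$ *Vertices and edges.* Put $F_{Kh}(v)=\{x\colon\pi_0(K_v)\to\{x_+,x_-\}\}$. Let $V=\mathbb Z\langle x_+,x_-\rangle$ with $m(x_+\otimes x_+)=x_+$, $m(x_+\otimes x_-)=m(x_-\otimes x_+)=x_-$, $m(x_-\otimes x_-)=0$, $\Delta(x_+)=x_+\otimes x_-+x_-\otimes x_+$, $\Delta(x_-)=x_-\otimes x_-$. For an edge $u\to v$, $K_u$ arises from $K_v$ by merging two circles or splitting one; let $(\epsilon_{x,y})$, $x\in F_{Kh}(u)$, $y\in F_{Kh}(v)$, be the matrix of the map $\bigotimes_{\pi_0(K_v)}V\to\bigotimes_{\pi_0(K_u)}V$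 that applies $m$, respectively $\Delta$, to the factors involved and the identity to the others. The edge correspondence is $F_{Kh}(\varphi_{u,v})=\{(y,x)\in F_{Kh}(v)\times F_{Kh}(u):\epsilon_{x,y}=1\}$, with source map $(y,x)\mapsto x$ and target map $(y,x)\mapsto y$. *Two-dimensional faces.* For a face $u\to v\to w$, $u\to v'\to w$ ($v\ne v'$), a face map is a $2$-morphism $$F_{u,v,v',w}\colon F_{Kh}(\varphi_{v,w})\times_{F_{Kh}(v)}F_{Kh}(\varphi_{u,v})\to F_{Kh}(\varphi_{v',w})\times_{F_{Kh}(v')}F_{Kh}(\varphi_{u,v'}).$$ The face is a ladybug configuration if a single circle $C_w$ of $K_w$ splits into two circles in $K_v$ and also into two circles in $K_{v'}$, and in each case these two merge to a single circle $C_u$ of $K_u$. Let then $a_v$, $a_{v'}$ be the surgery arcs in $S^2$ with endpoints on $C_w$ that produce $K_v$, $K_{v'}$ from $K_w$; the right pair is the pair of arcs of $C_w\setminus(\partial a_v\cup\partial a_{v'})$ reached by walking along $a_v$ or $a_{v'}$ to $C_w$ and turning right. The face maps are given by the ladybug matching if, for every ladybug configuration and all elements $(z,y,x)$ of the source with $z(C_w)=x_+$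 and $x(C_u)=x_-$, the image $(z,y',x)$ is such that for each arc of the right pair the circle of $K_{v'}$ containing it has the same label under $y'$ as the circle of $K_v$ containing it has under $y$. **Proposition.** There is exactly one family of face maps $F_{u,v,v',w}$, over all two-dimensional faces, that is given by the ladybug matching. It satisfies: (C-1) $F_{u,v',v,w}=F_{u,v,v',w}^{-1}$ for every two-dimensional face; (C-2) for every three-dimensional face with top vertex $u$, upper middle vertices $v,v',v''$, lower middle vertices $w,w',w''$ and bottom vertex $z$, where $v\to w',w''$; $v'\to w,w''$; $v''\to w,w'$ are the middle edges, the hexagon commutes: $$(F_{v'',w',w,z}\times\mathrm{Id})(\mathrm{Id}\times F_{u,v,v'',w'})(F_{v,w'',w',z}\times\mathrm{Id})=(\mathrm{Id}\times F_{u,v',v'',w})(F_{v',w'',w,z}\times\mathrm{Id})(\mathrm{Id}\times F_{u,v,v',w''}).$$ Consequently there is a strictly unitary lax $2$-functor $F_{Kh}\colon\underline{2}^n\to\mathscr B$ with these values on vertices and edges and with $(F_{Kh})_{u,v',w}^{-1}\circ(F_{Kh})_{u,v,w}=F_{u,v,v',w}$ for every two-dimensional face, and any two such $2$-functors are naturally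 isomorphic: there are bijections between their values at each vertex, and bijections between their correspondences over these, compatible with the structure $2$-isomorphisms. -/

import Mathlib

namespace KhBurnside

/-! ## The Burnside category -/

/-- A finite correspondence (span) from `A` to `B`. -/
structure Corr (A B : Type) where
  carrier : Type
  finite_carrier : Finite carrier
  s : carrier → A
  t : carrier → B

/-- The composition `Y ∘ X`, i.e. the fiber product `Y ×_B X`. -/
def Corr.comp {A B C : Type} (Y : Corr B C) (X : Corr A B) : Corr A C where
  carrier := {p : Y.carrier × X.carrier // Y.s p.1 = X.t p.2}
  finite_carrier :=
    haveI := X.finite_carrier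
    haveI := Y.finite_carrier
    inferInstance
  s p := X.s p.1.2
  t p := Y.t p.1.1

/-- A 2-morphism of the Burnside category: a bijection of correspondences that commutes with the
source and target maps. -/
@[ext]
structure TwoMor {A B : Type} (X Y : Corr A B) where
  toEquiv : X.carrier ≃ Y.carrier
  s_comm : ∀ x, Y.s (toEquiv x) = X.s x
  t_comm : ∀ x, Y.t (toEquiv x) = X.t x

/-- `f.trans g` is `f` followed by `g`. -/
def TwoMor.trans {A B : Type} {X Y Z : Corr A B} (f : TwoMor X Y) (g : TwoMor Y Z) :
    TwoMor X Z where
  toEquiv := f.toEquiv.trans g.toEquiv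
  s_comm x := (g.s_comm _).trans (f.s_comm x)
  t_comm x := (g.t_comm _).trans (f.t_comm x)

/-- The inverse of a 2-morphism. -/
def TwoMor.symm {A B : Type} {X Y : Corr A B} (f : TwoMor X Y) : TwoMor Y X where
  toEquiv := f.toEquiv.symm
  s_comm y := by
    have h := f.s_comm (f.toEquiv.symm y)
    rw [Equiv.apply_symm_apply] at h
    exact h.symm
  t_comm y := by
    have h := f.t_comm (f.toEquiv.symm y)
    rw [Equiv.apply_symm_apply] at h
    exact h.symm

/-- The canonical identification of the two triple fiber products. -/
def TwoMor.assoc {A B C D : Type} (Z : Corr C D) (Y : Corr B C) (X : Corr A B) :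
    TwoMor ((Z.comp Y).comp X) (Z.comp (Y.comp X)) where
  toEquiv :=
    { toFun := fun p => ⟨(p.1.1.1.1, ⟨(p.1.1.1.2, p.1.2), p.2⟩), p.1.1.2⟩
      invFun := fun p => ⟨(⟨(p.1.1, p.1.2.1.1), p.2⟩, p.1.2.1.2), p.1.2.2⟩
      left_inv := fun _ => rfl
      right_inv := fun _ => rfl }
  s_comm _ := rfl
  t_comm _ := rfl

/-- The 2-morphism `Id × f`. -/
def TwoMor.whiskerLeft {A B C : Type} (Y : Corr B C) {X X' : Corr A B} (f : TwoMor X X') :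
    TwoMor (Y.comp X) (Y.comp X') where
  toEquiv :=
    { toFun := fun p => ⟨(p.1.1, f.toEquiv p.1.2), p.2.trans (f.t_comm _).symm⟩
      invFun := fun p => ⟨(p.1.1, f.symm.toEquiv p.1.2), p.2.trans (f.symm.t_comm _).symm⟩
      left_inv := fun _ => Subtype.ext (Prod.ext rfl (f.toEquiv.symm_apply_apply _))
      right_inv := fun _ => Subtype.ext (Prod.ext rfl (f.toEquiv.apply_symm_apply _)) }
  s_comm p := f.s_comm p.1.2
  t_comm _ := rfl

/-- The 2-morphism `g × Id`. -/
def TwoMor.whiskerRight {A B C : Type} {Y Y' : Corr B C} (g : TwoMor Y Y') (X : Corr A B) :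
    TwoMor (Y.comp X) (Y'.comp X) where
  toEquiv :=
    { toFun := fun p => ⟨(g.toEquiv p.1.1, p.1.2), (g.s_comm _).trans p.2⟩
      invFun := fun p => ⟨(g.symm.toEquiv p.1.1, p.1.2), (g.symm.s_comm _).trans p.2⟩
      left_inv := fun _ => Subtype.ext (Prod.ext (g.toEquiv.symm_apply_apply _) rfl)
      right_inv := fun _ => Subtype.ext (Prod.ext (g.toEquiv.apply_symm_apply _) rfl) }
  s_comm _ := rfl
  t_comm p := g.t_comm p.1.1

/-! ## The cube -/

/-- Vertices of the `n`-dimensional cube, with the componentwise order (`false` is `0`, `true` is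
`1`). -/
abbrev Cube (n : ℕ) : Type := Fin n → Bool

/-- The grading `|v|`. -/
def grade {n : ℕ} (v : Cube n) : ℕ := ∑ i, (v i).toNat

/-- `CubeEdge u v` says that there is an edge from `u` to `v`: `u ≥ v` and `|u| - |v| = 1`. -/
structure CubeEdge {n : ℕ} (u v : Cube n) : Prop where
  le : v ≤ u
  grade_eq : grade u = grade v + 1

theorem CubeEdge.lt {n : ℕ} {u v : Cube n} (h : CubeEdge u v) : v < u := by
  refine lt_of_le_of_ne h.le ?_
  rintro rfl
  have := h.grade_eq
  omega

/-- Along an edge exactly one coordinate changes. -/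
theorem CubeEdge.existsUnique_ne {n : ℕ} {u v : Cube n} (h : CubeEdge u v) :
    ∃! i, u i ≠ v i := by
  have key : ∀ i, (v i).toNat + (if u i ≠ v i then 1 else 0) = (u i).toNat := by
    intro i
    have hi := h.le i
    revert hi
    cases u i <;> cases v i <;> simp
  have hs : ∑ i, (if u i ≠ v i then 1 else 0) = 1 := by
    have h1 : grade v + ∑ i, (if u i ≠ v i then 1 else 0) = grade u := by
      unfold grade
      rw [← Finset.sum_add_distrib]
      exact Finset.sum_congr rfl fun i _ => key i
    have h2 := h.grade_eq
    omega
  rw [Finset.sum_boole] at hs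
  obtain ⟨i, hi⟩ := Finset.card_eq_one.mp (by exact_mod_cast hs)
  refine ⟨i, ?_, fun j hj => ?_⟩
  · have : i ∈ Finset.univ.filter (fun i => u i ≠ v i) := by rw [hi]; simp
    simpa using this
  · have : j ∈ Finset.univ.filter (fun i => u i ≠ v i) := by simpa using hj
    rw [hi] at this
    simpa using this

/-- The coordinate that changes along an edge. -/
noncomputable def CubeEdge.coord {n : ℕ} {u v : Cube n} (h : CubeEdge u v) : Fin n :=
  h.existsUnique_ne.choose

theorem CubeEdge.coord_spec {n : ℕ} {u v : Cube n} (h : CubeEdge u v) : u h.coord ≠ v h.coord :=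
  h.existsUnique_ne.choose_spec.1

/-- A two-dimensional face with top vertex `u`, bottom vertex `w` and middle vertices `v`, `v'`. -/
structure CubeFace {n : ℕ} (u v v' w : Cube n) : Prop where
  uv : CubeEdge u v
  uv' : CubeEdge u v'
  vw : CubeEdge v w
  vw' : CubeEdge v' w
  ne : v ≠ v'

theorem CubeFace.symm {n : ℕ} {u v v' w : Cube n} (h : CubeFace u v v' w) : CubeFace u v' v w :=
  ⟨h.uv', h.uv, h.vw', h.vw, h.ne.symm⟩

/-- A three-dimensional face with top vertex `u`, bottom vertex `z`, upper middle vertices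
`v, v', v''` and lower middle vertices `w, w', w''`; each of the six fields is one of its
two-dimensional faces. -/
structure CubeSolid {n : ℕ} (u v v' v'' w w' w'' z : Cube n) : Prop where
  top₁ : CubeFace u v v' w''
  top₂ : CubeFace u v v'' w'
  top₃ : CubeFace u v' v'' w
  bot₁ : CubeFace v w'' w' z
  bot₂ : CubeFace v' w'' w z
  bot₃ : CubeFace v'' w' w z

/-! ## Functors from the cube to the Burnside category -/

/-- A strictly unitary lax 2-functor from the `n`-dimensional cube to the Burnside category. -/
structure CubeFunctor (n : ℕ) where
  obj : Cube n → Type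
  finite_obj : ∀ v, Finite (obj v)
  map : ∀ {u v : Cube n}, v < u → Corr (obj u) (obj v)
  mapComp : ∀ {u v w : Cube n} (huv : v < u) (hvw : w < v),
    TwoMor ((map hvw).comp (map huv)) (map (hvw.trans huv))
  coherence : ∀ {u v w z : Cube n} (huv : v < u) (hvw : w < v) (hwz : z < w),
    ((TwoMor.assoc (map hwz) (map hvw) (map huv)).trans
      (TwoMor.whiskerLeft (map hwz) (mapComp huv hvw))).trans (mapComp (hvw.trans huv) hwz) =
    (TwoMor.whiskerRight (mapComp hvw hwz) (map huv)).trans (mapComp huv (hwz.trans hvw))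

/-- The vertex and edge data: a finite set for every vertex, a finite correspondence for every
edge. -/
structure VertexEdgeData (n : ℕ) where
  obj : Cube n → Type
  finite_obj : ∀ v, Finite (obj v)
  edge : ∀ {u v : Cube n}, CubeEdge u v → Corr (obj u) (obj v)

/-- Face data over given vertex and edge data: a 2-morphism for every two-dimensional face. -/
def VertexEdgeData.FaceMaps {n : ℕ} (P : VertexEdgeData n) : Type :=
  ∀ (u v v' w : Cube n) (h : CubeFace u v v' w),
    TwoMor ((P.edge h.vw).comp (P.edge h.uv)) ((P.edge h.vw').comp (P.edge h.uv'))

/-- Vertex, edge and face data together. -/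
structure CubeData (n : ℕ) extends VertexEdgeData n where
  face : toVertexEdgeData.FaceMaps

/-- The matching condition. -/
def CubeData.Matching {n : ℕ} (D : CubeData n) : Prop :=
  ∀ (u v v' w : Cube n) (h : CubeFace u v v' w), D.face u v' v w h.symm = (D.face u v v' w h).symm

/-- The hexagon condition: the two composites from `F(w''→z) × F(v→w'') × F(u→v)` to
`F(w→z) × F(v''→w) × F(u→v'')` agree. -/
def CubeData.Hexagon {n : ℕ} (D : CubeData n) : Prop :=
  ∀ (u v v' v'' w w' w'' z : Cube n) (h : CubeSolid u v v' v'' w w' w'' z),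
    ((((TwoMor.whiskerRight (D.face v w'' w' z h.bot₁) (D.edge h.top₁.uv)).trans
      (TwoMor.assoc (D.edge h.bot₁.vw') (D.edge h.bot₁.uv') (D.edge h.top₁.uv))).trans
      (TwoMor.whiskerLeft (D.edge h.bot₁.vw') (D.face u v v'' w' h.top₂))).trans
      (TwoMor.assoc (D.edge h.bot₁.vw') (D.edge h.top₂.vw') (D.edge h.top₂.uv')).symm).trans
      (TwoMor.whiskerRight (D.face v'' w' w z h.bot₃) (D.edge h.top₂.uv')) =
    ((((((TwoMor.assoc (D.edge h.bot₁.vw) (D.edge h.bot₁.uv) (D.edge h.top₁.uv)).trans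
      (TwoMor.whiskerLeft (D.edge h.bot₁.vw) (D.face u v v' w'' h.top₁))).trans
      (TwoMor.assoc (D.edge h.bot₁.vw) (D.edge h.top₁.vw') (D.edge h.top₁.uv')).symm).trans
      (TwoMor.whiskerRight (D.face v' w'' w z h.bot₂) (D.edge h.top₁.uv'))).trans
      (TwoMor.assoc (D.edge h.bot₂.vw') (D.edge h.bot₂.uv') (D.edge h.top₁.uv'))).trans
      (TwoMor.whiskerLeft (D.edge h.bot₂.vw') (D.face u v' v'' w h.top₃))).trans
      (TwoMor.assoc (D.edge h.bot₂.vw') (D.edge h.top₃.vw') (D.edge h.top₃.uv')).symm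

/-- The data produced by a strictly unitary lax 2-functor: restrict to vertices and edges, and put
`F_{u,v,v',w} = F_{u,v',w}⁻¹ ∘ F_{u,v,w}`. -/
def CubeFunctor.toCubeData {n : ℕ} (F : CubeFunctor n) : CubeData n where
  obj := F.obj
  finite_obj := F.finite_obj
  edge h := F.map h.lt
  face _ _ _ _ h := (F.mapComp h.uv.lt h.vw.lt).trans (F.mapComp h.uv'.lt h.vw'.lt).symm

/-- A natural isomorphism of 2-functors: bijections of the values at vertices, and bijections of
the correspondences lying over them, that are compatible with the structure 2-isomorphisms. (An
invertible 1-morphism of the Burnside category is, up to a 2-isomorphism, a bijection.) -/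
structure CubeFunctor.NatIso {n : ℕ} (F G : CubeFunctor n) where
  obj : ∀ v, F.obj v ≃ G.obj v
  map : ∀ {u v : Cube n} (h : v < u), (F.map h).carrier ≃ (G.map h).carrier
  s_comm : ∀ {u v : Cube n} (h : v < u) (x : (F.map h).carrier),
    (G.map h).s (map h x) = obj u ((F.map h).s x)
  t_comm : ∀ {u v : Cube n} (h : v < u) (x : (F.map h).carrier),
    (G.map h).t (map h x) = obj v ((F.map h).t x)
  comp_comm : ∀ {u v w : Cube n} (huv : v < u) (hvw : w < v)
    (p : ((F.map hvw).comp (F.map huv)).carrier),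
    map (hvw.trans huv) ((F.mapComp huv hvw).toEquiv p) =
      (G.mapComp huv hvw).toEquiv ⟨(map hvw p.1.1, map huv p.1.2),
        (s_comm hvw p.1.1).trans ((congrArg (obj v) p.2).trans (t_comm huv p.1.2).symm)⟩

/-! ## Link diagrams -/

/-- The four half-edges at each of `n` crossings. At each crossing they are numbered `0, 1, 2, 3`
counterclockwise, so that `0` and `2` form the strand that passes under, and `1` and `3` form the
strand that passes over. -/
abbrev HalfEdge (n : ℕ) : Type := Fin n × Fin 4

/-- Two half-edges are consecutive on the boundary of a region: follow the edge, then turn to the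
next half-edge at the crossing reached. -/
def NextOnRegion {n : ℕ} (e : HalfEdge n → HalfEdge n) (d d' : HalfEdge n) : Prop :=
  d' = ((e d).1, (e d).2 + 1)

/-- Two half-edges lie at a common crossing or on a common edge. -/
def Adjacent {n : ℕ} (e : HalfEdge n → HalfEdge n) (d d' : HalfEdge n) : Prop :=
  d.1 = d'.1 ∨ d' = e d

/-- A link diagram on the sphere with `n` ordered crossings, recorded by its planar 4-valent
combinatorial map: `glue` joins the half-edges at the crossings in pairs, `loops` is the number of
circles that pass through no crossing. The field `planar` is Euler's formula `V - E + F = 2 C`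
(with `V = n`, `E = 2 n`), summed over the `C` connected pieces that contain crossings, where `F`
is the number of face cycles of the combinatorial map; it says that every piece has genus `0`. -/
structure LinkDiagram (n : ℕ) where
  glue : HalfEdge n → HalfEdge n
  glue_glue : ∀ d, glue (glue d) = d
  glue_ne : ∀ d, glue d ≠ d
  loops : ℕ
  planar : Nat.card (Quot (NextOnRegion glue)) = n + 2 * Nat.card (Quot (Adjacent glue))

namespace LinkDiagram

variable {n : ℕ} (K : LinkDiagram n)

/-- The other end of the arc that the `v`-resolution has at a half-edge: the `0`-resolution joins
`0` with `1` and `2` with `3`, the `1`-resolution joins `0` with `3` and `1` with `2`. -/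
def resolve {n : ℕ} (v : Cube n) (d : HalfEdge n) : HalfEdge n :=
  (d.1, if v d.1 then ![3, 2, 1, 0] d.2 else ![1, 0, 3, 2] d.2)

/-- The set `π₀(K_v)` of circles of the resolution `K_v`. -/
def Circle (v : Cube n) : Type :=
  Quot (fun d d' : HalfEdge n => d' = K.glue d ∨ d' = resolve v d) ⊕ Fin K.loops

instance (v : Cube n) : Finite (K.Circle v) :=
  inferInstanceAs (Finite (Quot _ ⊕ Fin K.loops))

/-- The circle of `K_v` through a half-edge. -/
def circle (v : Cube n) (d : HalfEdge n) : K.Circle v := Sum.inl (Quot.mk _ d)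

/-- The circle of `K_v` given by a component without crossings. -/
def loop (v : Cube n) (l : Fin K.loops) : K.Circle v := Sum.inr l

end LinkDiagram

/-! ## Khovanov generators and edge correspondences -/

/-- The two labels `x₊` and `x₋`. -/
inductive Label : Type
  | plus
  | minus
  deriving DecidableEq

instance : Finite Label :=
  Finite.of_injective (fun a : Label => decide (a = Label.plus)) (by
    intro a b; cases a <;> cases b <;> simp)

/-- The multiplication of `V = ℤ⟨x₊, x₋⟩`: `mul a b c` is the coefficient of `c` in `m(a ⊗ b)`. -/
def mul : Label → Label → (Label → ℤ)
  | .plus, .plus => Pi.single .plus 1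
  | .plus, .minus => Pi.single .minus 1
  | .minus, .plus => Pi.single .minus 1
  | .minus, .minus => 0

/-- The comultiplication: `comul a (b, c)` is the coefficient of `b ⊗ c` in `Δ(a)`. -/
def comul : Label → (Label × Label → ℤ)
  | .plus => Pi.single (.plus, .minus) 1 + Pi.single (.minus, .plus) 1
  | .minus => Pi.single (.minus, .minus) 1

namespace LinkDiagram

variable {n : ℕ} (K : LinkDiagram n)

/-- The Khovanov generators at `v`: labelings of the circles of `K_v`. They form the preferred
basis of the tensor product of copies of `V` indexed by the circles of `K_v`. -/
def Gen (v : Cube n) : Type := K.Circle v → Label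

instance (v : Cube n) : Finite (K.Gen v) :=
  inferInstanceAs (Finite (K.Circle v → Label))

/-- The labelings `x` of `K_u` and `y` of `K_v` agree on all circles that do not meet the crossing
at which `K_u` and `K_v` differ. -/
def AgreeAway {u v : Cube n} (h : CubeEdge u v) (x : K.Gen u) (y : K.Gen v) : Prop :=
  (∀ d, K.circle v d ≠ K.circle v (h.coord, 0) → K.circle v d ≠ K.circle v (h.coord, 2) →
    x (K.circle u d) = y (K.circle v d)) ∧
  ∀ l, x (K.loop u l) = y (K.loop v l)

open Classical in
/-- The matrix of the edge map from the Khovanov group of `v` to that of `u`. If the two arcs of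
`K_v` at the changing crossing lie on different circles, these are merged in `K_u`, and the map is
the multiplication of the two factors; if they lie on the same circle, this circle is split in
`K_u`, and the map is the comultiplication. On the remaining factors it is the identity. -/
noncomputable def edgeMatrix {u v : Cube n} (h : CubeEdge u v) : Matrix (K.Gen u) (K.Gen v) ℤ :=
  fun x y =>
    if K.AgreeAway h x y then
      if K.circle v (h.coord, 0) ≠ K.circle v (h.coord, 2) then
        mul (y (K.circle v (h.coord, 0))) (y (K.circle v (h.coord, 2)))
          (x (K.circle u (h.coord, 0)))
      else
        comul (y (K.circle v (h.coord, 0)))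
          (x (K.circle u (h.coord, 0)), x (K.circle u (h.coord, 2)))
    else 0

/-- The Khovanov correspondence of an edge: the pairs `(y, x)` whose matrix entry is `1`. -/
def khEdge {u v : Cube n} (h : CubeEdge u v) : Corr (K.Gen u) (K.Gen v) where
  carrier := {p : K.Gen v × K.Gen u // K.edgeMatrix h p.2 p.1 = 1}
  finite_carrier := inferInstance
  s p := p.1.2
  t p := p.1.1

/-- The Khovanov generators and the Khovanov edge correspondences. -/
def khVertexEdgeData : VertexEdgeData n where
  obj := K.Gen
  finite_obj _ := inferInstance
  edge h := K.khEdge h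

/-! ## The ladybug matching -/

/-- A ladybug configuration: both arcs of both crossings of the face lie on one circle `C_w` of
`K_w`, this circle splits in `K_v` and in `K_{v'}`, and the resulting circles merge to a single
circle `C_u` of `K_u`. -/
def IsLadybug {u v v' w : Cube n} (h : CubeFace u v v' w) : Prop :=
  (K.circle w (h.vw.coord, 2) = K.circle w (h.vw.coord, 0) ∧
    K.circle w (h.vw'.coord, 0) = K.circle w (h.vw.coord, 0) ∧
    K.circle w (h.vw'.coord, 2) = K.circle w (h.vw.coord, 0)) ∧
  K.circle v (h.vw.coord, 0) ≠ K.circle v (h.vw.coord, 2) ∧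
  K.circle v' (h.vw'.coord, 0) ≠ K.circle v' (h.vw'.coord, 2) ∧
  (K.circle u (h.vw.coord, 2) = K.circle u (h.vw.coord, 0) ∧
    K.circle u (h.vw'.coord, 0) = K.circle u (h.vw.coord, 0) ∧
    K.circle u (h.vw'.coord, 2) = K.circle u (h.vw.coord, 0))

/-- The half-edges at which the right pair of arcs begins and ends. The surgery arc at a crossing
`c` joins the midpoints of the two arcs `01` and `23` of the `0`-resolution. Walking along it
towards the arc `23` and turning right one leaves the crossing along the half-edge `2`; walking
towards the arc `01` and turning right one leaves along the half-edge `0`. -/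
def RightTurn {u v v' w : Cube n} (h : CubeFace u v v' w) (d : HalfEdge n) : Prop :=
  (d.1 = h.vw.coord ∨ d.1 = h.vw'.coord) ∧ (d.2 = 0 ∨ d.2 = 2)

/-- The face maps are given by the ladybug matching: in a ladybug configuration with `C_w` labeled
`x₊` and `C_u` labeled `x₋`, a circle of `K_v` and a circle of `K_{v'}` that contain the same arc
of the right pair receive the same label. (In all other cases a 2-morphism is unique, so that there
is nothing to prescribe.) -/
def IsLadybugMatching (Φ : K.khVertexEdgeData.FaceMaps) : Prop :=
  ∀ (u v v' w : Cube n) (h : CubeFace u v v' w), K.IsLadybug h →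
    ∀ (z : K.Gen w) (y : K.Gen v) (x : K.Gen u) (y' : K.Gen v')
      (hzy : K.edgeMatrix h.vw y z = 1) (hyx : K.edgeMatrix h.uv x y = 1)
      (hzy' : K.edgeMatrix h.vw' y' z = 1) (hyx' : K.edgeMatrix h.uv' x y' = 1),
      z (K.circle w (h.vw.coord, 0)) = Label.plus →
      x (K.circle u (h.vw.coord, 0)) = Label.minus →
      (Φ u v v' w h).toEquiv ⟨(⟨(z, y), hzy⟩, ⟨(y, x), hyx⟩), rfl⟩ =
        ⟨(⟨(z, y'), hzy'⟩, ⟨(y', x), hyx'⟩), rfl⟩ →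
      ∀ d, RightTurn h d → y (K.circle v d) = y' (K.circle v' d)

/-- The Khovanov generators and edge correspondences, with given face maps. -/
def khData (Φ : K.khVertexEdgeData.FaceMaps) : CubeData n where
  toVertexEdgeData := K.khVertexEdgeData
  face := Φ

end LinkDiagram

end KhBurnside

/-! The circles of all resolutions near a few crossings are governed by one small permutation. By
Euler's formula the mod 2 cellular complex of the diagram is exact in the middle
(`range_regionBoundary_eq_ker`), so the regions have a checkerboard colouring. Its boundary
orientation makes the half-edges at each crossing alternately outgoing and incoming, and both
resolutions of a crossing respect it. Hence the circles of `K_v` are the cycles of a permutation of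
the outgoing half-edges, and changing the resolution of a crossing composes this permutation with
the transposition of the two outgoing half-edges there. For `k` crossings, let `π` be the first
return map to their `2k` outgoing half-edges. Then the connections at all `2 ^ k` vertices of the
corresponding face of the cube are the cycles of `π` followed by such transpositions
(`Orientation.exists_perm`). Circles that avoid the `k` crossings keep their labels. So assertions
about squares and three-dimensional faces become assertions about all permutations of 4 and of 6
points, which are decided by evaluation. The ladybug matching needs one further bit per crossing:
which of its half-edges are outgoing. Besides providing the orientation, planarity enters the
evaluations only through the fact that the two crossings of a ladybug have different bits, that is,
the two surgery arcs lie on different sides of the circle. This is a mod 2 Jordan curve argument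
(`Orientation.out_ne_of_interlaced`). The evaluations then give that each path through one side of a
square has exactly one partner on the other side (`existsUnique_faceRel`), and that both ways of
moving a path across a three-dimensional face agree (`hexagon_faceRel`). Existence and uniqueness of
the face maps, (C-1) and (C-2) follow. For the functor, consider descending paths of generators up
to moves across squares. A weight on the coordinates directs the moves; the hexagon relation is
local confluence, so Newman's lemma applies. Directed moves sort the order in which coordinates
change, so irreducible paths between given ends run through the same vertices, and two equivalent
paths through the same vertices are equal (`eq_of_eqvGen_swap`). Therefore concatenation of classes
is bijective onto the fiber product (`pathMul_bijective`), and the classes form a functor whose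
edges can be identified with the Khovanov correspondences. Conversely, in any functor every element
is a product of elements over edges, and two factorizations are related across squares; so an
isomorphism on edges that respects squares extends uniquely (`EdgeIso.Rel.unique`). -/

namespace KhBurnside

namespace LinkDiagram

/-! ## Consequences of planarity -/

section Homology

variable {n : ℕ} (K : LinkDiagram n)

/-- Cellular 1-chains mod 2, as functions on half-edges. -/
def edgeChains : Submodule (ZMod 2) (HalfEdge n → ZMod 2) where
  carrier := {a | ∀ d, a (K.glue d) = a d}
  add_mem' ha hb d := by simp [ha d, hb d]
  zero_mem' _ := rfl
  smul_mem' r a ha d := by simp [ha d]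

/-- The endomorphism `1 + glue*` of the space of all functions on the `4n` half-edges has the edge
chains both as its kernel and as its image, so their dimension is half of `4n`. -/
theorem finrank_edgeChains : Module.finrank (ZMod 2) K.edgeChains = 2 * n := by
  let φ : (HalfEdge n → ZMod 2) →ₗ[ZMod 2] (HalfEdge n → ZMod 2) :=
    LinearMap.id + LinearMap.funLeft (ZMod 2) (ZMod 2) K.glue
  have hφ : ∀ g d, φ g d = g d + g (K.glue d) := fun g d => rfl
  have hker : LinearMap.ker φ = K.edgeChains := by
    ext g
    rw [LinearMap.mem_ker, funext_iff]
    refine forall_congr' fun d => ?_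
    rw [hφ, Pi.zero_apply, CharTwo.add_eq_zero]
    exact eq_comm
  have hrange : LinearMap.range φ = K.edgeChains := by
    apply le_antisymm
    · rintro _ ⟨g, rfl⟩ d
      rw [hφ, hφ, K.glue_glue, add_comm]
    · intro a ha
      -- Keep `a` on the smaller half-edge of each glued pair only. No half-edge is glued to itself,
      -- so symmetrizing recovers `a`.
      refine ⟨fun d => if toLex d < toLex (K.glue d) then a d else 0, funext fun d => ?_⟩
      rw [hφ, K.glue_glue]
      have hne : toLex d ≠ toLex (K.glue d) := fun h => K.glue_ne d (toLex.injective h).symm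
      rcases lt_or_gt_of_ne hne with h | h
      · simp [h, h.not_gt]
      · rw [if_neg h.not_gt, if_pos h, zero_add, ha d]
  have h := LinearMap.finrank_range_add_finrank_ker φ
  rw [hker, hrange, Module.finrank_pi] at h
  simp only [Fintype.card_prod, Fintype.card_fin] at h
  omega

/-- The boundary map from 1-chains to 0-chains. -/
def chainBoundary : K.edgeChains →ₗ[ZMod 2] (Fin n → ZMod 2) where
  toFun a c := ∑ i, a.1 (c, i)
  map_add' a b := by ext c; simp [Finset.sum_add_distrib]
  map_smul' r a := by ext c; simp [Finset.mul_sum]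

/-- The cokernel is spanned by one class per connected component, because the boundary of an edge
identifies the classes of its two ends. -/
theorem le_finrank_range_chainBoundary :
    n ≤ Module.finrank (ZMod 2) (LinearMap.range K.chainBoundary) +
      Nat.card (Quot (Adjacent K.glue)) := by
  classical
  let mk := (LinearMap.range K.chainBoundary).mkQ
  have hwd : ∀ d d', Adjacent K.glue d d' → mk (Pi.single d.1 1) = mk (Pi.single d'.1 1) := by
    rintro d d' (h | rfl)
    · rw [h]
    · refine (Submodule.Quotient.eq _).2 ?_
      let a : HalfEdge n → ZMod 2 := Pi.single d 1 + Pi.single (K.glue d) 1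
      have ha : a ∈ K.edgeChains := by
        intro x
        have h1 : (K.glue x = d) = (x = K.glue d) :=
          propext ⟨fun h => by rw [← h, K.glue_glue], fun h => by rw [h, K.glue_glue]⟩
        have h2 : (K.glue x = K.glue d) = (x = d) :=
          propext ⟨fun h => by rw [← K.glue_glue x, h, K.glue_glue], fun h => by rw [h]⟩
        simp only [a, Pi.add_apply, Pi.single_apply, h1, h2]
        exact add_comm _ _
      refine ⟨⟨a, ha⟩, funext fun c => ?_⟩
      have hs : ∀ e : HalfEdge n, ∑ i, (Pi.single e 1 : HalfEdge n → ZMod 2) (c, i) =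
          (Pi.single e.1 1 : Fin n → ZMod 2) c := by
        rintro ⟨e1, e2⟩
        simp only [Pi.single_apply, Prod.mk.injEq]
        by_cases hc : c = e1 <;> simp [hc]
      simp only [chainBoundary, LinearMap.coe_mk, AddHom.coe_mk, a, Pi.add_apply,
        Finset.sum_add_distrib, hs, Pi.sub_apply, CharTwo.sub_eq_add]
  have : Fintype (Quot (Adjacent K.glue)) := Fintype.ofFinite _
  have hspan : ⊤ ≤ Submodule.span (ZMod 2) (Set.range (Quot.lift _ hwd)) := by
    rintro q -
    obtain ⟨h, rfl⟩ := Submodule.mkQ_surjective _ q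
    have hh : h = ∑ c, h c • (Pi.single c 1 : Fin n → ZMod 2) := by
      ext c
      simp [Finset.sum_apply, Pi.single_apply]
    rw [hh, map_sum]
    refine Submodule.sum_mem _ fun c _ => ?_
    rw [map_smul]
    exact Submodule.smul_mem _ _ (Submodule.subset_span ⟨Quot.mk _ (c, 0), rfl⟩)
  have h1 := finrank_le_of_span_eq_top (top_le_iff.1 hspan)
  have h2 := Submodule.finrank_quotient_add_finrank (LinearMap.range K.chainBoundary)
  rw [Module.finrank_pi, Fintype.card_fin] at h2
  rw [Nat.card_eq_fintype_card]
  omega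

/-- The boundary map from 2-chains, functions on the set of regions, to 1-chains. -/
def regionBoundary : (Quot (NextOnRegion K.glue) → ZMod 2) →ₗ[ZMod 2] K.edgeChains where
  toFun f := ⟨fun d => f (Quot.mk _ d) + f (Quot.mk _ (K.glue d)), fun d => by
    simp only [K.glue_glue, add_comm]⟩
  map_add' f g := by ext d; simp only [Pi.add_apply, Submodule.coe_add]; ring
  map_smul' r f := by ext d; simp [mul_add]

theorem mk_glue_region (c : Fin n) (i : Fin 4) :
    Quot.mk (NextOnRegion K.glue) (K.glue (c, i)) = Quot.mk (NextOnRegion K.glue) (c, i + 1) := by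
  apply Quot.sound
  simp [NextOnRegion, K.glue_glue]

/-- A function on regions without jumps is constant around each crossing and across each edge, hence
comes from a function on the components. -/
theorem finrank_ker_regionBoundary_le :
    Module.finrank (ZMod 2) (LinearMap.ker K.regionBoundary) ≤
      Nat.card (Quot (Adjacent K.glue)) := by
  let π : Quot (NextOnRegion K.glue) → Quot (Adjacent K.glue) :=
    Quot.lift (fun d => Quot.mk _ d) (by
      rintro d _ rfl
      exact (Quot.sound (r := Adjacent K.glue) (a := d) (b := K.glue d) (Or.inr rfl)).trans
        (Quot.sound (Or.inl rfl)))
  let ψ := LinearMap.funLeft (ZMod 2) (ZMod 2) π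
  have hle : LinearMap.ker K.regionBoundary ≤ LinearMap.range ψ := by
    intro f hf
    have h0 : ∀ d, f (Quot.mk _ d) = f (Quot.mk _ (K.glue d)) := fun d =>
      CharTwo.add_eq_zero.1 (congrFun (congrArg Subtype.val (LinearMap.mem_ker.1 hf)) d)
    have h1 : ∀ c i, f (Quot.mk _ (c, i)) = f (Quot.mk _ (c, i + 1)) := fun c i => by
      rw [h0, K.mk_glue_region]
    have h2 : ∀ c i, f (Quot.mk _ (c, i)) = f (Quot.mk _ (c, 0)) := by
      intro c i
      have e0 := h1 c 0
      have e1 := h1 c 1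
      have e2 := h1 c 2
      simp only [zero_add, Fin.reduceAdd] at e0 e1 e2
      fin_cases i
      · rfl
      · exact e0.symm
      · exact (e0.trans e1).symm
      · exact (e0.trans (e1.trans e2)).symm
    refine ⟨Quot.lift (fun d => f (Quot.mk _ d)) ?_, ?_⟩
    · rintro ⟨c, i⟩ ⟨c', i'⟩ (h | h)
      · obtain rfl : c = c' := h
        rw [h2 c i, h2 c i']
      · rw [h]
        exact h0 _
    · ext q
      induction q using Quot.ind
      rfl
  have : Fintype (Quot (Adjacent K.glue)) := Fintype.ofFinite _
  calc _ ≤ Module.finrank (ZMod 2) (LinearMap.range ψ) := Submodule.finrank_mono hle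
    _ ≤ Module.finrank (ZMod 2) (Quot (Adjacent K.glue) → ZMod 2) := LinearMap.finrank_range_le ψ
    _ = _ := by rw [Module.finrank_pi, Nat.card_eq_fintype_card]

/-- This is a dimension count. With `C` components and `F` regions the kernel has dimension at most
`2n - (n - C) = n + C`, the range has dimension at least `F - C`, and Euler's formula `F = n + 2C`
makes these bounds equal. -/
theorem range_regionBoundary_eq_ker :
    LinearMap.range K.regionBoundary = LinearMap.ker K.chainBoundary := by
  have : Fintype (Quot (NextOnRegion K.glue)) := Fintype.ofFinite _
  apply Submodule.eq_of_le_of_finrank_le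
  · rintro _ ⟨f, rfl⟩
    rw [LinearMap.mem_ker]
    ext c
    simp only [chainBoundary, regionBoundary, LinearMap.coe_mk, AddHom.coe_mk, K.mk_glue_region,
      Fin.sum_univ_four, Pi.zero_apply, zero_add, Fin.reduceAdd]
    have key : ∀ x₀ x₁ x₂ x₃ : ZMod 2, x₀ + x₁ + (x₁ + x₂) + (x₂ + x₃) + (x₃ + x₀) = 0 := by
      decide
    exact key _ _ _ _
  · have h1 := LinearMap.finrank_range_add_finrank_ker K.chainBoundary
    have h2 := LinearMap.finrank_range_add_finrank_ker K.regionBoundary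
    have h3 := K.finrank_ker_regionBoundary_le
    have h4 := K.le_finrank_range_chainBoundary
    have h5 := K.planar
    rw [K.finrank_edgeChains] at h1
    rw [Module.finrank_pi, ← Nat.card_eq_fintype_card] at h2
    omega

/-- On a planar diagram every mod 2 cycle of edges separates the regions: it is the set of edges
across which some function on the regions jumps. The value of the function on the region to the
right of a half-edge is attached to that half-edge. -/
theorem exists_region_function (a : HalfEdge n → ZMod 2) (ha : ∀ d, a (K.glue d) = a d)
    (hs : ∀ c, ∑ i, a (c, i) = 0) :
    ∃ f : HalfEdge n → ZMod 2, (∀ c i, f (K.glue (c, i)) = f (c, i + 1)) ∧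
      ∀ d, f d + f (K.glue d) = a d := by
  have h : (⟨a, ha⟩ : K.edgeChains) ∈ LinearMap.range K.regionBoundary := by
    rw [range_regionBoundary_eq_ker, LinearMap.mem_ker]
    exact funext hs
  obtain ⟨f, hf⟩ := h
  refine ⟨fun d => f (Quot.mk _ d), fun c i => congrArg f (K.mk_glue_region c i), fun d => ?_⟩
  exact congrFun (congrArg Subtype.val hf) d

end Homology

end LinkDiagram

end KhBurnside

namespace KhBurnside

/-! ## First return maps -/

theorem _root_.Equiv.Perm.SameCycle.exists_natPow {X : Type*} [Finite X] {σ : Equiv.Perm X}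
    {x y : X} (h : σ.SameCycle x y) : ∃ N : ℕ, (σ ^ N) x = y := by
  obtain ⟨N, -, hN⟩ := h.exists_pow_eq'
  exact ⟨N, hN⟩

/-- The first return map `π` of a permutation `ρ` to a finite subset computes the cycles of every
permutation obtained from `ρ` by composing with a permutation of that subset. -/
theorem exists_firstReturn {X T : Type*} [Finite X] [Finite T] (ρ : Equiv.Perm X) (f : T → X)
    (hf : Function.Injective f) :
    ∃ π : Equiv.Perm T, ∀ (τ : Equiv.Perm T) (σ : Equiv.Perm X),
      (∀ x, ρ x ∉ Set.range f → σ x = ρ x) → (∀ x t, ρ x = f t → σ x = f (τ t)) →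
      ∀ t t', σ.SameCycle (f t) (f t') ↔ (τ * π).SameCycle t t' := by
  classical
  -- The return time is `m t + 1`, hence positive; a return occurs at the latest after `orderOf ρ`
  -- steps.
  have hit : ∀ t, ∃ m, (ρ ^ (m + 1)) (f t) ∈ Set.range f := fun t => by
    refine ⟨orderOf ρ - 1, ?_⟩
    rw [Nat.sub_add_cancel (orderOf_pos ρ), pow_orderOf_eq_one]
    exact ⟨t, rfl⟩
  let m : T → ℕ := fun t => Nat.find (hit t)
  have hm : ∀ t, (ρ ^ (m t + 1)) (f t) ∈ Set.range f := fun t => Nat.find_spec (hit t)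
  have hlt : ∀ t j, j < m t → (ρ ^ (j + 1)) (f t) ∉ Set.range f := fun t j hj =>
    Nat.find_min (hit t) hj
  choose r hr using hm
  -- If two points return to the same place, cancelling the shorter time shows that the orbit with
  -- the longer return time meets the subset early, unless the times agree.
  have hinj' : ∀ t t', r t = r t' → m t ≤ m t' → t = t' := by
    intro t t' h hle
    have h1 : (ρ ^ (m t + 1)) (f t) = (ρ ^ (m t' + 1)) (f t') := by rw [← hr, ← hr, h]
    obtain ⟨j, hj⟩ := Nat.exists_eq_add_of_le hle
    have h2 : f t = (ρ ^ j) (f t') := by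
      have : m t' + 1 = (m t + 1) + j := by omega
      rw [this, pow_add ρ (m t + 1) j, Equiv.Perm.mul_apply] at h1
      exact (ρ ^ (m t + 1)).injective h1
    rcases j with _ | j
    · exact hf h2
    · exact absurd ⟨t, h2⟩ (hlt t' j (by omega))
  have hinj : Function.Injective r := fun t t' h => by
    rcases le_total (m t) (m t') with hle | hle
    · exact hinj' t t' h hle
    · exact (hinj' t' t h.symm hle).symm
  refine ⟨Equiv.ofBijective r (Finite.injective_iff_bijective.1 hinj), ?_⟩
  intro τ σ hσ hσ' t t'
  have hpow : ∀ t j, j ≤ m t → (σ ^ j) (f t) = (ρ ^ j) (f t) := by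
    intro t j
    induction j with
    | zero => intro _; rfl
    | succ j ih =>
      intro hj
      rw [pow_succ', Equiv.Perm.mul_apply, ih (by omega), pow_succ', Equiv.Perm.mul_apply]
      apply hσ
      rw [← Equiv.Perm.mul_apply, ← pow_succ']
      exact hlt t j (by omega)
  -- Before its return the orbit avoids the subset, where `σ` and `ρ` agree, so `τ` acts only at the
  -- last step: the first return map of `σ` is `τ * π`.
  have hret : ∀ t, (σ ^ (m t + 1)) (f t) = f (τ (r t)) := by
    intro t
    rw [pow_succ', Equiv.Perm.mul_apply, hpow t _ le_rfl]
    apply hσ'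
    rw [← Equiv.Perm.mul_apply, ← pow_succ', hr]
  constructor
  · intro h
    obtain ⟨N, hN⟩ := h.exists_natPow
    induction N using Nat.strong_induction_on generalizing t with
    | _ N ih =>
      rcases Nat.eq_zero_or_pos N with rfl | hpos
      · exact (hf hN) ▸ Equiv.Perm.SameCycle.refl _ _
      · by_cases hle : N ≤ m t
        · refine absurd ⟨t', ?_⟩ (hlt t (N - 1) (by omega))
          rw [Nat.sub_add_cancel hpos, ← hpow t N hle, hN]
        · have h1 : (σ ^ (N - (m t + 1))) (f (τ (r t))) = f t' := by
            rw [← hret, ← Equiv.Perm.mul_apply, ← pow_add, ← hN]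
            congr 2
            omega
          have h2 := ih _ (by omega) (τ (r t)) ⟨(N - (m t + 1) : ℕ), by rw [zpow_natCast, h1]⟩ h1
          exact (Equiv.Perm.sameCycle_apply_left (f := τ * Equiv.ofBijective r _)).1 h2
  · intro h
    obtain ⟨N, hN⟩ := h.exists_natPow
    rw [← hN]
    clear h hN
    induction N with
    | zero => exact Equiv.Perm.SameCycle.refl _ _
    | succ N ih =>
      refine ih.trans ?_
      rw [pow_succ', Equiv.Perm.mul_apply]
      generalize ((τ * Equiv.ofBijective r _) ^ N) t = s
      refine ⟨(m s + 1 : ℕ), ?_⟩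
      rw [zpow_natCast, hret]
      rfl

namespace LinkDiagram

variable {n : ℕ} (K : LinkDiagram n)

/-! ## Source-sink orientations -/

/-- The boundary orientation of one colour class of a checkerboard colouring: the half-edges around
a crossing are alternately outgoing and incoming. -/
structure Orientation where
  out : HalfEdge n → Bool
  out_glue : ∀ d, out (K.glue d) = !out d
  out_succ : ∀ c i, out (c, i + 1) = !out (c, i)

/-- All edges together form a mod 2 cycle, since every crossing has four half-edges. The function
that jumps across every edge is the checkerboard colouring. -/
theorem nonempty_orientation : Nonempty K.Orientation := by
  obtain ⟨f, hf, hf'⟩ := K.exists_region_function 1 (fun _ => rfl) (fun _ => by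
    simp only [Pi.one_apply]; decide)
  have key : ∀ x y : ZMod 2, x + y = 1 → decide (y = 1) = !decide (x = 1) := by decide
  exact ⟨⟨fun d => decide (f d = 1), fun d => key _ _ (hf' d), fun c i => by
    rw [← hf]
    exact key _ _ (hf' _)⟩⟩

variable {K}

theorem resolve_resolve (v : Cube n) (d : HalfEdge n) : resolve v (resolve v d) = d := by
  obtain ⟨c, i⟩ := d
  simp only [resolve]
  cases v c <;> fin_cases i <;> rfl

theorem resolve_congr {v w : Cube n} {d : HalfEdge n} (h : v d.1 = w d.1) :
    resolve v d = resolve w d := by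
  simp only [resolve, h]

/-- Both resolutions join cyclically neighbouring half-edges, so every arc leads from an incoming to
an outgoing half-edge and the orientation descends to each `K_v`. -/
theorem Orientation.out_resolve (o : K.Orientation) (v : Cube n) (d : HalfEdge n) :
    o.out (resolve v d) = !o.out d := by
  obtain ⟨c, i⟩ := d
  have e0 := o.out_succ c 0
  have e1 := o.out_succ c 1
  have e2 := o.out_succ c 2
  simp only [zero_add, Fin.reduceAdd] at e0 e1 e2
  simp only [resolve]
  cases v c <;> fin_cases i <;> simp [e0, e1, e2]

theorem circle_glue (v : Cube n) (d : HalfEdge n) : K.circle v (K.glue d) = K.circle v d :=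
  congrArg Sum.inl (Quot.sound (r := fun d d' : HalfEdge n => d' = K.glue d ∨ d' = resolve v d)
    (Or.inl rfl)).symm

theorem circle_resolve (v : Cube n) (d : HalfEdge n) : K.circle v (resolve v d) = K.circle v d :=
  congrArg Sum.inl (Quot.sound (r := fun d d' : HalfEdge n => d' = K.glue d ∨ d' = resolve v d)
    (Or.inr rfl)).symm

/-- A function on half-edges that is constant along the arcs of `K_v` is constant on circles. -/
theorem eq_of_circle_eq {α : Sort*} {v : Cube n} (F : HalfEdge n → α)
    (hg : ∀ d, F (K.glue d) = F d) (hr : ∀ d, F (resolve v d) = F d) {d d' : HalfEdge n}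
    (h : K.circle v d = K.circle v d') : F d = F d' := by
  have h' := Sum.inl.inj h
  exact congrArg (Quot.lift F (by
    rintro a b (rfl | rfl)
    · exact (hg a).symm
    · exact (hr a).symm)) h'

/-- The surgery arcs of two interlaced crossings lie on different sides of their circle. -/
theorem Orientation.out_ne_of_interlaced (o : K.Orientation) {v w : Cube n} (h : CubeEdge v w)
    {c' : Fin n} (hc : c' ≠ h.coord) (hwc : w h.coord = false) (hwc' : w c' = false)
    (hw : K.circle w (c', 0) = K.circle w (c', 2))
    (hv' : ¬ (K.circle v (c', 0) = K.circle v (h.coord, 0) ↔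
      K.circle v (c', 2) = K.circle v (h.coord, 0))) :
    o.out (h.coord, 0) ≠ o.out (c', 0) := by
  classical
  intro heq
  have hvw : ∀ x, x ≠ h.coord → v x = w x := fun x hx => by
    by_contra hne
    exact hx (h.existsUnique_ne.unique hne h.coord_spec)
  -- The circle of `K_v` through the surgery site, as a mod 2 cycle; below, `f` tells its inside
  -- from its outside.
  let a : HalfEdge n → ZMod 2 := fun d =>
    if K.circle v d = K.circle v (h.coord, 0) then 1 else 0
  have hag : ∀ d, a (K.glue d) = a d := fun d => by simp only [a, circle_glue]
  have har : ∀ d, a (resolve v d) = a d := fun d => by simp only [a, circle_resolve]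
  have hpair : ∀ c, v c = false → a (c, 1) = a (c, 0) ∧ a (c, 3) = a (c, 2) := fun c hc =>
    ⟨by simpa [resolve, hc] using har (c, 0), by simpa [resolve, hc] using har (c, 2)⟩
  have hpair' : ∀ c, v c = true → a (c, 3) = a (c, 0) ∧ a (c, 2) = a (c, 1) := fun c hc =>
    ⟨by simpa [resolve, hc] using har (c, 0), by simpa [resolve, hc] using har (c, 1)⟩
  have hsum : ∀ c, ∑ i, a (c, i) = 0 := by
    intro c
    rw [Fin.sum_univ_four]
    have key : ∀ x y : ZMod 2, x + x + y + y = 0 ∧ x + y + y + x = 0 := by decide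
    cases hvc : v c
    · rw [(hpair c hvc).1, (hpair c hvc).2]
      exact (key _ _).1
    · rw [(hpair' c hvc).1, (hpair' c hvc).2]
      exact (key _ _).2
  obtain ⟨f, hf, hf'⟩ := K.exists_region_function a hag hsum
  have hstep : ∀ c i, f (c, i + 1) = f (c, i) + a (c, i) := fun c i => by
    rw [← hf, ← hf' (c, i), ← add_assoc, CharTwo.add_self_eq_zero, zero_add]
  -- Push the oriented curve `K_w` to the side away from the surgery arc at `h.coord`, and read `f`
  -- there. The pushed curve does not meet the surgery arc, so it will turn out not to cross the
  -- circle `a`.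
  let F : HalfEdge n → ZMod 2 := fun d =>
    if o.out d = o.out (h.coord, 0) then f (K.glue d) else f d
  have hFg : ∀ d, F (K.glue d) = F d := by
    intro d
    simp only [F, o.out_glue, K.glue_glue]
    cases o.out d <;> cases o.out (h.coord, 0) <;> simp
  have e0 : ∀ c, o.out (c, 1) = !o.out (c, 0) := fun c => o.out_succ c 0
  have e1 : ∀ c, o.out (c, 2) = o.out (c, 0) := fun c => by
    rw [← Bool.not_not (o.out (c, 0)), ← e0]
    exact o.out_succ c 1
  have e2 : ∀ c, o.out (c, 3) = !o.out (c, 0) := fun c => by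
    rw [← e1]
    exact o.out_succ c 2
  have g0 : ∀ c, f (c, 1) = f (c, 0) + a (c, 0) := fun c => hstep c 0
  have g1 : ∀ c, f (c, 2) = f (c, 1) + a (c, 1) := fun c => hstep c 1
  have g2 : ∀ c, f (c, 3) = f (c, 2) + a (c, 2) := fun c => hstep c 2
  have g3 : ∀ c, f (c, 0) = f (c, 3) + a (c, 3) := fun c => hstep c 3
  -- At a crossing of the same type as `h.coord`, the side in question consists of the two corners
  -- cut off by the arcs `01` and `23`; at one of the other type, of those cut off by `03` and `12`.
  have hF : ∀ c, (o.out (c, 0) = o.out (h.coord, 0) → F (c, 0) = f (c, 1) ∧ F (c, 1) = f (c, 1) ∧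
      F (c, 2) = f (c, 3) ∧ F (c, 3) = f (c, 3)) ∧ (o.out (c, 0) ≠ o.out (h.coord, 0) →
      F (c, 0) = f (c, 0) ∧ F (c, 1) = f (c, 2) ∧ F (c, 2) = f (c, 2) ∧ F (c, 3) = f (c, 0)) := by
    intro c
    have k0 := hf c 0
    have k1 := hf c 1
    have k2 := hf c 2
    have k3 := hf c 3
    simp only [zero_add, Fin.reduceAdd] at k0 k1 k2 k3
    constructor
    · intro hc
      simp [F, e0, e1, e2, hc, k0, k2]
    · intro hc
      have hc' : (!o.out (c, 0)) = o.out (h.coord, 0) := by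
        revert hc
        cases o.out (c, 0) <;> cases o.out (h.coord, 0) <;> simp
      simp [F, e0, e1, e2, hc, hc', k1, k3]
  have hFr : ∀ d, F (resolve w d) = F d := by
    rintro ⟨c, i⟩
    have key : ∀ x y : ZMod 2, x + y + y = x := by decide
    by_cases hcc : c = h.coord
    · subst hcc
      obtain ⟨k0, k1, k2, k3⟩ := (hF h.coord).1 rfl
      simp only [resolve, hwc]
      fin_cases i <;> simp [k0, k1, k2, k3]
    · have hvc := hvw c hcc
      by_cases ho : o.out (c, 0) = o.out (h.coord, 0)
      -- Where the arcs of `K_w` do not cut off these corners, `K_v` has the same arcs, and `f` does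
      -- not change across a pair of strands that both belong to `a` or both do not.
      · obtain ⟨k0, k1, k2, k3⟩ := (hF c).1 ho
        cases hwx : w c
        · simp only [resolve, hwx]
          fin_cases i <;> simp [k0, k1, k2, k3]
        · have hp := (hpair' c (hvc.trans hwx)).2
          have : f (c, 3) = f (c, 1) := by rw [g2, g1, hp, key]
          simp only [resolve, hwx]
          fin_cases i <;> simp [k0, k1, k2, k3, this]
      · obtain ⟨k0, k1, k2, k3⟩ := (hF c).2 ho
        cases hwx : w c
        · have hp := (hpair c (hvc.trans hwx)).1
          have : f (c, 2) = f (c, 0) := by rw [g1, g0, hp, key]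
          simp only [resolve, hwx]
          fin_cases i <;> simp [k0, k1, k2, k3, this]
        · simp only [resolve, hwx]
          fin_cases i <;> simp [k0, k1, k2, k3]
  -- Both arcs at `c'` lie on one circle of `K_w`, so `f` agrees at the two opposite corners there.
  -- This forces `a` to contain both arcs or neither, against the interlacing.
  have hconst := eq_of_circle_eq F hFg hFr hw
  obtain ⟨k0, -, k2, -⟩ := (hF c').1 heq.symm
  rw [k0, k2, g2, g1] at hconst
  have hp := (hpair c' ((hvw c' hc).trans hwc')).1
  have key : ∀ x y z : ZMod 2, x = x + y + z → y = z := by decide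
  have h02 : a (c', 0) = a (c', 2) := hp ▸ key _ _ _ hconst
  apply hv'
  by_cases p : K.circle v (c', 0) = K.circle v (h.coord, 0) <;>
    by_cases q : K.circle v (c', 2) = K.circle v (h.coord, 0)
  · exact iff_of_true p q
  · exact absurd h02 (by simp [a, p, q])
  · exact absurd h02 (by simp [a, p, q])
  · exact iff_of_false p q

end LinkDiagram

end KhBurnside

namespace KhBurnside

/-! ## Packed permutations and their orbits

The functions of this section are evaluated by the kernel. They are written with recursors and the
binary operations on natural numbers. A function `f` with `f i < 2 ^ w` for `i < m` is packed into
the number with base `2 ^ w` digits `f 0, …, f (m - 1)`; a set of numbers is packed into the number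
with these binary digits. -/

namespace Packed

/-- `strict a k` is `k a`; its evaluation begins with `a`. -/
def strict {α : Type} (a : ℕ) (k : ℕ → α) : α := Nat.rec (k 0) (fun b _ => k (Nat.succ b)) a

theorem strict_eq {α : Type} (a : ℕ) (k : ℕ → α) : strict a k = k a := by
  cases a <;> rfl

/-- The binary digit `i` of `y`. -/
def bit (y i : ℕ) : Bool := Nat.beq (Nat.land (Nat.shiftRight y i) 1) 1

theorem bit_eq_testBit (y i : ℕ) : bit y i = y.testBit i := by
  have h : Nat.land (Nat.shiftRight y i) 1 = (y >>> i) % 2 := Nat.and_one_is_mod _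
  rw [bit, h, Nat.testBit_eq_decide_div_mod_eq, Nat.shiftRight_eq_div_pow, Bool.eq_iff_iff,
    decide_eq_true_iff]
  exact Iff.of_eq Nat.beq_eq

/-- `allBelow f m` says that `f i` holds for all `i < m`. -/
def allBelow (f : ℕ → Bool) (m : ℕ) : Bool := Nat.rec true (fun i ih => cond (f i) ih false) m

theorem allBelow_iff {f : ℕ → Bool} {m : ℕ} : allBelow f m = true ↔ ∀ i < m, f i = true := by
  induction m with
  | zero => simp [allBelow]
  | succ m ih =>
    have h : allBelow f (m + 1) = cond (f m) (allBelow f m) false := rfl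
    rw [h, Nat.forall_lt_succ_right]
    cases hf : f m <;> simp [ih]

/-- The number with base `2 ^ w` digits `f (m - d), …, f (m - 1)`. -/
def pack (w : ℕ) (f : ℕ → ℕ) (m d : ℕ) : ℕ :=
  Nat.rec 0 (fun i ih => Nat.add (Nat.mul ih (Nat.pow 2 w)) (f (Nat.sub m (Nat.succ i)))) d

/-- The base `2 ^ w` digit `i` of `X`. -/
def digit (w X i : ℕ) : ℕ := Nat.mod (Nat.shiftRight X (Nat.mul w i)) (Nat.pow 2 w)

theorem pack_succ (w : ℕ) (f : ℕ → ℕ) (m d : ℕ) :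
    pack w f m (d + 1) = pack w f m d * 2 ^ w + f (m - (d + 1)) := rfl

theorem pack_lt {w : ℕ} {f : ℕ → ℕ} {m : ℕ} (hf : ∀ i < m, f i < 2 ^ w) {d : ℕ} (hd : d ≤ m) :
    pack w f m d < 2 ^ (w * d) := by
  induction d with
  | zero => exact Nat.one_pos
  | succ d ih =>
    rw [pack_succ, Nat.mul_succ, pow_add]
    have h1 := ih (by omega)
    have h2 := hf (m - (d + 1)) (by omega)
    calc _ < pack w f m d * 2 ^ w + 1 * 2 ^ w := by omega
      _ = (pack w f m d + 1) * 2 ^ w := by ring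
      _ ≤ _ := Nat.mul_le_mul_right _ h1

theorem digit_pack {w : ℕ} {f : ℕ → ℕ} {m : ℕ} (hf : ∀ i < m, f i < 2 ^ w) {i : ℕ} (hi : i < m) :
    digit w (pack w f m m) i = f i := by
  have hdiv : ∀ s d, s + d ≤ m → pack w f m (d + s) / 2 ^ (w * s) = pack w f m d := by
    intro s d h
    induction s with
    | zero => simp
    | succ s ih =>
      rw [← add_assoc, pack_succ, Nat.mul_succ, add_comm (w * s), pow_add, ← Nat.div_div_eq_div_mul,
        add_comm, Nat.add_mul_div_right _ _ (by positivity),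
        Nat.div_eq_of_lt (hf _ (by omega)), zero_add]
      exact ih (by omega)
  have h := hdiv i (m - i) (by omega)
  rw [Nat.sub_add_cancel hi.le] at h
  have h' : digit w (pack w f m m) i = pack w f m m / 2 ^ (w * i) % 2 ^ w := by
    rw [← Nat.shiftRight_eq_div_pow]
    rfl
  obtain ⟨d, hd⟩ : ∃ d, m - i = d + 1 := ⟨m - i - 1, by omega⟩
  have hlt := hf i hi
  rw [h', h, hd, pack_succ, Nat.mul_add_mod_of_lt]
  · congr 1
    omega
  · rwa [show m - (d + 1) = i by omega]

/-- `allPerms m chk f P used` says that `chk` holds for all extensions of `P` by `f` further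
distinct digits less than `m` that are not in `used`. -/
def allPerms (m : ℕ) (chk : ℕ → Bool) (f : ℕ) : ℕ → ℕ → Bool :=
  Nat.rec (fun P _ => chk P) (fun _ ih P used => allBelow (fun a =>
    cond (bit used a) true (strict (Nat.add (Nat.mul P (Nat.pow 2 3)) a) fun P' =>
      strict (Nat.lor used (Nat.shiftLeft 1 a)) fun used' => ih P' used')) m) f

/-- The search tree chooses the values from index `m - 1` down to `0`; injectivity of `p` keeps its
own branch from being pruned by `used`. -/
theorem allPerms_sound {m : ℕ} {chk : ℕ → Bool} (h : allPerms m chk m 0 0 = true) {p : ℕ → ℕ}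
    (hp : ∀ i < m, p i < m) (hinj : ∀ i < m, ∀ j < m, p i = p j → i = j) :
    chk (pack 3 p m m) = true := by
  have key : ∀ f d used, f + d = m →
      (∀ a, used.testBit a = true → ∃ j, m ≤ j + d ∧ j < m ∧ p j = a) →
      allPerms m chk f (pack 3 p m d) used = true → chk (pack 3 p m m) = true := by
    intro f
    induction f with
    | zero =>
      intro d used hd _ h
      obtain rfl : d = m := by omega
      exact h
    | succ f ih =>
      intro d used hd hused h
      have h1 := allBelow_iff.1 h (p (m - (d + 1))) (hp _ (by omega))
      have hbit : bit used (p (m - (d + 1))) = false := by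
        rw [bit_eq_testBit]
        by_contra hb
        obtain ⟨j, hj1, hj2, hj3⟩ := hused _ (by simpa using hb)
        have := hinj _ hj2 _ (by omega) hj3
        omega
      rw [hbit, cond_false, strict_eq, strict_eq] at h1
      refine ih (d + 1) _ (by omega) ?_ h1
      intro a ha
      have ha' : (used ||| 1 <<< p (m - (d + 1))).testBit a = true := ha
      rw [Nat.testBit_or, Nat.one_shiftLeft, Nat.testBit_two_pow, Bool.or_eq_true,
        decide_eq_true_iff] at ha'
      rcases ha' with ha' | ha'
      · obtain ⟨j, hj1, hj2, hj3⟩ := hused a ha'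
        exact ⟨j, by omega, hj2, hj3⟩
      · exact ⟨m - (d + 1), by omega, by omega, ha'⟩
  exact key m 0 0 (by omega) (by simp) h

/-- Exchange `2 j` and `2 j + 1` for all elements `j` of `S`. -/
def twist (S s : ℕ) : ℕ :=
  cond (bit S (Nat.div s 2)) (Nat.sub (Nat.add s 1) (Nat.mul 2 (Nat.mod s 2))) s

/-- The set of all `Q^i t` with `1 ≤ i ≤ f`, united with `a`, for a packed permutation `Q`. -/
def orbit (Q f : ℕ) : ℕ → ℕ → ℕ :=
  Nat.rec (fun _ a => a) (fun _ ih t a =>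
    strict (digit 3 Q t) fun t' => ih t' (Nat.lor a (Nat.shiftLeft 1 t'))) f

/-- The orbits of `twist S ∘ P` for all `S < ns`. -/
def table (m ns P : ℕ) : ℕ :=
  pack 64 (fun S => strict (pack 3 (fun t => strict (digit 3 P t) (twist S)) m m) fun Q =>
    pack 8 (fun t => orbit Q m t 0) m m) ns ns

/-- The orbit of `t` under `twist S ∘ P`, read off from `table m ns P`. -/
def look (W S t : ℕ) : ℕ := digit 8 (digit 64 W S) t

theorem twist_twist (S s : ℕ) : twist S (twist S s) = s := by
  have h : ∀ s, twist S s = if bit S (s / 2) = true then s + 1 - 2 * (s % 2) else s := fun s => by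
    rw [← Bool.cond_eq_ite]
    rfl
  rw [h s]
  split_ifs with h1
  · have h2 : (s + 1 - 2 * (s % 2)) / 2 = s / 2 := by omega
    rw [h, h2, if_pos h1]
    omega
  · rw [h, if_neg h1]

theorem twist_lt {S s k : ℕ} (hs : s < 2 * k) : twist S s < 2 * k := by
  have h : twist S s = if bit S (s / 2) = true then s + 1 - 2 * (s % 2) else s := by
    rw [← Bool.cond_eq_ite]
    rfl
  rw [h]
  split_ifs <;> omega

theorem testBit_orbit (Q f t a x : ℕ) : (orbit Q f t a).testBit x = true ↔
    a.testBit x = true ∨ ∃ i, 0 < i ∧ i ≤ f ∧ (digit 3 Q)^[i] t = x := by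
  induction f generalizing t a with
  | zero =>
    refine ⟨Or.inl, ?_⟩
    rintro (h | ⟨i, h1, h2, -⟩)
    · exact h
    · omega
  | succ f ih =>
    have h : orbit Q (f + 1) t a = orbit Q f (digit 3 Q t) (a ||| 1 <<< digit 3 Q t) :=
      strict_eq (digit 3 Q t) fun t' => orbit Q f t' (Nat.lor a (Nat.shiftLeft 1 t'))
    rw [h, ih, Nat.testBit_or, Nat.one_shiftLeft, Nat.testBit_two_pow, Bool.or_eq_true,
      decide_eq_true_iff, or_assoc]
    refine or_congr Iff.rfl ⟨?_, ?_⟩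
    · rintro (h | ⟨i, h1, h2, h3⟩)
      · exact ⟨1, by omega, by omega, h⟩
      · exact ⟨i + 1, by omega, by omega, h3⟩
    · rintro ⟨i, h1, h2, h3⟩
      obtain ⟨i, rfl⟩ : ∃ j, i = j + 1 := ⟨i - 1, by omega⟩
      rcases Nat.eq_zero_or_pos i with rfl | hi
      · exact Or.inl h3
      · exact Or.inr ⟨i, hi, by omega, h3⟩

/-- The permutation `twist S` of the numbers less than `2 k`. -/
def twistPerm (k S : ℕ) : Equiv.Perm (Fin (2 * k)) :=
  Function.Involutive.toPerm (fun t => ⟨twist S t, twist_lt t.2⟩)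
    fun t => Fin.ext (twist_twist S t)

/-- The iterates up to the least positive exponent that reaches `t'` are distinct, which bounds it
by `m`. Positive exponents suffice even for `t = t'`, in agreement with `orbit`, which starts after
one step. -/
theorem sameCycle_iff_exists_pow {m : ℕ} (σ : Equiv.Perm (Fin m)) (t t' : Fin m) :
    σ.SameCycle t t' ↔ ∃ i, 0 < i ∧ i ≤ m ∧ (σ ^ i) t = t' := by
  classical
  constructor
  · intro h
    obtain ⟨N, hN, -, hN'⟩ := h.exists_pow_eq''
    have hex : ∃ N, 0 < N ∧ (σ ^ N) t = t' := ⟨N, hN, hN'⟩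
    obtain ⟨h0, h1⟩ := Nat.find_spec hex
    have hmin := fun i hi => Nat.find_min hex (m := i) hi
    generalize Nat.find hex = M at h0 h1 hmin
    refine ⟨M, h0, ?_, h1⟩
    have hlt : ∀ i j, i < j → j < M → (σ ^ (i + 1)) t ≠ (σ ^ (j + 1)) t := by
      intro i j hij hj heq
      apply hmin (M - 1 - j + (i + 1)) (by omega)
      refine ⟨by omega, ?_⟩
      rw [pow_add, Equiv.Perm.mul_apply, heq, ← Equiv.Perm.mul_apply, ← pow_add, ← h1]
      congr 2
      omega
    have hinj : Function.Injective (fun i : Fin M => (σ ^ (i.1 + 1)) t) := by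
      intro i j hij
      rcases lt_trichotomy i.1 j.1 with h | h | h
      · exact absurd hij (hlt _ _ h j.2)
      · exact Fin.ext h
      · exact absurd hij.symm (hlt _ _ h i.2)
    simpa using Fintype.card_le_of_injective _ hinj
  · rintro ⟨i, -, -, rfl⟩
    exact ⟨i, by rw [zpow_natCast]⟩

/-- The bound `k ≤ 3` makes the fixed widths sufficient: points are less than 6 and fit into 3 bits,
an orbit fits into 8 bits, and the at most six orbits of a row fit into 64 bits. -/
theorem look_table {k ns : ℕ} (hk : k ≤ 3) (π : Equiv.Perm (Fin (2 * k))) {p : ℕ → ℕ}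
    (hp : ∀ t : Fin (2 * k), p t = π t) {S : ℕ} (hS : S < ns) (t t' : Fin (2 * k)) :
    (bit (look (table (2 * k) ns (pack 3 p (2 * k) (2 * k))) S t) t' = true ↔
      (twistPerm k S * π).SameCycle t t') ∧
    look (table (2 * k) ns (pack 3 p (2 * k) (2 * k))) S t < 2 ^ (2 * k) := by
  have h8 : 2 * k ≤ 6 := by omega
  have hplt : ∀ i < 2 * k, p i < 2 ^ 3 := fun i hi => by
    have := hp ⟨i, hi⟩
    have := (π ⟨i, hi⟩).2
    simp only [] at *
    omega
  have horb : ∀ Q, (∀ t < 2 * k, digit 3 Q t < 2 * k) → ∀ t < 2 * k,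
      orbit Q (2 * k) t 0 < 2 ^ (2 * k) := by
    intro Q hQ t ht
    have hit : ∀ i, (digit 3 Q)^[i] t < 2 * k := by
      intro i
      induction i with
      | zero => exact ht
      | succ i ih =>
        rw [Function.iterate_succ_apply']
        exact hQ _ ih
    apply Nat.lt_pow_two_of_testBit
    intro i hi
    by_contra hb
    rw [Bool.not_eq_false, testBit_orbit] at hb
    rcases hb with hb | ⟨j, -, -, hj⟩
    · simp at hb
    · have := hit j
      omega
  let Q : ℕ → ℕ := fun S => pack 3 (fun t => strict (digit 3 (pack 3 p (2 * k) (2 * k)) t)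
    (twist S)) (2 * k) (2 * k)
  have hQ : ∀ S, ∀ s : Fin (2 * k), digit 3 (Q S) s = (twistPerm k S * π) s := by
    intro S s
    have h1 : ∀ t < 2 * k, strict (digit 3 (pack 3 p (2 * k) (2 * k)) t) (twist S) =
        twist S (p t) := fun t ht => by rw [strict_eq, digit_pack hplt ht]
    have h2 : ∀ t < 2 * k, strict (digit 3 (pack 3 p (2 * k) (2 * k)) t) (twist S) < 2 * k := by
      intro t ht
      rw [h1 t ht]
      apply twist_lt
      rw [hp ⟨t, ht⟩]
      exact (π _).2
    rw [digit_pack (fun t ht => (h2 t ht).trans_le (by omega)) s.2, h1 s s.2, hp s]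
    rfl
  have hQlt : ∀ S, ∀ t < 2 * k, digit 3 (Q S) t < 2 * k := fun S t ht => by
    rw [hQ S ⟨t, ht⟩]
    exact Fin.is_lt _
  have horb' : ∀ S, ∀ t < 2 * k, orbit (Q S) (2 * k) t 0 < 2 ^ 8 := fun S t ht =>
    (horb _ (hQlt S) t ht).trans_le (Nat.pow_le_pow_right two_pos (by omega))
  have hrow : ∀ S, pack 8 (fun t => orbit (Q S) (2 * k) t 0) (2 * k) (2 * k) < 2 ^ 64 := fun S =>
    (pack_lt (horb' S) le_rfl).trans_le (Nat.pow_le_pow_right (by norm_num) (by omega))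
  have hlook : look (table (2 * k) ns (pack 3 p (2 * k) (2 * k))) S t =
      orbit (Q S) (2 * k) t 0 := by
    rw [look, table, digit_pack (w := 64) _ hS]
    · rw [strict_eq]
      exact digit_pack (horb' S) t.2
    · intro S _
      rw [strict_eq]
      exact hrow S
  refine ⟨?_, hlook ▸ horb _ (hQlt S) t t.2⟩
  rw [bit_eq_testBit, hlook, testBit_orbit, sameCycle_iff_exists_pow]
  have hiter : ∀ i, (digit 3 (Q S))^[i] t = ((twistPerm k S * π) ^ i) t := by
    intro i
    induction i with
    | zero => rfl
    | succ i ih =>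
      rw [Function.iterate_succ_apply', ih, hQ, pow_succ']
      rfl
  simp only [Nat.zero_testBit, Bool.false_eq_true, false_or, hiter, Fin.ext_iff]

end Packed

end KhBurnside

namespace KhBurnside

open Packed

/-! ## Circles near a few crossings -/

/-- A face of the cube: the vertices that agree with `base` except at the coordinates
`coord 0, …, coord (k - 1)`. -/
structure Frame (n k : ℕ) where
  base : Cube n
  coord : ℕ → Fin n
  inj : ∀ i < k, ∀ j < k, coord i = coord j → i = j
  base_coord : ∀ j < k, base (coord j) = false

namespace Frame

variable {n k : ℕ} (f : Frame n k)

open Classical in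
/-- The vertex whose coordinates in the face are the binary digits of `S`. -/
def point (S : ℕ) : Cube n := fun x =>
  if ∃ j < k, f.coord j = x ∧ bit S j = true then true else f.base x

/-- The vertices of the face. -/
def Mem (v : Cube n) : Prop := ∀ x, (∀ j < k, f.coord j ≠ x) → v x = f.base x

theorem point_mem (S : ℕ) : f.Mem (f.point S) := fun _ hx =>
  if_neg fun ⟨j, hj, h, _⟩ => hx j hj h

theorem point_coord (S : ℕ) {j : ℕ} (hj : j < k) : f.point S (f.coord j) = bit S j := by
  by_cases h : bit S j = true
  · rw [h]
    exact if_pos ⟨j, hj, rfl, h⟩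
  · rw [Bool.not_eq_true] at h
    rw [h, ← f.base_coord j hj]
    refine if_neg ?_
    rintro ⟨i, hi, hij, hb⟩
    rw [f.inj i hi j hj hij, h] at hb
    exact absurd hb (by simp)

theorem point_of_ne (S : ℕ) {x : Fin n} (hx : ∀ j < k, f.coord j ≠ x) :
    f.point S x = f.base x := f.point_mem S x hx

theorem point_zero : f.point 0 = f.base := by
  ext x
  refine if_neg ?_
  rintro ⟨i, -, -, hb⟩
  rw [bit_eq_testBit, Nat.zero_testBit] at hb
  exact absurd hb (by simp)

end Frame

/-! ### Circles as cycles of the walk along outgoing half-edges. -/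

namespace LinkDiagram

variable {n k : ℕ} {K : LinkDiagram n}

/-- The outgoing half-edges at the crossings `c 0, c 1, …`, two at each crossing. -/
def Orientation.port (o : K.Orientation) (c : ℕ → Fin n) (t : ℕ) : HalfEdge n :=
  (c (t / 2), if o.out (c (t / 2), 0) then (if t % 2 = 0 then 0 else 2)
    else (if t % 2 = 0 then 1 else 3))

theorem Orientation.out_one (o : K.Orientation) (c : Fin n) : o.out (c, 1) = !o.out (c, 0) :=
  o.out_succ c 0

theorem Orientation.out_two (o : K.Orientation) (c : Fin n) : o.out (c, 2) = o.out (c, 0) := by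
  rw [← Bool.not_not (o.out (c, 0)), ← o.out_one]
  exact o.out_succ c 1

theorem Orientation.out_three (o : K.Orientation) (c : Fin n) : o.out (c, 3) = !o.out (c, 0) := by
  rw [← o.out_two]
  exact o.out_succ c 2

theorem Orientation.out_port (o : K.Orientation) (c : ℕ → Fin n) (t : ℕ) :
    o.out (o.port c t) = true := by
  unfold Orientation.port
  split_ifs with h1 h2 h2 <;> simp_all [o.out_one, o.out_two, o.out_three]

theorem Orientation.port_two_mul (o : K.Orientation) (c : ℕ → Fin n) (j : ℕ) :
    o.port c (2 * j) = (c j, if o.out (c j, 0) then 0 else 1) := by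
  have h1 : 2 * j / 2 = j := by omega
  have h2 : 2 * j % 2 = 0 := by omega
  simp only [Orientation.port, h1, h2, if_true]

theorem Orientation.port_two_mul_add_one (o : K.Orientation) (c : ℕ → Fin n) (j : ℕ) :
    o.port c (2 * j + 1) = (c j, if o.out (c j, 0) then 2 else 3) := by
  have h1 : (2 * j + 1) / 2 = j := by omega
  have h2 : (2 * j + 1) % 2 = 1 := by omega
  simp only [Orientation.port, h1, h2, one_ne_zero, if_false]

theorem Orientation.exists_eq_port (o : K.Orientation) (c : ℕ → Fin n) {d : HalfEdge n}
    (hd : o.out d = true) {j : ℕ} (hj : c j = d.1) : ∃ b < 2, d = o.port c (2 * j + b) := by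
  obtain ⟨c', i⟩ := d
  obtain rfl : c j = c' := hj
  have h1 := o.out_one (c j)
  have h2 := o.out_two (c j)
  have h3 := o.out_three (c j)
  cases h0 : o.out (c j, 0) <;> rw [h0] at h1 h2 h3 <;> fin_cases i <;> simp_all
  · exact ⟨0, by omega, by simp [o.port_two_mul, h0]⟩
  · exact ⟨1, by omega, by simp [o.port_two_mul_add_one, h0]⟩
  · exact ⟨0, by omega, by simp [o.port_two_mul, h0]⟩
  · exact ⟨1, by omega, by simp [o.port_two_mul_add_one, h0]⟩

/-- Every half-edge at one of the crossings lies on the same circle as a port. -/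
theorem Orientation.exists_circle_eq_port (o : K.Orientation) (c : ℕ → Fin n) (v : Cube n)
    (d : HalfEdge n) {j : ℕ} (hj : c j = d.1) :
    ∃ b < 2, K.circle v d = K.circle v (o.port c (2 * j + b)) := by
  cases hd : o.out d
  · obtain ⟨b, hb, h⟩ := o.exists_eq_port c (d := resolve v d) (by rw [o.out_resolve, hd]; rfl)
      (j := j) hj
    exact ⟨b, hb, by rw [← h, circle_resolve]⟩
  · obtain ⟨b, hb, h⟩ := o.exists_eq_port c hd hj
    exact ⟨b, hb, by rw [← h]⟩

/-- Walk along the circles of `K_v`, from an outgoing half-edge to the next one. -/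
def Orientation.walk (o : K.Orientation) (v : Cube n) :
    Equiv.Perm {d : HalfEdge n // o.out d = true} where
  toFun d := ⟨resolve v (K.glue d), by rw [o.out_resolve, o.out_glue, d.2]; rfl⟩
  invFun d := ⟨K.glue (resolve v d), by rw [o.out_glue, o.out_resolve, d.2]; rfl⟩
  left_inv d := Subtype.ext (by simp only [resolve_resolve, K.glue_glue])
  right_inv d := Subtype.ext (by simp only [resolve_resolve, K.glue_glue])

theorem Orientation.circle_eq_iff_sameCycle (o : K.Orientation) (v : Cube n)
    (d d' : {d : HalfEdge n // o.out d = true}) :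
    K.circle v d.1 = K.circle v d'.1 ↔ (o.walk v).SameCycle d d' := by
  constructor
  · intro h
    -- The outgoing end of the edge through `e`. It does not change under gluing and moves by one
    -- step of the walk, in one direction or the other, along an arc of the resolution.
    let tail : HalfEdge n → {d : HalfEdge n // o.out d = true} := fun e =>
      if he : o.out e = true then ⟨e, he⟩ else ⟨K.glue e, by rw [o.out_glue]; simpa using he⟩
    have htail : ∀ e : {d : HalfEdge n // o.out d = true}, tail e.1 = e := fun e => dif_pos e.2
    have htail' : ∀ e, o.out e = false → (tail e).1 = K.glue e := fun e he => by
      simp only [tail, he, Bool.false_eq_true, dif_neg, not_false_eq_true]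
    have key := eq_of_circle_eq (v := v) (fun e => (o.walk v).SameCycle d (tail e)) ?_ ?_ h
    · simp only [htail] at key
      exact key ▸ Equiv.Perm.SameCycle.refl _ _
    · intro e
      have : tail (K.glue e) = tail e := by
        cases he : o.out e
        · apply Subtype.ext
          rw [htail' e he]
          exact congrArg Subtype.val (htail ⟨K.glue e, by rw [o.out_glue, he]; rfl⟩)
        · apply Subtype.ext
          rw [htail' _ (by rw [o.out_glue, he]; rfl), K.glue_glue]
          exact congrArg Subtype.val (htail ⟨e, he⟩).symm
      simp only [this]
    · intro e
      cases he : o.out e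
      · have : tail (resolve v e) = o.walk v (tail e) := by
          apply Subtype.ext
          have h1 := congrArg Subtype.val
            (htail ⟨resolve v e, by rw [o.out_resolve, he]; rfl⟩)
          refine h1.trans ?_
          change _ = resolve v (K.glue (tail e).1)
          rw [htail' e he, K.glue_glue]
        simp only [this, Equiv.Perm.sameCycle_apply_right]
      · have : tail e = o.walk v (tail (resolve v e)) := by
          apply Subtype.ext
          have h1 := congrArg Subtype.val (htail ⟨e, he⟩)
          refine h1.trans ?_
          change _ = resolve v (K.glue (tail (resolve v e)).1)
          rw [htail' _ (by rw [o.out_resolve, he]; rfl), K.glue_glue, resolve_resolve]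
        rw [this, Equiv.Perm.sameCycle_apply_right]
  · intro h
    obtain ⟨N, rfl⟩ := h.exists_natPow
    clear h
    induction N with
    | zero => rfl
    | succ N ih =>
      rw [ih, pow_succ', Equiv.Perm.mul_apply]
      change _ = K.circle v (resolve v (K.glue _))
      rw [circle_resolve, circle_glue]

/-- The circles through the ports, at all vertices of a face, are given by one permutation. -/
theorem Orientation.exists_perm (o : K.Orientation) (f : Frame n k) (hk : k ≤ 3) :
    ∃ p : ℕ → ℕ, (∀ i < 2 * k, p i < 2 * k) ∧ (∀ i < 2 * k, ∀ j < 2 * k, p i = p j → i = j) ∧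
      ∀ ns S t t', S < ns → t < 2 * k → t' < 2 * k →
        (K.circle (f.point S) (o.port f.coord t) = K.circle (f.point S) (o.port f.coord t') ↔
          bit (look (table (2 * k) ns (pack 3 p (2 * k) (2 * k))) S t) t' = true) ∧
        look (table (2 * k) ns (pack 3 p (2 * k) (2 * k))) S t < 2 ^ (2 * k) := by
  let q : Fin (2 * k) → {d : HalfEdge n // o.out d = true} := fun t =>
    ⟨o.port f.coord t, o.out_port _ _⟩
  have hq : Function.Injective q := by
    intro t t' h
    have h1 := congrArg Subtype.val h
    have h2 := f.inj _ (by omega) _ (by omega) (congrArg Prod.fst h1)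
    have h3 := congrArg Prod.snd h1
    simp only [q, Orientation.port, ← h2] at h3
    apply Fin.ext
    split_ifs at h3 <;> omega
  -- At the bottom vertex take the first return map to the ports. The walk at `f.point S` differs
  -- from it only when a port is reached, where the other resolution leads to the other outgoing
  -- half-edge; this is `twist S`.
  obtain ⟨π, hπ⟩ := exists_firstReturn (o.walk f.base) q hq
  refine ⟨fun t => if h : t < 2 * k then π ⟨t, h⟩ else 0, fun i hi => ?_, fun i hi j hj h => ?_,
    fun ns S t t' hS ht ht' => ?_⟩
  · simp only [hi, dif_pos]
    exact Fin.is_lt _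
  · simp only [hi, hj, dif_pos] at h
    simpa using π.injective (Fin.ext h)
  · have hl := look_table hk π (p := fun t => if h : t < 2 * k then π ⟨t, h⟩ else 0)
      (fun t => by simp) hS ⟨t, ht⟩ ⟨t', ht'⟩
    refine ⟨?_, hl.2⟩
    rw [hl.1, ← hπ (twistPerm k S)
      (o.walk (f.point S))]
    · exact o.circle_eq_iff_sameCycle (f.point S) (q ⟨t, ht⟩) (q ⟨t', ht'⟩)
    · intro x hx
      apply Subtype.ext
      apply resolve_congr
      apply f.point_of_ne
      intro j hj hjx
      obtain ⟨b, hb, h⟩ := o.exists_eq_port f.coord (o.walk f.base x).2 (j := j) hjx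
      exact hx ⟨⟨2 * j + b, by omega⟩, Subtype.ext h.symm⟩
    · intro x t hx
      have hx1 : resolve f.base (K.glue x.1) = o.port f.coord t := congrArg Subtype.val hx
      have hx2 : K.glue x.1 = resolve f.base (o.port f.coord t) := by
        rw [← hx1, resolve_resolve]
      apply Subtype.ext
      change resolve (f.point S) (K.glue x.1) = o.port f.coord (twist S t)
      have ht : (t : ℕ) / 2 < k := by omega
      rw [hx2]
      cases hb : bit S (t / 2)
      · have h1 : twist S t = t := by
          change cond (bit S (t / 2)) _ _ = _
          rw [hb]
          rfl
        rw [h1, resolve_congr (w := f.base), resolve_resolve]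
        change f.point S (f.coord (t / 2)) = f.base (f.coord (t / 2))
        rw [f.point_coord S ht, f.base_coord _ ht, hb]
      · have h1 : twist S t = t + 1 - 2 * (t % 2) := by
          change cond (bit S (t / 2)) _ _ = _
          rw [hb]
          rfl
        have h2 : twist S t / 2 = t / 2 := by omega
        have h3 : twist S t % 2 = 1 - t % 2 := by omega
        have h4 := f.point_coord S ht
        rw [hb] at h4
        simp only [Orientation.port, resolve, h2, h3, h4, f.base_coord _ ht]
        rcases Nat.mod_two_eq_zero_or_one t with h5 | h5 <;> rw [h5] <;>
          cases o.out (f.coord (t / 2), 0) <;> rfl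

/-- A circle that avoids the crossings at which two vertices differ is unchanged. -/
theorem circle_eq_of_avoid {u v : Cube n} (A : Fin n → Prop) (huv : ∀ c, ¬ A c → u c = v c)
    {d d' : HalfEdge n} (hA : ∀ c i, A c → K.circle v d ≠ K.circle v (c, i))
    (h : K.circle v d = K.circle v d') : K.circle u d = K.circle u d' := by
  classical
  have key := eq_of_circle_eq (v := v)
    (fun e => if K.circle v d = K.circle v e then K.circle u e else K.circle u d) ?_ ?_ h
  · simpa [h] using key
  · intro e
    simp only [circle_glue]
  · intro e
    simp only [circle_resolve]
    by_cases he : A e.1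
    · rw [if_neg (hA _ _ he), if_neg (hA _ _ he)]
    · rw [← resolve_congr (v := u) (huv _ he), circle_resolve]

theorem circle_eq_iff_of_avoid {u v : Cube n} (A : Fin n → Prop) (huv : ∀ c, ¬ A c → u c = v c)
    {d : HalfEdge n} (hA : ∀ c i, A c → K.circle v d ≠ K.circle v (c, i)) (d' : HalfEdge n) :
    K.circle v d = K.circle v d' ↔ K.circle u d = K.circle u d' := by
  refine ⟨circle_eq_of_avoid A huv hA, fun h => ?_⟩
  have h' := eq_of_circle_eq (v := u) (fun e => K.circle v d = K.circle v e) ?_ ?_ h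
  · simpa using h'
  · intro e
    simp only [circle_glue]
  · intro e
    by_cases he : A e.1
    · exact propext (iff_of_false (hA _ _ he) (hA _ _ he))
    · rw [resolve_congr (huv _ he), circle_resolve]

theorem _root_.KhBurnside.CubeEdge.apply_eq {u v : Cube n} (h : CubeEdge u v) {x : Fin n}
    (hx : x ≠ h.coord) : u x = v x := by
  by_contra hne
  exact hx (h.existsUnique_ne.unique hne h.coord_spec)

theorem _root_.KhBurnside.CubeEdge.apply_coord {u v : Cube n} (h : CubeEdge u v) :
    u h.coord = true ∧ v h.coord = false := by
  have h1 := h.coord_spec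
  have h2 := h.le h.coord
  revert h1 h2
  cases u h.coord <;> cases v h.coord <;> simp

theorem _root_.KhBurnside.CubeEdge.coord_eq {u v : Cube n} (h : CubeEdge u v) {x : Fin n}
    (hx : u x ≠ v x) : h.coord = x :=
  (h.existsUnique_ne.unique hx h.coord_spec).symm

section Tables

-- Composing with a transposition changes the number of cycles by one, so a surgery never turns one
-- circle into one circle. For two ports this is visible on the two permutations.
set_option maxRecDepth 10000 in
theorem allPerms_two : allPerms 2 (fun P => strict (table 2 2 P) fun W =>
    xor (bit (look W 0 0) 1) (bit (look W 1 0) 1)) 2 0 0 = true := by decide +kernel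

end Tables

/-- The ports are `0, 2` or `1, 3`. Only in the second case with the `1`-resolution, which joins `0`
with `3` and `1` with `2`, do the two ports come in the opposite order. -/
theorem Orientation.circle_port (o : K.Orientation) (c : ℕ → Fin n) (v : Cube n) (j : ℕ) :
    K.circle v (c j, 0) =
      K.circle v (o.port c (2 * j + cond (!o.out (c j, 0) && v (c j)) 1 0)) ∧
    K.circle v (c j, 2) =
      K.circle v (o.port c (2 * j + cond (!o.out (c j, 0) && v (c j)) 0 1)) := by
  have h0 := circle_resolve (K := K) v (c j, 0)
  have h2 := circle_resolve (K := K) v (c j, 2)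
  simp only [resolve] at h0 h2
  cases ho : o.out (c j, 0) <;> cases hv : v (c j) <;>
    simp_all [o.port_two_mul, o.port_two_mul_add_one]

/-- Along an edge of the cube two circles are merged or one circle is split. -/
theorem circle_eq_iff_ne {u v : Cube n} (h : CubeEdge u v) :
    K.circle u (h.coord, 0) = K.circle u (h.coord, 2) ↔
      K.circle v (h.coord, 0) ≠ K.circle v (h.coord, 2) := by
  obtain ⟨o⟩ := K.nonempty_orientation
  let f : Frame n 1 := ⟨v, fun _ => h.coord, fun i hi j hj _ => by omega,
    fun _ _ => h.apply_coord.2⟩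
  obtain ⟨p, hp, hinj, hW⟩ := o.exists_perm f (by norm_num)
  have hu : f.point 1 = u := by
    ext x
    by_cases hx : x = h.coord
    · rw [hx, h.apply_coord.1]
      exact f.point_coord 1 (j := 0) one_pos
    · rw [h.apply_eq hx]
      exact f.point_of_ne 1 fun _ _ h' => hx h'.symm
  have hv : f.point 0 = v := f.point_zero
  have key := allPerms_sound allPerms_two hp hinj
  rw [strict_eq] at key
  have h0 := (hW 2 0 0 1 (by omega) (by omega) (by omega)).1
  have h1 := (hW 2 1 0 1 (by omega) (by omega) (by omega)).1
  rw [hv] at h0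
  rw [hu] at h1
  have e0 := o.circle_port (fun _ => h.coord) v 0
  have e1 := o.circle_port (fun _ => h.coord) u 0
  rw [h.apply_coord.2] at e0
  rw [h.apply_coord.1] at e1
  simp only [Bool.and_false, cond_false, Bool.and_true, mul_zero, zero_add] at e0 e1
  have h1' : K.circle u (h.coord, 0) = K.circle u (h.coord, 2) ↔
      K.circle u (o.port (fun _ => h.coord) 0) = K.circle u (o.port (fun _ => h.coord) 1) := by
    rw [e1.1, e1.2]
    cases o.out (h.coord, 0)
    · exact eq_comm
    · exact Iff.rfl
  rw [h1', e0.1, e0.2, h1, Ne, h0]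
  revert key
  generalize bit (look _ 0 0) 1 = b0
  generalize bit (look _ 1 0) 1 = b1
  cases b0 <;> cases b1 <;> simp

end LinkDiagram

end KhBurnside

namespace KhBurnside

open Packed

/-! ## Labelings near a few crossings -/

namespace Packed

/-- The matrix entry of an edge of the cube, in terms of sets of plus-labeled ports: `W` is the
table of circles, `S` is the lower vertex, `j` is the crossing, and `y` and
`x` are the labelings. -/
def edge (W m S j y x : ℕ) : Bool :=
  cond (allBelow (fun t => bit (look W S t) (2 * j) || bit (look W S t) (2 * j + 1) ||
    (bit x t == bit y t)) m)
    (cond (bit (look W S (2 * j)) (2 * j + 1))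
      (cond (bit y (2 * j)) (xor (bit x (2 * j)) (bit x (2 * j + 1)))
        (!bit x (2 * j) && !bit x (2 * j + 1)))
      ((bit y (2 * j) || bit y (2 * j + 1)) &&
        (bit x (2 * j) == (bit y (2 * j) && bit y (2 * j + 1))))) false

/-- The labeling `y` is constant on circles. -/
def const (W m S y : ℕ) : Bool :=
  allBelow (fun t => allBelow (fun t' => !bit (look W S t) t' || (bit y t == bit y t')) m) m

end Packed

namespace LinkDiagram

variable {n k : ℕ} {K : LinkDiagram n}

/-- The set of plus-labeled ports. -/
def Orientation.mask (o : K.Orientation) (c : ℕ → Fin n) (m : ℕ) {v : Cube n} (y : K.Gen v) : ℕ :=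
  Nat.ofBits fun t : Fin m => decide (y (K.circle v (o.port c t)) = Label.plus)

theorem Orientation.bit_mask (o : K.Orientation) (c : ℕ → Fin n) {m : ℕ} {v : Cube n}
    (y : K.Gen v) {t : ℕ} (ht : t < m) :
    bit (o.mask c m y) t = decide (y (K.circle v (o.port c t)) = Label.plus) := by
  rw [bit_eq_testBit, Orientation.mask, Nat.testBit_ofBits_lt _ _ ht]

theorem Orientation.mask_lt (o : K.Orientation) (c : ℕ → Fin n) {m : ℕ} {v : Cube n}
    (y : K.Gen v) : o.mask c m y < 2 ^ m := Nat.ofBits_lt_two_pow _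

/-- `W` is a table of the circles through the ports, at all vertices of a face. -/
def Orientation.IsTable (o : K.Orientation) (f : Frame n k) (W : ℕ) : Prop :=
  ∀ S t t', S < 2 ^ k → t < 2 * k → t' < 2 * k →
    (K.circle (f.point S) (o.port f.coord t) = K.circle (f.point S) (o.port f.coord t') ↔
      bit (look W S t) t' = true) ∧ look W S t < 2 ^ (2 * k)

theorem Orientation.exists_isTable (o : K.Orientation) (f : Frame n k) (hk : k ≤ 3)
    {chk : ℕ → Bool} (h : allPerms (2 * k) (fun P => strict (table (2 * k) (2 ^ k) P) chk)
      (2 * k) 0 0 = true) : ∃ W, o.IsTable f W ∧ chk W = true := by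
  obtain ⟨p, hp, hinj, hW⟩ := o.exists_perm f hk
  have key := allPerms_sound h hp hinj
  rw [strict_eq] at key
  exact ⟨_, fun S t t' hS => hW _ S t t' hS, key⟩

/-- The labelings agree on all circles that avoid the given crossings. -/
def Orientation.AgreeOff (o : K.Orientation) (f : Frame n k) {u v : Cube n} (x : K.Gen u)
    (y : K.Gen v) : Prop :=
  (∀ d, (∀ t < 2 * k, K.circle f.base d ≠ K.circle f.base (o.port f.coord t)) →
    x (K.circle u d) = y (K.circle v d)) ∧ ∀ l, x (K.loop u l) = y (K.loop v l)

theorem Orientation.AgreeOff.symm {o : K.Orientation} {f : Frame n k} {u v : Cube n} {x : K.Gen u}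
    {y : K.Gen v} (h : o.AgreeOff f x y) : o.AgreeOff f y x :=
  ⟨fun d hd => (h.1 d hd).symm, fun l => (h.2 l).symm⟩

theorem Orientation.AgreeOff.trans {o : K.Orientation} {f : Frame n k} {u v w : Cube n}
    {x : K.Gen u} {y : K.Gen v} {z : K.Gen w} (h : o.AgreeOff f x y) (h' : o.AgreeOff f y z) :
    o.AgreeOff f x z :=
  ⟨fun d hd => (h.1 d hd).trans (h'.1 d hd), fun l => (h.2 l).trans (h'.2 l)⟩

theorem Orientation.avoid_of_off (o : K.Orientation) (f : Frame n k) {v : Cube n} {d : HalfEdge n}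
    (hd : ∀ t < 2 * k, K.circle v d ≠ K.circle v (o.port f.coord t)) (c : Fin n) (i : Fin 4)
    (hc : ∃ j < k, f.coord j = c) : K.circle v d ≠ K.circle v (c, i) := by
  obtain ⟨j, hj, rfl⟩ := hc
  obtain ⟨b, hb, h⟩ := o.exists_circle_eq_port f.coord v (f.coord j, i) (j := j) rfl
  rw [h]
  exact hd _ (by omega)

/-- A circle that avoids all crossings of a face is the same circle at all its vertices. This lets
labelings of different vertices be compared away from the ports. -/
theorem Orientation.circle_eq_iff_of_off (o : K.Orientation) (f : Frame n k) {u v : Cube n}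
    (hu : f.Mem u) (hv : f.Mem v) {d : HalfEdge n}
    (hd : ∀ t < 2 * k, K.circle v d ≠ K.circle v (o.port f.coord t)) (d' : HalfEdge n) :
    K.circle v d = K.circle v d' ↔ K.circle u d = K.circle u d' := by
  refine circle_eq_iff_of_avoid (fun c => ∃ j < k, f.coord j = c) (fun c hc => ?_)
    (o.avoid_of_off f hd) d'
  push Not at hc
  rw [hu c hc, hv c hc]

theorem Orientation.off_of_off (o : K.Orientation) (f : Frame n k) {u v : Cube n}
    (hu : f.Mem u) (hv : f.Mem v) {d : HalfEdge n}
    (hd : ∀ t < 2 * k, K.circle v d ≠ K.circle v (o.port f.coord t)) :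
    ∀ t < 2 * k, K.circle u d ≠ K.circle u (o.port f.coord t) := fun t ht h =>
  hd t ht ((o.circle_eq_iff_of_off f hu hv hd _).2 h)

theorem _root_.KhBurnside.Frame.base_mem (f : Frame n k) : f.Mem f.base := fun _ _ => rfl

/-- A circle either passes through a port, where its label is recorded in the mask, or avoids the
face, where its label is that of `y`. -/
theorem Orientation.gen_ext (o : K.Orientation) (f : Frame n k) {u v : Cube n} (hu : f.Mem u)
    {x x' : K.Gen u} {y : K.Gen v} (h : o.AgreeOff f x y) (h' : o.AgreeOff f x' y)
    (hm : o.mask f.coord (2 * k) x = o.mask f.coord (2 * k) x') : x = x' := by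
  funext q
  rcases q with q | l
  · induction q using Quot.ind with
    | mk d =>
      change x (K.circle u d) = x' (K.circle u d)
      by_cases hd : ∀ t < 2 * k, K.circle u d ≠ K.circle u (o.port f.coord t)
      · have hd' := o.off_of_off f f.base_mem hu hd
        rw [h.1 d hd', h'.1 d hd']
      · push Not at hd
        obtain ⟨t, ht, hdt⟩ := hd
        have h1 := o.bit_mask f.coord x ht
        rw [hm, o.bit_mask f.coord x' ht, ← hdt] at h1
        revert h1
        cases x (K.circle u d) <;> cases x' (K.circle u d) <;> simp
  · exact (h.2 l).trans (h'.2 l).symm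

/-- Circles through ports are labeled by `Y`; the others take their labels from `y`, read at a
chosen half-edge of the circle. -/
theorem Orientation.exists_gen (o : K.Orientation) (f : Frame n k) {u v : Cube n} (hu : f.Mem u)
    (hv : f.Mem v) (y : K.Gen v) (Y : ℕ → Bool)
    (hY : ∀ t < 2 * k, ∀ t' < 2 * k,
      K.circle u (o.port f.coord t) = K.circle u (o.port f.coord t') → Y t = Y t') :
    ∃ x : K.Gen u, o.AgreeOff f x y ∧
      ∀ t < 2 * k, decide (x (K.circle u (o.port f.coord t)) = Label.plus) = Y t := by
  classical
  let x : K.Gen u := Sum.elim (fun q =>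
    if h : ∃ t, t < 2 * k ∧ Sum.inl q = K.circle u (o.port f.coord t) then
      if Y h.choose then Label.plus else Label.minus
    else y (K.circle v (Quot.out q))) (fun l => y (K.loop v l))
  have hx : ∀ d, x (K.circle u d) =
      if h : ∃ t, t < 2 * k ∧ K.circle u d = K.circle u (o.port f.coord t) then
        if Y h.choose then Label.plus else Label.minus
      else y (K.circle v (Quot.out (Quot.mk (fun d d' : HalfEdge n =>
        d' = K.glue d ∨ d' = resolve u d) d))) := fun _ => rfl
  refine ⟨x, ⟨fun d hd => ?_, fun _ => rfl⟩, fun t ht => ?_⟩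
  · have hd' := o.off_of_off f hu f.base_mem hd
    rw [hx, dif_neg (by push Not; exact hd')]
    congr 1
    refine ((o.circle_eq_iff_of_off f hv hu hd' _).1 ?_).symm
    exact congrArg Sum.inl (Quot.out_eq _).symm
  · have hex : ∃ t', t' < 2 * k ∧
        K.circle u (o.port f.coord t) = K.circle u (o.port f.coord t') := ⟨t, ht, rfl⟩
    rw [hx, dif_pos hex, ← hY t ht _ hex.choose_spec.1 hex.choose_spec.2]
    cases Y t <;> simp

theorem mul_eq_one_iff (a b c : Label) : mul a b c = 1 ↔ (a = .plus ∨ b = .plus) ∧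
    (c = .plus ↔ a = .plus ∧ b = .plus) := by
  cases a <;> cases b <;> cases c <;> simp [mul]

theorem comul_eq_one_iff (a b c : Label) : comul a (b, c) = 1 ↔
    if a = .plus then ¬ (b = .plus ↔ c = .plus) else b ≠ .plus ∧ c ≠ .plus := by
  cases a <;> cases b <;> cases c <;> simp [comul]

open Classical in
/-- An edge correspondence, in terms of the labels near the crossings of a face. -/
theorem Orientation.edgeMatrix_eq_one_iff (o : K.Orientation) {f : Frame n k} {W : ℕ}
    (hW : o.IsTable f W) {u v : Cube n} (h : CubeEdge u v) {S S' j : ℕ} (hS : S < 2 ^ k)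
    (hv : f.point S = v) (hu : f.point S' = u) (hj : j < k)
    (hc : f.coord j = h.coord) (x : K.Gen u) (y : K.Gen v) :
    K.edgeMatrix h x y = 1 ↔ o.AgreeOff f x y ∧
      edge W (2 * k) S j (o.mask f.coord (2 * k) y) (o.mask f.coord (2 * k) x) = true := by
  have hum : f.Mem u := hu ▸ f.point_mem S'
  have hvm : f.Mem v := hv ▸ f.point_mem S
  have h0 : 2 * j < 2 * k := by omega
  have h1 : 2 * j + 1 < 2 * k := by omega
  have ev := o.circle_port f.coord v j
  have eu := o.circle_port f.coord u j
  rw [hc] at ev eu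
  rw [h.apply_coord.2] at ev
  rw [h.apply_coord.1] at eu
  simp only [Bool.and_false, cond_false, Bool.and_true, add_zero] at ev eu
  have hWv : ∀ t < 2 * k, ∀ t' < 2 * k, (bit (look W S t) t' = true ↔
      K.circle v (o.port f.coord t) = K.circle v (o.port f.coord t')) := fun t ht t' ht' => by
    rw [← (hW S t t' hS ht ht').1, hv]
  have hby : ∀ t < 2 * k, (bit (o.mask f.coord (2 * k) y) t = true ↔
      y (K.circle v (o.port f.coord t)) = .plus) := fun t ht => by
    rw [o.bit_mask _ _ ht, decide_eq_true_iff]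
  have hbx : ∀ t < 2 * k, (bit (o.mask f.coord (2 * k) x) t = true ↔
      x (K.circle u (o.port f.coord t)) = .plus) := fun t ht => by
    rw [o.bit_mask _ _ ht, decide_eq_true_iff]
  have hbeq : ∀ t < 2 * k, ((bit (o.mask f.coord (2 * k) x) t ==
      bit (o.mask f.coord (2 * k) y) t) = true ↔
      x (K.circle u (o.port f.coord t)) = y (K.circle v (o.port f.coord t))) := fun t ht => by
    rw [o.bit_mask _ _ ht, o.bit_mask _ _ ht]
    cases x (K.circle u (o.port f.coord t)) <;> cases y (K.circle v (o.port f.coord t)) <;> simp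
  -- A circle not meeting the changing crossing either avoids the whole face, which is `AgreeOff`,
  -- or passes through a port, which is the finite condition.
  have hAway : K.AgreeAway h x y ↔ o.AgreeOff f x y ∧
      allBelow (fun t => bit (look W S t) (2 * j) || bit (look W S t) (2 * j + 1) ||
        (bit (o.mask f.coord (2 * k) x) t == bit (o.mask f.coord (2 * k) y) t)) (2 * k) = true := by
    rw [allBelow_iff]
    have hport : ∀ t < 2 * k, ((bit (look W S t) (2 * j) || bit (look W S t) (2 * j + 1) ||
        (bit (o.mask f.coord (2 * k) x) t == bit (o.mask f.coord (2 * k) y) t)) = true ↔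
        (K.circle v (o.port f.coord t) ≠ K.circle v (h.coord, 0) →
          K.circle v (o.port f.coord t) ≠ K.circle v (h.coord, 2) →
          x (K.circle u (o.port f.coord t)) = y (K.circle v (o.port f.coord t)))) := by
      intro t ht
      rw [Bool.or_eq_true, Bool.or_eq_true, hWv t ht _ h0, hWv t ht _ h1, hbeq t ht, ev.1, ev.2]
      tauto
    constructor
    · intro hA
      refine ⟨⟨fun d hd => ?_, hA.2⟩, fun t ht => (hport t ht).2 (hA.1 _)⟩
      have hd' := o.off_of_off f hvm f.base_mem hd
      exact hA.1 d (by rw [ev.1]; exact hd' _ h0) (by rw [ev.2]; exact hd' _ h1)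
    · rintro ⟨hoff, hp⟩
      refine ⟨fun d hd0 hd2 => ?_, hoff.2⟩
      by_cases hd : ∀ t < 2 * k, K.circle v d ≠ K.circle v (o.port f.coord t)
      · exact hoff.1 d (o.off_of_off f f.base_mem hvm hd)
      · push Not at hd
        obtain ⟨t, ht, hdt⟩ := hd
        -- The circle avoids the changing crossing, so it still contains the same port after the
        -- surgery.
        have hu' : K.circle u d = K.circle u (o.port f.coord t) := by
          refine circle_eq_of_avoid (· = h.coord) (fun c hc => h.apply_eq hc) ?_ hdt
          rintro _ i rfl
          obtain ⟨b, hb, hb'⟩ := o.exists_circle_eq_port f.coord v (h.coord, i) (j := j) hc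
          rw [hb']
          rcases Nat.lt_succ_iff_lt_or_eq.1 hb with hb | rfl
          · obtain rfl : b = 0 := by omega
            rw [add_zero, ← ev.1]
            exact hd0
          · rw [← ev.2]
            exact hd2
        rw [hu', hdt]
        exact (hport t ht).1 (hp t ht) (hdt ▸ hd0) (hdt ▸ hd2)
  have hmerge := circle_eq_iff_ne (K := K) h
  have key : (if K.circle v (h.coord, 0) ≠ K.circle v (h.coord, 2) then
        mul (y (K.circle v (h.coord, 0))) (y (K.circle v (h.coord, 2)))
          (x (K.circle u (h.coord, 0)))
      else
        comul (y (K.circle v (h.coord, 0)))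
          (x (K.circle u (h.coord, 0)), x (K.circle u (h.coord, 2)))) = 1 ↔
      cond (bit (look W S (2 * j)) (2 * j + 1))
      (cond (bit (o.mask f.coord (2 * k) y) (2 * j))
        (xor (bit (o.mask f.coord (2 * k) x) (2 * j)) (bit (o.mask f.coord (2 * k) x) (2 * j + 1)))
        (!bit (o.mask f.coord (2 * k) x) (2 * j) && !bit (o.mask f.coord (2 * k) x) (2 * j + 1)))
      ((bit (o.mask f.coord (2 * k) y) (2 * j) || bit (o.mask f.coord (2 * k) y) (2 * j + 1)) &&
        (bit (o.mask f.coord (2 * k) x) (2 * j) == (bit (o.mask f.coord (2 * k) y) (2 * j) &&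
          bit (o.mask f.coord (2 * k) y) (2 * j + 1)))) = true := by
    have hs := hWv _ h0 _ h1
    rw [← ev.1, ← ev.2] at hs
    rw [o.bit_mask _ _ h0, o.bit_mask _ _ h1, o.bit_mask _ _ h0, o.bit_mask _ _ h1, ← ev.1,
      ← ev.2]
    by_cases hne : K.circle v (h.coord, 0) = K.circle v (h.coord, 2)
    · rw [if_neg (not_not.2 hne), hs.2 hne, cond_true, comul_eq_one_iff]
      rw [eu.1, eu.2]
      -- The two ports may come in either order here; the comultiplication is symmetric, so both
      -- cases give the same condition.
      cases o.out (h.coord, 0) <;> simp only [Bool.not_false, Bool.not_true, cond_true, cond_false,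
        add_zero] <;>
        cases y (K.circle v (h.coord, 0)) <;>
        cases x (K.circle u (o.port f.coord (2 * j))) <;>
        cases x (K.circle u (o.port f.coord (2 * j + 1))) <;> simp
    · have hx : x (K.circle u (h.coord, 0)) = x (K.circle u (o.port f.coord (2 * j))) := by
        -- After a merge both ports lie on the single resulting circle, so their order does not
        -- matter.
        have hm := hmerge.2 hne
        cases ho : o.out (h.coord, 0)
        · rw [hm, eu.2, ho]
          rfl
        · rw [eu.1, ho]
          rfl
      rw [if_pos hne, Bool.eq_false_iff.2 fun hb => hne (hs.1 hb), cond_false, mul_eq_one_iff, hx]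
      cases y (K.circle v (h.coord, 0)) <;> cases y (K.circle v (h.coord, 2)) <;>
        cases x (K.circle u (o.port f.coord (2 * j))) <;> simp
  unfold edgeMatrix edge
  by_cases hA : K.AgreeAway h x y
  · obtain ⟨hA1, hA2⟩ := hAway.1 hA
    rw [if_pos hA, hA2, cond_true, key]
    simp only [hA1, true_and]
  · rw [if_neg hA]
    constructor
    · intro h01
      exact absurd h01 (by norm_num)
    · rintro ⟨hA1, hA2⟩
      exfalso
      refine hA (hAway.2 ⟨hA1, ?_⟩)
      by_contra hb
      rw [Bool.not_eq_true] at hb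
      rw [hb] at hA2
      exact absurd hA2 (by simp)

theorem Orientation.const_mask (o : K.Orientation) {f : Frame n k} {W : ℕ} (hW : o.IsTable f W)
    {v : Cube n} {S : ℕ} (hS : S < 2 ^ k) (hv : f.point S = v) (y : K.Gen v) :
    const W (2 * k) S (o.mask f.coord (2 * k) y) = true := by
  refine allBelow_iff.2 fun t ht => allBelow_iff.2 fun t' ht' => ?_
  rw [o.bit_mask _ _ ht, o.bit_mask _ _ ht']
  cases hb : bit (look W S t) t'
  · rfl
  · have := (hW S t t' hS ht ht').1.2 hb
    rw [hv] at this
    rw [this]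
    simp

/-- The bound on `Y` excludes digits beyond the ports; it is what turns agreement at the ports into
equality of numbers. -/
theorem Orientation.exists_mask_eq (o : K.Orientation) {f : Frame n k} {W : ℕ}
    (hW : o.IsTable f W) {u v : Cube n} {S : ℕ} (hS : S < 2 ^ k) (hu : f.point S = u)
    (hv : f.Mem v) (y : K.Gen v) {Y : ℕ} (hY : Y < 2 ^ (2 * k))
    (hc : const W (2 * k) S Y = true) :
    ∃ x : K.Gen u, o.AgreeOff f x y ∧ o.mask f.coord (2 * k) x = Y := by
  have hconst : ∀ t < 2 * k, ∀ t' < 2 * k,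
      K.circle u (o.port f.coord t) = K.circle u (o.port f.coord t') → bit Y t = bit Y t' := by
    intro t ht t' ht' h
    subst hu
    have h1 := (hW S t t' hS ht ht').1.1 h
    have h2 := allBelow_iff.1 (allBelow_iff.1 hc t ht) t' ht'
    rw [h1] at h2
    simpa using h2
  obtain ⟨x, hx, hx'⟩ := o.exists_gen f (hu ▸ f.point_mem S) hv y (bit Y) hconst
  refine ⟨x, hx, Nat.eq_of_testBit_eq fun t => ?_⟩
  by_cases ht : t < 2 * k
  · rw [← bit_eq_testBit, ← bit_eq_testBit, o.bit_mask _ _ ht, hx' t ht]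
  · rw [Nat.testBit_lt_two_pow, Nat.testBit_lt_two_pow]
    · exact hY.trans_le (Nat.pow_le_pow_right two_pos (by omega))
    · exact (o.mask_lt _ _).trans_le (Nat.pow_le_pow_right two_pos (by omega))

end LinkDiagram

end KhBurnside

namespace KhBurnside

namespace Packed

/-! ## Finite checks -/

/-- `look W S` lists the classes of an equivalence relation on the numbers less than `m`. -/
structure IsPartition (W m S : ℕ) : Prop where
  lt : ∀ t < m, look W S t < 2 ^ m
  refl : ∀ t < m, bit (look W S t) t = true
  symm : ∀ t < m, ∀ s < m, bit (look W S t) s = true → bit (look W S s) t = true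
  trans : ∀ t < m, ∀ s < m, ∀ r < m, bit (look W S t) s = true → bit (look W S s) r = true →
    bit (look W S t) r = true

/-- The classes in `S'` arise from those in `S` by a surgery at the points `2 j` and `2 j + 1`. -/
structure IsSurgery (W m S S' j : ℕ) : Prop where
  lt : 2 * j + 1 < m
  left : IsPartition W m S
  right : IsPartition W m S'
  touch : ∀ t < m, bit (look W S t) (2 * j) = true ∨ bit (look W S t) (2 * j + 1) = true ↔
    bit (look W S' t) (2 * j) = true ∨ bit (look W S' t) (2 * j + 1) = true
  merge : bit (look W S (2 * j)) (2 * j + 1) = false → bit (look W S' (2 * j)) (2 * j + 1) = true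

theorem eq_of_bit_eq {m x y : ℕ} (hx : x < 2 ^ m) (hy : y < 2 ^ m)
    (h : ∀ t < m, bit x t = bit y t) : x = y := by
  refine Nat.eq_of_testBit_eq fun t => ?_
  by_cases ht : t < m
  · rw [← bit_eq_testBit, ← bit_eq_testBit, h t ht]
  · rw [Nat.testBit_lt_two_pow, Nat.testBit_lt_two_pow]
    · exact hy.trans_le (Nat.pow_le_pow_right two_pos (by omega))
    · exact hx.trans_le (Nat.pow_le_pow_right two_pos (by omega))

theorem bit_xor (x y t : ℕ) : bit (Nat.xor x y) t = xor (bit x t) (bit y t) := by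
  simp only [bit_eq_testBit]
  exact Nat.testBit_xor x y t

theorem bit_lor (x y t : ℕ) : bit (Nat.lor x y) t = (bit x t || bit y t) := by
  simp only [bit_eq_testBit]
  exact Nat.testBit_or x y t

theorem const_iff {W m S y : ℕ} : const W m S y = true ↔
    ∀ t < m, ∀ s < m, bit (look W S t) s = true → bit y t = bit y s := by
  simp only [const, allBelow_iff, Bool.or_eq_true, Bool.not_eq_true', beq_iff_eq]
  refine forall_congr' fun t => forall_congr' fun _ => forall_congr' fun s => forall_congr' fun _ => ?_
  cases bit (look W S t) s <;> simp

/-- `allSucc W S S' p q y k` says that `k` holds for all labelings to which `y` is related by the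
edge from `S` to `S'` with surgery points `p` and `q`. -/
def allSucc (W S S' p q y : ℕ) (k : ℕ → Bool) : Bool :=
  cond (bit (look W S p) q)
    (cond (bit y p) (cond (strict (Nat.xor y (look W S' p)) k)
      (strict (Nat.xor y (look W S' q)) k) false) (k y))
    (cond (bit y p) (cond (bit y q) (k y) (strict (Nat.xor y (look W S p)) k))
      (cond (bit y q) (strict (Nat.xor y (look W S q)) k) true))

/-- Equality with one of the enumerated numbers is checked port by port. Untouched ports keep their
labels; a port on a circle under surgery has, in `x`, the label of `2 j` or of `2 j + 1`. So `x` is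
`y` with the labels of at most one class exchanged. -/
theorem allSucc_sound {W m S S' j y x : ℕ} (hS : IsSurgery W m S S' j) (hy : y < 2 ^ m)
    (hx : x < 2 ^ m) (hyc : const W m S y = true) (hxc : const W m S' x = true)
    (he : edge W m S j y x = true) {k : ℕ → Bool}
    (hk : allSucc W S S' (2 * j) (2 * j + 1) y k = true) : k x = true := by
  rw [const_iff] at hyc hxc
  have hq := hS.lt
  have hp : 2 * j < m := by omega
  unfold edge at he
  obtain ⟨he1, he2⟩ : (∀ t < m, bit (look W S t) (2 * j) = false →
      bit (look W S t) (2 * j + 1) = false → bit x t = bit y t) ∧ _ := by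
    rw [Bool.cond_eq_ite, Bool.ite_eq_true_distrib] at he
    split_ifs at he with h
    refine ⟨fun t ht h1 h2 => ?_, he⟩
    have := allBelow_iff.1 h t ht
    rw [h1, h2] at this
    simpa using this
  -- The surgery keeps the union of the affected circles, so a port on it ends up on the circle of
  -- `2 j` or on that of `2 j + 1`.
  have hxy : ∀ t < m, bit (look W S t) (2 * j) = true ∨ bit (look W S t) (2 * j + 1) = true →
      bit x t = bit x (2 * j) ∧ bit (look W S' (2 * j)) t = true ∨
      bit x t = bit x (2 * j + 1) ∧ bit (look W S' (2 * j + 1)) t = true := fun t ht h =>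
    ((hS.touch t ht).1 h).imp (fun h => ⟨hxc t ht _ hp h, hS.right.symm t ht _ hp h⟩)
      (fun h => ⟨hxc t ht _ hq h, hS.right.symm t ht _ hq h⟩)
  have key : ∀ a, (a < 2 ^ m) → (∀ t < m, bit x t = xor (bit y t) (bit a t)) → x = Nat.xor y a := by
    intro a ha h
    refine eq_of_bit_eq hx (Nat.xor_lt_two_pow hy ha) fun t ht => ?_
    rw [bit_xor, h t ht]
  unfold allSucc at hk
  simp only [strict_eq] at hk
  cases hs : bit (look W S (2 * j)) (2 * j + 1)
  · rw [hs, cond_false] at he2 hk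
    have hm := hS.merge hs
    have hxpq := hxc _ hp _ hq hm
    simp only [Bool.and_eq_true, Bool.or_eq_true, beq_iff_eq] at he2
    have hxt : ∀ t < m, bit (look W S t) (2 * j) = true ∨ bit (look W S t) (2 * j + 1) = true →
        bit x t = bit x (2 * j) := fun t ht h => by
      rcases hxy t ht h with h | h
      · exact h.1
      · rw [h.1, hxpq]
    have hexcl : ∀ t < m, ¬ (bit (look W S t) (2 * j) = true ∧
        bit (look W S t) (2 * j + 1) = true) := fun t ht h => by
      have := hS.left.trans _ hp _ ht _ hq (hS.left.symm _ ht _ hp h.1) h.2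
      rw [hs] at this
      exact absurd this (by simp)
    have hsymm : ∀ r < m, ∀ t < m, bit (look W S r) t = bit (look W S t) r := fun r hr t ht =>
      Bool.eq_iff_iff.2 ⟨hS.left.symm r hr t ht, hS.left.symm t ht r hr⟩
    cases hyp : bit y (2 * j) <;> cases hyq : bit y (2 * j + 1) <;> rw [hyp, hyq] at he2 hk <;>
      simp only [cond_true, cond_false] at hk
    · simp at he2
    · rw [key _ (hS.left.lt _ hq)]
      · exact hk
      · intro t ht
        rw [hsymm _ hq _ ht]
        cases h1 : bit (look W S t) (2 * j) <;> cases h2 : bit (look W S t) (2 * j + 1)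
        · simp [he1 t ht h1 h2]
        · rw [hxt t ht (Or.inr h2), he2.2, hyc t ht _ hq h2, hyq]
          rfl
        · rw [hxt t ht (Or.inl h1), he2.2, hyc t ht _ hp h1, hyp]
          rfl
        · exact absurd ⟨h1, h2⟩ (hexcl t ht)
    · rw [key _ (hS.left.lt _ hp)]
      · exact hk
      · intro t ht
        rw [hsymm _ hp _ ht]
        cases h1 : bit (look W S t) (2 * j) <;> cases h2 : bit (look W S t) (2 * j + 1)
        · simp [he1 t ht h1 h2]
        · rw [hxt t ht (Or.inr h2), he2.2, hyc t ht _ hq h2, hyq]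
          rfl
        · rw [hxt t ht (Or.inl h1), he2.2, hyc t ht _ hp h1, hyp]
          rfl
        · exact absurd ⟨h1, h2⟩ (hexcl t ht)
    · rw [eq_of_bit_eq hx hy]
      · exact hk
      · intro t ht
        cases h1 : bit (look W S t) (2 * j) <;> cases h2 : bit (look W S t) (2 * j + 1)
        · exact he1 t ht h1 h2
        · rw [hxt t ht (Or.inr h2), he2.2, hyc t ht _ hq h2, hyq]
          rfl
        · rw [hxt t ht (Or.inl h1), he2.2, hyc t ht _ hp h1, hyp]
          rfl
        · exact absurd ⟨h1, h2⟩ (hexcl t ht)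
  · rw [hs, cond_true] at he2 hk
    have hyt : ∀ t < m, bit (look W S t) (2 * j) = true ∨ bit (look W S t) (2 * j + 1) = true →
        bit y t = bit y (2 * j) := fun t ht h => by
      rcases h with h | h
      · exact hyc t ht _ hp h
      · rw [hyc t ht _ hq h, hyc _ hp _ hq hs]
    cases hyp : bit y (2 * j) <;> rw [hyp] at he2 hk hyt
    · simp only [cond_false, Bool.and_eq_true, Bool.not_eq_true'] at he2 hk
      rw [eq_of_bit_eq hx hy]
      · exact hk
      · intro t ht
        by_cases h : bit (look W S t) (2 * j) = true ∨ bit (look W S t) (2 * j + 1) = true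
        · rw [hyt t ht h]
          rcases hxy t ht h with h' | h'
          · rw [h'.1, he2.1]
          · rw [h'.1, he2.2]
        · push Not at h
          exact he1 t ht (Bool.eq_false_iff.2 h.1) (Bool.eq_false_iff.2 h.2)
    · have hk' : k (Nat.xor y (look W S' (2 * j))) = true ∧
          k (Nat.xor y (look W S' (2 * j + 1))) = true := by
        revert hk
        cases k (Nat.xor y (look W S' (2 * j))) <;> simp
      rw [cond_true] at he2
      have hne : bit (look W S' (2 * j)) (2 * j + 1) = false := by
        by_contra hb
        rw [Bool.not_eq_false] at hb
        rw [hxc _ hp _ hq hb] at he2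
        simp at he2
      have hexcl : ∀ t < m, bit (look W S' (2 * j)) t = true →
          bit (look W S' (2 * j + 1)) t = true → False := fun t ht h1 h2 => by
        have := hS.right.trans _ hp _ ht _ hq h1 (hS.right.symm _ hq _ ht h2)
        rw [hne] at this
        exact absurd this (by simp)
      have huntouch : ∀ t < m,
          ¬ (bit (look W S t) (2 * j) = true ∨ bit (look W S t) (2 * j + 1) = true) →
          bit x t = bit y t ∧ bit (look W S' (2 * j)) t = false ∧
            bit (look W S' (2 * j + 1)) t = false := by
        intro t ht h
        refine ⟨?_, ?_, ?_⟩
        · push Not at h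
          exact he1 t ht (Bool.eq_false_iff.2 h.1) (Bool.eq_false_iff.2 h.2)
        · exact Bool.eq_false_iff.2 fun hb =>
            h ((hS.touch t ht).2 (Or.inl (hS.right.symm _ hp _ ht hb)))
        · exact Bool.eq_false_iff.2 fun hb =>
            h ((hS.touch t ht).2 (Or.inr (hS.right.symm _ hq _ ht hb)))
      cases hxp : bit x (2 * j)
      · have hxq : bit x (2 * j + 1) = true := by simpa [hxp] using he2
        rw [key _ (hS.right.lt _ hp)]
        · exact hk'.1
        · intro t ht
          by_cases h : bit (look W S t) (2 * j) = true ∨ bit (look W S t) (2 * j + 1) = true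
          · rw [hyt t ht h]
            rcases hxy t ht h with h' | h'
            · rw [h'.1, h'.2, hxp]
              rfl
            · rw [h'.1, hxq, Bool.eq_false_iff.2 fun hb => hexcl t ht hb h'.2]
              rfl
          · obtain ⟨h1, h2, -⟩ := huntouch t ht h
            rw [h1, h2, Bool.xor_false]
      · have hxq : bit x (2 * j + 1) = false := by simpa [hxp] using he2
        rw [key _ (hS.right.lt _ hq)]
        · exact hk'.2
        · intro t ht
          by_cases h : bit (look W S t) (2 * j) = true ∨ bit (look W S t) (2 * j + 1) = true
          · rw [hyt t ht h]
            rcases hxy t ht h with h' | h'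
            · rw [h'.1, hxp, Bool.eq_false_iff.2 fun hb => hexcl t ht h'.2 hb]
              rfl
            · rw [h'.1, h'.2, hxq]
              rfl
          · obtain ⟨h1, -, h2⟩ := huntouch t ht h
            rw [h1, h2, Bool.xor_false]

/-- `imp a b` says that `a` implies `b`. -/
def imp (a b : Bool) : Bool := cond a b true

theorem imp_iff {a b : Bool} : imp a b = true ↔ (a = true → b = true) := by
  cases a <;> simp [imp]

/-- `allConst W f k a` says that `k` holds for all unions of `a` with classes of `S = 0` whose
least elements are less than `f`. -/
def allConst (W f : ℕ) (k : ℕ → Bool) : ℕ → Bool :=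
  Nat.rec (fun z => k z) (fun t ih z =>
    cond (Nat.beq (Nat.mod (look W 0 t) (Nat.pow 2 t)) 0)
      (cond (ih z) (strict (Nat.lor z (look W 0 t)) ih) false) (ih z)) f

/-- A set that is constant on classes is the union of the classes whose least elements it contains.
Taking at each least element the branch dictated by `z` reaches exactly `z`. -/
theorem allConst_sound {W m : ℕ} (hW : IsPartition W m 0) {z : ℕ} (hz : z < 2 ^ m)
    (hc : const W m 0 z = true) {k : ℕ → Bool} (h : allConst W m k 0 = true) : k z = true := by
  rw [const_iff] at hc
  -- The digits of a class below `t` all vanish precisely when the class contains nothing less than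
  -- `t`.
  let b : ℕ → Bool := fun t => Nat.beq (Nat.mod (look W 0 t) (Nat.pow 2 t)) 0
  have hb : ∀ t, b t = true ↔ ∀ s < t, bit (look W 0 t) s = false := by
    intro t
    have h1 : b t = true ↔ look W 0 t % 2 ^ t = 0 := Iff.of_eq Nat.beq_eq
    rw [h1]
    constructor
    · intro h s hs
      have h2 : (look W 0 t % 2 ^ t).testBit s = false := by rw [h, Nat.zero_testBit]
      rw [Nat.testBit_mod_two_pow, decide_eq_true hs, Bool.true_and] at h2
      rw [bit_eq_testBit, h2]
    · intro h
      refine Nat.eq_of_testBit_eq fun s => ?_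
      rw [Nat.testBit_mod_two_pow, Nat.zero_testBit]
      by_cases hs : s < t
      · rw [← bit_eq_testBit, h s hs, Bool.and_false]
      · rw [decide_eq_false hs, Bool.false_and]
  have key : ∀ f a, allConst W f k a = true → ∃ u, k u = true ∧ (a < 2 ^ m → f ≤ m → u < 2 ^ m) ∧
      ∀ s, bit u s = true ↔ bit a s = true ∨
        ∃ t < f, b t = true ∧ bit z t = true ∧ bit (look W 0 t) s = true := by
    intro f
    induction f with
    | zero =>
      intro a h
      exact ⟨a, h, fun h _ => h, fun s => by simp⟩
    | succ f ih =>
      intro a h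
      have hstep : allConst W (f + 1) k a = cond (b f) (cond (allConst W f k a)
        (strict (Nat.lor a (look W 0 f)) (allConst W f k)) false) (allConst W f k a) := rfl
      rw [hstep, strict_eq] at h
      by_cases hf : b f = true ∧ bit z f = true
      · rw [hf.1, cond_true] at h
        have h' : allConst W f k (Nat.lor a (look W 0 f)) = true := by
          revert h
          cases allConst W f k a <;> simp
        obtain ⟨u, hu1, hu2, hu3⟩ := ih _ h'
        refine ⟨u, hu1, fun ha hf => hu2 (Nat.or_lt_two_pow ha (hW.lt f (by omega))) (by omega),
          fun s => ?_⟩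
        rw [hu3, bit_lor, Bool.or_eq_true, or_assoc]
        refine or_congr Iff.rfl ⟨?_, ?_⟩
        · rintro (h | ⟨t, ht, h⟩)
          · exact ⟨f, by omega, hf.1, hf.2, h⟩
          · exact ⟨t, by omega, h⟩
        · rintro ⟨t, ht, hh⟩
          rcases Nat.lt_succ_iff_lt_or_eq.1 ht with ht | rfl
          · exact Or.inr ⟨t, ht, hh⟩
          · exact Or.inl hh.2.2
      · have h' : allConst W f k a = true := by
          revert h
          cases allConst W f k a <;> cases b f <;> simp
        obtain ⟨u, hu1, hu2, hu3⟩ := ih _ h'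
        refine ⟨u, hu1, fun ha hf => hu2 ha (by omega), fun s => ?_⟩
        rw [hu3]
        refine or_congr Iff.rfl ⟨?_, ?_⟩
        · rintro ⟨t, ht, h⟩
          exact ⟨t, by omega, h⟩
        · rintro ⟨t, ht, hh⟩
          rcases Nat.lt_succ_iff_lt_or_eq.1 ht with ht | rfl
          · exact ⟨t, ht, hh⟩
          · exact absurd ⟨hh.1, hh.2.1⟩ hf
  obtain ⟨u, hu1, hu2, hu3⟩ := key m 0 h
  have huz : u = z := by
    refine eq_of_bit_eq (hu2 (by positivity) le_rfl) hz fun s hs => ?_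
    rw [Bool.eq_iff_iff, hu3, bit_eq_testBit 0, Nat.zero_testBit]
    simp only [Bool.false_eq_true, false_or]
    constructor
    · rintro ⟨t, ht, -, h1, h2⟩
      rw [← hc t ht s hs h2, h1]
    · intro h
      have hex : ∃ t, bit (look W 0 s) t = true := ⟨s, hW.refl s hs⟩
      have h1 := Nat.find_spec hex
      have h2 := fun r hr => Nat.find_min hex (m := r) hr
      have h3 : Nat.find hex ≤ s := Nat.find_min' hex (hW.refl s hs)
      generalize Nat.find hex = t at h1 h2 h3
      have ht : t < m := by omega
      refine ⟨t, ht, (hb t).2 fun r hr => Bool.eq_false_iff.2 fun h4 => ?_, ?_,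
        hW.symm s hs t ht h1⟩
      · exact h2 r hr (hW.trans s hs t ht r (by omega) h1 h4)
      · rw [← hc s hs t ht h1, h]
  rw [← huz]
  exact hu1

/-- The labeling `x` is related to `y`. -/
def isSucc (W S S' p q y x : ℕ) : Bool :=
  not (allSucc W S S' p q y fun x' => not (Nat.beq x x'))

/-- If `x` were missed by the enumeration, all enumerated labelings would differ from `x`, and by
soundness so would `x` itself. -/
theorem isSucc_of_edge {W m S S' j y x : ℕ} (hS : IsSurgery W m S S' j) (hy : y < 2 ^ m)
    (hx : x < 2 ^ m) (hyc : const W m S y = true) (hxc : const W m S' x = true)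
    (he : edge W m S j y x = true) : isSucc W S S' (2 * j) (2 * j + 1) y x = true := by
  unfold isSucc
  rw [Bool.not_eq_true', Bool.eq_false_iff]
  intro h
  have := allSucc_sound hS hy hx hyc hxc he h
  simp at this

/-- The face with lower vertex `S`, middle vertices `Si`, `Sj`, upper vertex `Sij` and crossings
`i`, `j` is a ladybug configuration. -/
def lady (W S Si Sj Sij i j : ℕ) : Bool :=
  bit (look W S (2 * i)) (2 * i + 1) && bit (look W S (2 * i)) (2 * j) &&
  bit (look W S (2 * i)) (2 * j + 1) && !bit (look W Si (2 * i)) (2 * i + 1) &&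
  !bit (look W Sj (2 * j)) (2 * j + 1) && bit (look W Sij (2 * i)) (2 * i + 1) &&
  bit (look W Sij (2 * i)) (2 * j) && bit (look W Sij (2 * i)) (2 * j + 1)

/-- The label of the half-edge `2 b` at the crossing `q`; `e` is the set of crossings at which the
outgoing half-edges are `1` and `3`. -/
def turn (e S y q b : ℕ) : Bool :=
  bit y (2 * q + cond (bit e q && bit S q) (1 - b) b)

/-- The labelings `y` and `y'` are related by the ladybug matching. -/
def ladyOk (W e S Si Sj Sij i j z y x y' : ℕ) : Bool :=
  imp (lady W S Si Sj Sij i j) (imp (bit z (2 * i)) (imp (not (bit x (2 * i)))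
  (turn e Si y i 0 == turn e Sj y' i 0 && turn e Si y i 1 == turn e Sj y' i 1 &&
   turn e Si y j 0 == turn e Sj y' j 0 && turn e Si y j 1 == turn e Sj y' j 1)))

/-- In a ladybug configuration the surgery arcs lie on different sides. -/
def sidesOk (W e S Si Sj Sij i j : ℕ) : Bool :=
  imp (lady W S Si Sj Sij i j) (xor (bit e i) (bit e j))

/-- `allMoves W e S Si Sj Sij i j z y x k` says that `k` holds for all `y'` that correspond to `y`
under the face map. -/
def allMoves (W e S Si Sj Sij i j z y x : ℕ) (k : ℕ → Bool) : Bool :=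
  allSucc W S Sj (2 * j) (2 * j + 1) z fun y' =>
    imp (isSucc W Sj Sij (2 * i) (2 * i + 1) y' x) (imp (ladyOk W e S Si Sj Sij i j z y x y') (k y'))

theorem allMoves_sound {W m e S Si Sj Sij i j z y x y' : ℕ} (h1 : IsSurgery W m S Sj j)
    (h2 : IsSurgery W m Sj Sij i) (hz : z < 2 ^ m) (hx : x < 2 ^ m) (hy' : y' < 2 ^ m)
    (hzc : const W m S z = true) (hxc : const W m Sij x = true) (hyc : const W m Sj y' = true)
    (e1 : edge W m S j z y' = true) (e2 : edge W m Sj i y' x = true)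
    (hl : ladyOk W e S Si Sj Sij i j z y x y' = true) {k : ℕ → Bool}
    (hk : allMoves W e S Si Sj Sij i j z y x k = true) : k y' = true :=
  imp_iff.1 (imp_iff.1 (allSucc_sound h1 hz hy' hzc hyc e1 hk)
    (isSucc_of_edge h2 hy' hx hyc hxc e2)) hl

/-! ### Exhaustive checks over all permutations of the ports. -/

/-- In a ladybug configuration the two crossings are interlaced. -/
def interlaceCheck (W : ℕ) : Bool :=
  imp (lady W 0 1 2 3 0 1) (xor (bit (look W 1 2) 0) (bit (look W 1 3) 0) &&
    xor (bit (look W 1 2) 1) (bit (look W 1 3) 1))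

/-- Every path through one middle vertex of a square corresponds to exactly one path through the
other middle vertex. -/
def faceCheck (W : ℕ) : Bool :=
  allBelow (fun e => imp (sidesOk W e 0 1 2 3 0 1)
    (allConst W 4 (fun z => allSucc W 0 1 0 1 z fun y => allSucc W 1 3 2 3 y fun x =>
      cond (allBelow (fun y' => not (const W 4 2 y' && edge W 4 0 1 z y' && edge W 4 2 0 y' x &&
        ladyOk W e 0 1 2 3 0 1 z y x y')) 16) false
      (allMoves W e 0 1 2 3 0 1 z y x fun y' =>
        allMoves W e 0 1 2 3 0 1 z y x fun y'' => Nat.beq y' y'')) 0)) 4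

/-- All paths from `z` to `x` through the vertices `1` and `3` of the cube. -/
def allPaths (W z x : ℕ) (k : ℕ → ℕ → Bool) : Bool :=
  allSucc W 0 1 0 1 z fun a => allSucc W 1 3 2 3 a fun b => imp (isSucc W 3 7 4 5 b x) (k a b)

/-- The hexagon relation, for a given path from `z` to `x` in the cube. -/
def hexagonCheckAt (W z aw av x : ℕ) : Bool :=
  allBelow (fun e => imp (sidesOk W e 0 4 2 6 2 1 && sidesOk W e 2 6 3 7 2 0 &&
      sidesOk W e 0 2 1 3 1 0 && sidesOk W e 4 6 5 7 1 0 && sidesOk W e 0 4 1 5 2 0 &&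
      sidesOk W e 1 5 3 7 2 1)
    (allMoves W e 0 4 2 6 2 1 z aw av fun bw' =>
      allMoves W e 2 6 3 7 2 0 bw' av x fun bv =>
      allMoves W e 0 2 1 3 1 0 z bw' bv fun bw =>
      allMoves W e 4 6 5 7 1 0 aw av x fun dv' =>
      allMoves W e 0 4 1 5 2 0 z aw dv' fun dw =>
      allMoves W e 1 5 3 7 2 1 dw dv' x fun dv => Nat.beq bw dw && Nat.beq bv dv)) 8

/-- The hexagon relation. It is clear if the path between the given ends is unique. -/
def hexagonCheck (W : ℕ) : Bool :=
  allConst W 6 (fun z => allSucc W 0 4 4 5 z fun aw => allSucc W 4 6 2 3 aw fun av =>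
    allSucc W 6 7 0 1 av fun x =>
      cond (allPaths W z x fun a b => allPaths W z x fun c d =>
        cond (Nat.beq a c) (Nat.beq b d) false) true (hexagonCheckAt W z aw av x)) 0

set_option maxRecDepth 10000 in
theorem allPerms_interlaceCheck :
    allPerms 4 (fun P => strict (table 4 4 P) interlaceCheck) 4 0 0 = true := by decide +kernel

-- No planarity condition is imposed on the 24 permutations; all that remains of planarity is the
-- hypothesis `sidesOk` on the types of the crossings.
set_option maxRecDepth 10000 in
theorem allPerms_faceCheck :
    allPerms 4 (fun P => strict (table 4 4 P) faceCheck) 4 0 0 = true := by decide +kernel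

-- This covers all 720 permutations of six ports. The types of the crossings matter only where the
-- path between the given ends fails to be unique, and there `sidesOk` is assumed on all six
-- squares.
set_option maxRecDepth 10000 in
theorem allPerms_hexagonCheck :
    allPerms 6 (fun P => strict (table 6 8 P) hexagonCheck) 6 0 0 = true := by decide +kernel

end Packed

end KhBurnside

namespace KhBurnside

open Packed

/-! ## Square faces -/

theorem CubeFace.coord_ne {n : ℕ} {u v v' w : Cube n} (h : CubeFace u v v' w) :
    h.vw.coord ≠ h.vw'.coord := by
  intro heq
  apply h.ne
  funext x
  by_cases hx : x = h.vw.coord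
  · rw [hx, h.vw.apply_coord.1, heq, h.vw'.apply_coord.1]
  · rw [h.vw.apply_eq hx, h.vw'.apply_eq (heq ▸ hx)]

theorem CubeFace.uv_coord {n : ℕ} {u v v' w : Cube n} (h : CubeFace u v v' w) :
    h.uv.coord = h.vw'.coord := by
  apply h.uv.coord_eq
  have h1 := h.uv'.le h.vw'.coord
  rw [h.vw'.apply_coord.1] at h1
  rw [h.vw.apply_eq h.coord_ne.symm, h.vw'.apply_coord.2, top_le_iff.1 h1]
  exact Bool.noConfusion

theorem CubeFace.uv'_coord {n : ℕ} {u v v' w : Cube n} (h : CubeFace u v v' w) :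
    h.uv'.coord = h.vw.coord := h.symm.uv_coord

/-- The position of a square in a face of the cube: `S` is the bottom vertex, `Si`, `Sj` are the
middle vertices, and `Sij` is the top vertex. -/
structure Frame.FaceAt {n k : ℕ} (f : Frame n k) {u v v' w : Cube n} (h : CubeFace u v v' w)
    (S Si Sj Sij i j : ℕ) : Prop where
  hi : i < k
  hj : j < k
  lt : Sij < 2 ^ k ∧ Si < 2 ^ k ∧ Sj < 2 ^ k ∧ S < 2 ^ k
  bot : f.point S = w
  left : f.point Si = v
  right : f.point Sj = v'
  top : f.point Sij = u
  coord_i : f.coord i = h.vw.coord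
  coord_j : f.coord j = h.vw'.coord

theorem Frame.point_eq_of_edge {n k : ℕ} (f : Frame n k) {u v : Cube n} (h : CubeEdge u v)
    {S S' j : ℕ} (hj : j < k) (hv : f.point S = v) (hc : f.coord j = h.coord)
    (hS : ∀ i < k, bit S' i = (bit S i || decide (i = j))) : f.point S' = u := by
  funext x
  by_cases hx : ∃ i < k, f.coord i = x
  · obtain ⟨i, hi, rfl⟩ := hx
    rw [f.point_coord S' hi, hS i hi]
    by_cases hij : i = j
    · rw [hij, hc, h.apply_coord.1]
      simp
    · rw [h.apply_eq (hc ▸ fun h' => hij (f.inj _ hi _ hj h')), ← hv, f.point_coord S hi]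
      simp [hij]
  · push Not at hx
    rw [f.point_of_ne S' hx, h.apply_eq (hc ▸ (hx j hj).symm), ← hv, f.point_of_ne S hx]

theorem Frame.FaceAt.mk' {n k : ℕ} (f : Frame n k) {u v v' w : Cube n} (h : CubeFace u v v' w)
    {S Si Sj Sij i j : ℕ} (hi : i < k) (hj : j < k)
    (lt : Sij < 2 ^ k ∧ Si < 2 ^ k ∧ Sj < 2 ^ k ∧ S < 2 ^ k)
    (hSi : ∀ q < k, bit Si q = (bit S q || decide (q = i)))
    (hSj : ∀ q < k, bit Sj q = (bit S q || decide (q = j)))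
    (hSij : ∀ q < k, bit Sij q = (bit Si q || decide (q = j)))
    (bot : f.point S = w) (ci : f.coord i = h.vw.coord) (cj : f.coord j = h.vw'.coord) :
    f.FaceAt h S Si Sj Sij i j where
  hi := hi
  hj := hj
  lt := lt
  bot := bot
  left := f.point_eq_of_edge h.vw hi bot ci hSi
  right := f.point_eq_of_edge h.vw' hj bot cj hSj
  top := f.point_eq_of_edge h.uv hj (f.point_eq_of_edge h.vw hi bot ci hSi)
    (cj.trans h.uv_coord.symm) hSij
  coord_i := ci
  coord_j := cj

/-- The face of the cube given by a square. -/
noncomputable def CubeFace.frame {n : ℕ} {u v v' w : Cube n} (h : CubeFace u v v' w) :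
    Frame n 2 where
  base := w
  coord j := if j = 0 then h.vw.coord else h.vw'.coord
  inj i hi j hj hij := by
    have := h.coord_ne
    interval_cases i <;> interval_cases j <;> simp_all
  base_coord j hj := by
    split_ifs
    · exact h.vw.apply_coord.2
    · exact h.vw'.apply_coord.2

theorem CubeFace.faceAt_frame {n : ℕ} {u v v' w : Cube n} (h : CubeFace u v v' w) :
    h.frame.FaceAt h 0 1 2 3 0 1 :=
  Frame.FaceAt.mk' _ h (by decide) (by decide) (by decide) (by decide) (by decide) (by decide)
    h.frame.point_zero rfl rfl

namespace LinkDiagram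

variable {n k : ℕ} {K : LinkDiagram n}

theorem circle_eq_or (v : Cube n) (c : Fin n) (i : Fin 4) :
    K.circle v (c, i) = K.circle v (c, 0) ∨ K.circle v (c, i) = K.circle v (c, 2) := by
  have h0 := circle_resolve (K := K) v (c, 0)
  have h2 := circle_resolve (K := K) v (c, 2)
  simp only [resolve] at h0 h2
  cases hv : v c <;> rw [hv] at h0 h2 <;> fin_cases i <;> simp_all

/-- A circle that misses the changing crossing at one end of the edge misses it at the other end
too, since it is the same circle. -/
theorem touch_iff {u v : Cube n} (h : CubeEdge u v) (d : HalfEdge n) :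
    (K.circle v d = K.circle v (h.coord, 0) ∨ K.circle v d = K.circle v (h.coord, 2)) ↔
      (K.circle u d = K.circle u (h.coord, 0) ∨ K.circle u d = K.circle u (h.coord, 2)) := by
  have key : ∀ {a b : Cube n}, (∀ c, c ≠ h.coord → b c = a c) →
      (K.circle b d = K.circle b (h.coord, 0) ∨ K.circle b d = K.circle b (h.coord, 2)) →
      (K.circle a d = K.circle a (h.coord, 0) ∨ K.circle a d = K.circle a (h.coord, 2)) := by
    intro a b hab hb
    by_contra ha
    push Not at ha
    have hav : ∀ c i, c = h.coord → K.circle a d ≠ K.circle a (c, i) := by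
      rintro _ i rfl heq
      rcases circle_eq_or (K := K) a h.coord i with h' | h'
      · exact ha.1 (heq.trans h')
      · exact ha.2 (heq.trans h')
    have hiff := circle_eq_iff_of_avoid (u := b) (· = h.coord) hab hav
    rcases hb with hb | hb
    · exact ha.1 ((hiff _).2 hb)
    · exact ha.2 ((hiff _).2 hb)
  exact ⟨key fun c hc => (h.apply_eq hc).symm, key fun c hc => h.apply_eq hc⟩

theorem Orientation.IsTable.isPartition {o : K.Orientation} {f : Frame n k} {W : ℕ}
    (hW : o.IsTable f W) {S : ℕ} (hS : S < 2 ^ k) : IsPartition W (2 * k) S where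
  lt t ht := (hW S t t hS ht ht).2
  refl t ht := (hW S t t hS ht ht).1.1 rfl
  symm t ht s hs h := (hW S s t hS hs ht).1.1 ((hW S t s hS ht hs).1.2 h).symm
  trans t ht s hs r hr h h' := (hW S t r hS ht hr).1.1
    (((hW S t s hS ht hs).1.2 h).trans ((hW S s r hS hs hr).1.2 h'))

/-- At both ends of an edge, the circles at the changing crossing are those through its ports. -/
theorem Orientation.circle_port_or (o : K.Orientation) (c : ℕ → Fin n) (v : Cube n) (j : ℕ) :
    (K.circle v (c j, 0) = K.circle v (o.port c (2 * j)) ∧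
      K.circle v (c j, 2) = K.circle v (o.port c (2 * j + 1))) ∨
    (K.circle v (c j, 0) = K.circle v (o.port c (2 * j + 1)) ∧
      K.circle v (c j, 2) = K.circle v (o.port c (2 * j))) := by
  have h := o.circle_port c v j
  cases hb : (!o.out (c j, 0) && v (c j)) <;> rw [hb] at h
  · exact Or.inl h
  · exact Or.inr h

theorem Orientation.circle_port_false (o : K.Orientation) (c : ℕ → Fin n) (v : Cube n) (j : ℕ)
    (hv : v (c j) = false) :
    K.circle v (c j, 0) = K.circle v (o.port c (2 * j)) ∧
      K.circle v (c j, 2) = K.circle v (o.port c (2 * j + 1)) := by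
  have h := o.circle_port c v j
  rw [hv, Bool.and_false] at h
  exact h

theorem Orientation.isSurgery (o : K.Orientation) {f : Frame n k} {W : ℕ}
    (hW : o.IsTable f W) {u v : Cube n} (h : CubeEdge u v) {S S' j : ℕ} (hS : S < 2 ^ k)
    (hS' : S' < 2 ^ k) (hv : f.point S = v) (hu : f.point S' = u) (hj : j < k)
    (hc : f.coord j = h.coord) : IsSurgery W (2 * k) S S' j := by
  have h0 : 2 * j < 2 * k := by omega
  have h1 : 2 * j + 1 < 2 * k := by omega
  have ev := o.circle_port_or f.coord v j
  have eu := o.circle_port_or f.coord u j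
  rw [hc] at ev eu
  have hWv : ∀ t < 2 * k, ∀ t' < 2 * k, (bit (look W S t) t' = true ↔
      K.circle v (o.port f.coord t) = K.circle v (o.port f.coord t')) := fun t ht t' ht' => by
    rw [← (hW S t t' hS ht ht').1, hv]
  have hWu : ∀ t < 2 * k, ∀ t' < 2 * k, (bit (look W S' t) t' = true ↔
      K.circle u (o.port f.coord t) = K.circle u (o.port f.coord t')) := fun t ht t' ht' => by
    rw [← (hW S' t t' hS' ht ht').1, hu]
  refine ⟨h1, hW.isPartition hS, hW.isPartition hS', fun t ht => ?_, fun hb => ?_⟩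
  · rw [hWv t ht _ h0, hWv t ht _ h1, hWu t ht _ h0, hWu t ht _ h1]
    have := touch_iff (K := K) h (o.port f.coord t)
    rcases ev with ev | ev <;> rcases eu with eu | eu <;> rw [ev.1, ev.2, eu.1, eu.2] at this
    · exact this
    · exact this.trans or_comm
    · exact or_comm.trans this
    · exact or_comm.trans (this.trans or_comm)
  · have hne : K.circle v (h.coord, 0) ≠ K.circle v (h.coord, 2) := by
      intro heq
      rw [Bool.eq_false_iff, Ne, hWv _ h0 _ h1] at hb
      rcases ev with ev | ev <;> rw [ev.1, ev.2] at heq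
      · exact hb heq
      · exact hb heq.symm
    have heq := (circle_eq_iff_ne h).2 hne
    rw [hWu _ h0 _ h1]
    rcases eu with eu | eu <;> rw [eu.1, eu.2] at heq
    · exact heq
    · exact heq.symm

theorem eq_iff_of_or {α : Type*} {p q a b : α} (h : (a = p ∧ b = q) ∨ (a = q ∧ b = p)) :
    p = q ↔ a = b := by
  rcases h with ⟨rfl, rfl⟩ | ⟨rfl, rfl⟩
  · rfl
  · exact eq_comm

theorem all_eq_iff {α : Type*} {p q r s a b a' b' : α} (h : (a = p ∧ b = q) ∨ (a = q ∧ b = p))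
    (h' : (a' = r ∧ b' = s) ∨ (a' = s ∧ b' = r)) :
    p = q ∧ p = r ∧ p = s ↔ b = a ∧ a' = a ∧ b' = a := by
  grind

theorem Orientation.lady_iff (o : K.Orientation) {f : Frame n k} {W : ℕ}
    (hW : o.IsTable f W) {u v v' w : Cube n} {h : CubeFace u v v' w} {S Si Sj Sij i j : ℕ}
    (hf : f.FaceAt h S Si Sj Sij i j) : lady W S Si Sj Sij i j = true ↔ K.IsLadybug h := by
  have hi := hf.hi
  have hj := hf.hj
  have i0 : 2 * i < 2 * k := by omega
  have i1 : 2 * i + 1 < 2 * k := by omega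
  have j0 : 2 * j < 2 * k := by omega
  have j1 : 2 * j + 1 < 2 * k := by omega
  have hb : ∀ {x : Cube n} {S : ℕ}, S < 2 ^ k → f.point S = x → ∀ t < 2 * k, ∀ t' < 2 * k,
      (bit (look W S t) t' = true ↔
      K.circle x (o.port f.coord t) = K.circle x (o.port f.coord t')) :=
    fun hS hx t ht t' ht' => by rw [← (hW _ t t' hS ht ht').1, hx]
  obtain ⟨l1, l2, l3, l4⟩ := hf.lt
  have wi := o.circle_port_or f.coord w i
  have wj := o.circle_port_or f.coord w j
  have vi := o.circle_port_or f.coord v i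
  have vj := o.circle_port_or f.coord v' j
  have ui := o.circle_port_or f.coord u i
  have uj := o.circle_port_or f.coord u j
  rw [hf.coord_i] at wi vi ui
  rw [hf.coord_j] at wj vj uj
  simp only [lady, Bool.and_eq_true, Bool.not_eq_true', Bool.eq_false_iff, Ne,
    hb l4 hf.bot _ i0 _ i1, hb l4 hf.bot _ i0 _ j0, hb l4 hf.bot _ i0 _ j1, hb l2 hf.left _ i0 _ i1,
    hb l3 hf.right _ j0 _ j1, hb l1 hf.top _ i0 _ i1, hb l1 hf.top _ i0 _ j0,
    hb l1 hf.top _ i0 _ j1, and_assoc]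
  unfold IsLadybug
  rw [← all_eq_iff wi wj, ← all_eq_iff ui uj, Ne, Ne, ← eq_iff_of_or vi, ← eq_iff_of_or vj]
  simp only [and_assoc]

/-- In a ladybug configuration the two surgery arcs lie on different sides of the circle. -/
theorem Orientation.out_ne_of_isLadybug (o : K.Orientation) {u v v' w : Cube n}
    {h : CubeFace u v v' w} (hl : K.IsLadybug h) :
    o.out (h.vw.coord, 0) ≠ o.out (h.vw'.coord, 0) := by
  obtain ⟨W, hW, hchk⟩ := o.exists_isTable h.frame (by norm_num) allPerms_interlaceCheck
  have hf := h.faceAt_frame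
  have hlady := (o.lady_iff hW hf).2 hl
  have hx := imp_iff.1 hchk hlady
  rw [Bool.and_eq_true] at hx
  have hb : ∀ t < 2 * 2, ∀ t' < 2 * 2, (bit (look W 1 t) t' = true ↔
      K.circle v (o.port h.frame.coord t) = K.circle v (o.port h.frame.coord t')) :=
    fun t ht t' ht' => by rw [← (hW 1 t t' (by norm_num) ht ht').1, hf.left]
  -- It remains to see the interlacing in `K_v`: of the two arcs at the second crossing, exactly one
  -- lies on the split-off circle through the first. The check supplies this for both ports, since
  -- either may represent the half-edge `0`.
  refine o.out_ne_of_interlaced h.vw h.coord_ne.symm h.vw.apply_coord.2 h.vw'.apply_coord.2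
    (hl.1.2.1.trans hl.1.2.2.symm) ?_
  have ev := o.circle_port_or h.frame.coord v 0
  have ev' := o.circle_port_false h.frame.coord v 1 (by
    change v h.vw'.coord = false
    rw [h.vw.apply_eq h.coord_ne.symm, h.vw'.apply_coord.2])
  change (K.circle v (h.vw.coord, 0) = _ ∧ _) ∨ (K.circle v (h.vw.coord, 0) = _ ∧ _) at ev
  change K.circle v (h.vw'.coord, 0) = _ ∧ K.circle v (h.vw'.coord, 2) = _ at ev'
  rw [ev'.1, ev'.2]
  have b20 := hb 2 (by norm_num) 0 (by norm_num)
  have b30 := hb 3 (by norm_num) 0 (by norm_num)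
  have b21 := hb 2 (by norm_num) 1 (by norm_num)
  have b31 := hb 3 (by norm_num) 1 (by norm_num)
  simp only [mul_zero, mul_one, zero_add, Nat.reduceAdd] at ev ⊢
  rcases ev with ev | ev
  · rw [ev.1, ← b20, ← b30]
    have := hx.1
    revert this
    cases bit (look W 1 2) 0 <;> cases bit (look W 1 3) 0 <;> simp
  · rw [ev.1, ← b21, ← b31]
    have := hx.2
    revert this
    cases bit (look W 1 2) 1 <;> cases bit (look W 1 3) 1 <;> simp

/-- The set of crossings at which the outgoing half-edges are `1` and `3`. -/
def Orientation.typeSet (o : K.Orientation) (f : Frame n k) : ℕ :=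
  Nat.ofBits fun j : Fin k => !o.out (f.coord j, 0)

theorem Orientation.bit_typeSet (o : K.Orientation) (f : Frame n k) {j : ℕ} (hj : j < k) :
    bit (o.typeSet f) j = !o.out (f.coord j, 0) := by
  rw [bit_eq_testBit, Orientation.typeSet, Nat.testBit_ofBits_lt _ _ hj]

theorem Orientation.typeSet_lt (o : K.Orientation) (f : Frame n k) : o.typeSet f < 2 ^ k :=
  Nat.ofBits_lt_two_pow _

theorem Orientation.sidesOk (o : K.Orientation) {f : Frame n k} {W : ℕ}
    (hW : o.IsTable f W) {u v v' w : Cube n} {h : CubeFace u v v' w} {S Si Sj Sij i j : ℕ}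
    (hf : f.FaceAt h S Si Sj Sij i j) : sidesOk W (o.typeSet f) S Si Sj Sij i j = true := by
  refine imp_iff.2 fun hl => ?_
  have := o.out_ne_of_isLadybug ((o.lady_iff hW hf).1 hl)
  rw [o.bit_typeSet f hf.hi, o.bit_typeSet f hf.hj, hf.coord_i, hf.coord_j]
  revert this
  cases o.out (h.vw.coord, 0) <;> cases o.out (h.vw'.coord, 0) <;> simp

/-- The labelings `y` and `y'` of the middle vertices of a square are related by the ladybug
matching. -/
def LadybugRel {u v v' w : Cube n} (h : CubeFace u v v' w) (z : K.Gen w) (y : K.Gen v)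
    (x : K.Gen u) (y' : K.Gen v') : Prop :=
  K.IsLadybug h → z (K.circle w (h.vw.coord, 0)) = Label.plus →
    x (K.circle u (h.vw.coord, 0)) = Label.minus →
    ∀ d, RightTurn h d → y (K.circle v d) = y' (K.circle v' d)

theorem Orientation.turn_mask (o : K.Orientation) (f : Frame n k) {v : Cube n} {S : ℕ}
    (hv : f.point S = v) (y : K.Gen v) {q : ℕ} (hq : q < k) :
    turn (o.typeSet f) S (o.mask f.coord (2 * k) y) q 0 =
      decide (y (K.circle v (f.coord q, 0)) = Label.plus) ∧
    turn (o.typeSet f) S (o.mask f.coord (2 * k) y) q 1 =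
      decide (y (K.circle v (f.coord q, 2)) = Label.plus) := by
  have h := o.circle_port f.coord v q
  have hp := f.point_coord S hq
  rw [hv] at hp
  rw [h.1, h.2, hp, ← o.bit_typeSet f hq]
  unfold turn
  constructor
  · rw [o.bit_mask]
    cases bit (o.typeSet f) q && bit S q <;> simp only [cond_true, cond_false] <;> omega
  · rw [o.bit_mask]
    cases bit (o.typeSet f) q && bit S q <;> simp only [cond_true, cond_false] <;> omega

theorem Orientation.ladyOk_iff (o : K.Orientation) {f : Frame n k} {W : ℕ}
    (hW : o.IsTable f W) {u v v' w : Cube n} {h : CubeFace u v v' w} {S Si Sj Sij i j : ℕ}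
    (hf : f.FaceAt h S Si Sj Sij i j) (z : K.Gen w) (y : K.Gen v) (x : K.Gen u) (y' : K.Gen v') :
    ladyOk W (o.typeSet f) S Si Sj Sij i j (o.mask f.coord (2 * k) z) (o.mask f.coord (2 * k) y)
      (o.mask f.coord (2 * k) x) (o.mask f.coord (2 * k) y') = true ↔ LadybugRel h z y x y' := by
  have hi := hf.hi
  have i0 : 2 * i < 2 * k := by omega
  unfold ladyOk LadybugRel
  rw [imp_iff, o.lady_iff hW hf, imp_iff, imp_iff]
  refine forall_congr' fun hl => ?_
  have wi := o.circle_port_false f.coord w i (hf.coord_i ▸ h.vw.apply_coord.2)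
  rw [o.bit_mask _ _ i0, o.bit_mask _ _ i0, ← wi.1, hf.coord_i, decide_eq_true_iff,
    Bool.not_eq_true', decide_eq_false_iff_not]
  refine imp_congr Iff.rfl (imp_congr ?_ ?_)
  · have : K.circle u (o.port f.coord (2 * i)) = K.circle u (h.vw.coord, 0) := by
      have e := o.circle_port_or f.coord u i
      rw [hf.coord_i] at e
      rcases e with e | e
      · exact e.1.symm
      · exact e.2.symm.trans hl.2.2.2.1
    rw [this]
    cases x (K.circle u (h.vw.coord, 0)) <;> simp
  · have t1 := o.turn_mask f hf.left y hf.hi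
    have t2 := o.turn_mask f hf.left y hf.hj
    have t3 := o.turn_mask f hf.right y' hf.hi
    have t4 := o.turn_mask f hf.right y' hf.hj
    have hlab : ∀ a b : Label, (decide (a = Label.plus) = decide (b = Label.plus)) ↔ a = b := by
      intro a b
      cases a <;> cases b <;> simp
    simp only [t1.1, t1.2, t2.1, t2.2, t3.1, t3.2, t4.1, t4.2, Bool.and_eq_true, beq_iff_eq, hlab,
      hf.coord_i, hf.coord_j]
    constructor
    · rintro ⟨⟨⟨h1, h2⟩, h3⟩, h4⟩ ⟨c, q⟩ ⟨hc, hq⟩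
      rcases hc with hc | hc <;> rcases hq with hq | hq <;> simp only at hc hq <;> subst hc <;>
        subst hq <;> assumption
    · intro hd
      exact ⟨⟨⟨hd _ ⟨Or.inl rfl, Or.inl rfl⟩, hd _ ⟨Or.inl rfl, Or.inr rfl⟩⟩,
        hd _ ⟨Or.inr rfl, Or.inl rfl⟩⟩, hd _ ⟨Or.inr rfl, Or.inr rfl⟩⟩

/-! ### The correspondence of paths across a square. -/

/-- The two paths from `z` to `x` through the middle vertices of a square correspond under the face
map. -/
structure FaceRel {u v v' w : Cube n} (h : CubeFace u v v' w) (z : K.Gen w) (y : K.Gen v)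
    (x : K.Gen u) (y' : K.Gen v') : Prop where
  zy : K.edgeMatrix h.vw y z = 1
  yx : K.edgeMatrix h.uv x y = 1
  zy' : K.edgeMatrix h.vw' y' z = 1
  yx' : K.edgeMatrix h.uv' x y' = 1
  ladybug : LadybugRel h z y x y'

theorem IsLadybug.symm {u v v' w : Cube n} {h : CubeFace u v v' w} (hl : K.IsLadybug h) :
    K.IsLadybug h.symm := by
  obtain ⟨⟨h1, h2, h3⟩, h4, h5, h6, h7, h8⟩ := hl
  exact ⟨⟨h3.trans h2.symm, h2.symm, h1.trans h2.symm⟩, h5, h4, h8.trans h7.symm, h7.symm,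
    h6.trans h7.symm⟩

theorem FaceRel.symm {u v v' w : Cube n} {h : CubeFace u v v' w} {z : K.Gen w} {y : K.Gen v}
    {x : K.Gen u} {y' : K.Gen v'} (hr : FaceRel h z y x y') : FaceRel h.symm z y' x y where
  zy := hr.zy'
  yx := hr.yx'
  zy' := hr.zy
  yx' := hr.yx
  ladybug hl hz hx d hd := by
    have hl' : K.IsLadybug h := hl.symm
    refine (hr.ladybug hl' ?_ ?_ d ⟨hd.1.symm, hd.2⟩).symm
    · rw [← hl'.1.2.1]
      exact hz
    · rw [← hl'.2.2.2.2.1]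
      exact hx

/-- The edges of a square, in terms of the labels near its crossings. -/
theorem Orientation.edge_faceAt (o : K.Orientation) {f : Frame n k} {W : ℕ}
    (hW : o.IsTable f W) {u v v' w : Cube n} {h : CubeFace u v v' w} {S Si Sj Sij i j : ℕ}
    (hf : f.FaceAt h S Si Sj Sij i j) (z : K.Gen w) (y : K.Gen v) (x : K.Gen u) :
    (K.edgeMatrix h.vw y z = 1 ↔ o.AgreeOff f y z ∧
      edge W (2 * k) S i (o.mask f.coord (2 * k) z) (o.mask f.coord (2 * k) y) = true) ∧
    (K.edgeMatrix h.uv x y = 1 ↔ o.AgreeOff f x y ∧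
      edge W (2 * k) Si j (o.mask f.coord (2 * k) y) (o.mask f.coord (2 * k) x) = true) :=
  ⟨o.edgeMatrix_eq_one_iff hW h.vw hf.lt.2.2.2 hf.bot hf.left hf.hi hf.coord_i y z,
    o.edgeMatrix_eq_one_iff hW h.uv hf.lt.2.1 hf.left hf.top hf.hj
      (hf.coord_j.trans h.uv_coord.symm) x y⟩

theorem _root_.KhBurnside.Frame.FaceAt.symm {f : Frame n k} {u v v' w : Cube n}
    {h : CubeFace u v v' w} {S Si Sj Sij i j : ℕ} (hf : f.FaceAt h S Si Sj Sij i j) :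
    f.FaceAt h.symm S Sj Si Sij j i :=
  ⟨hf.hj, hf.hi, ⟨hf.lt.1, hf.lt.2.2.1, hf.lt.2.1, hf.lt.2.2.2⟩, hf.bot, hf.right, hf.left, hf.top,
    hf.coord_j, hf.coord_i⟩

theorem Orientation.isSurgery_faceAt (o : K.Orientation) {f : Frame n k} {W : ℕ}
    (hW : o.IsTable f W) {u v v' w : Cube n} {h : CubeFace u v v' w} {S Si Sj Sij i j : ℕ}
    (hf : f.FaceAt h S Si Sj Sij i j) :
    IsSurgery W (2 * k) S Si i ∧ IsSurgery W (2 * k) Si Sij j :=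
  ⟨o.isSurgery hW h.vw hf.lt.2.2.2 hf.lt.2.1 hf.bot hf.left hf.hi hf.coord_i,
    o.isSurgery hW h.uv hf.lt.2.1 hf.lt.1 hf.left hf.top hf.hj (hf.coord_j.trans h.uv_coord.symm)⟩

theorem Orientation.allMoves_of_faceRel (o : K.Orientation) {f : Frame n k} {W : ℕ}
    (hW : o.IsTable f W) {u v v' w : Cube n} {h : CubeFace u v v' w} {S Si Sj Sij i j : ℕ}
    (hf : f.FaceAt h S Si Sj Sij i j) {z : K.Gen w} {y : K.Gen v} {x : K.Gen u} {y' : K.Gen v'}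
    (hr : FaceRel h z y x y') {p : ℕ → Bool}
    (hp : allMoves W (o.typeSet f) S Si Sj Sij i j (o.mask f.coord (2 * k) z)
      (o.mask f.coord (2 * k) y) (o.mask f.coord (2 * k) x) p = true) :
    p (o.mask f.coord (2 * k) y') = true := by
  have e := o.edge_faceAt hW hf.symm z y' x
  have s := o.isSurgery_faceAt hW hf.symm
  exact allMoves_sound s.1 s.2 (o.mask_lt _ _) (o.mask_lt _ _) (o.mask_lt _ _)
    (o.const_mask hW hf.lt.2.2.2 hf.bot z) (o.const_mask hW hf.lt.1 hf.top x)
    (o.const_mask hW hf.lt.2.2.1 hf.right y') (e.1.1 hr.zy').2 (e.2.1 hr.yx').2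
    ((o.ladyOk_iff hW hf z y x y').2 hr.ladybug) hp

theorem Orientation.allSucc_of_edge (o : K.Orientation) {f : Frame n k} {W : ℕ}
    (hW : o.IsTable f W) {u v v' w : Cube n} {h : CubeFace u v v' w} {S Si Sj Sij i j : ℕ}
    (hf : f.FaceAt h S Si Sj Sij i j) {z : K.Gen w} {y : K.Gen v}
    (hzy : K.edgeMatrix h.vw y z = 1) {p : ℕ → Bool}
    (hp : allSucc W S Si (2 * i) (2 * i + 1) (o.mask f.coord (2 * k) z) p = true) :
    p (o.mask f.coord (2 * k) y) = true :=
  allSucc_sound (o.isSurgery_faceAt hW hf).1 (o.mask_lt _ _) (o.mask_lt _ _)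
    (o.const_mask hW hf.lt.2.2.2 hf.bot z) (o.const_mask hW hf.lt.2.1 hf.left y)
    ((o.edgeMatrix_eq_one_iff hW h.vw hf.lt.2.2.2 hf.bot hf.left hf.hi hf.coord_i y z).1 hzy).2 hp

theorem Orientation.allSucc_of_edge' (o : K.Orientation) {f : Frame n k} {W : ℕ}
    (hW : o.IsTable f W) {u v v' w : Cube n} {h : CubeFace u v v' w} {S Si Sj Sij i j : ℕ}
    (hf : f.FaceAt h S Si Sj Sij i j) {y : K.Gen v} {x : K.Gen u}
    (hyx : K.edgeMatrix h.uv x y = 1) {p : ℕ → Bool}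
    (hp : allSucc W Si Sij (2 * j) (2 * j + 1) (o.mask f.coord (2 * k) y) p = true) :
    p (o.mask f.coord (2 * k) x) = true :=
  allSucc_sound (o.isSurgery_faceAt hW hf).2 (o.mask_lt _ _) (o.mask_lt _ _)
    (o.const_mask hW hf.lt.2.1 hf.left y) (o.const_mask hW hf.lt.1 hf.top x)
    ((o.edgeMatrix_eq_one_iff hW h.uv hf.lt.2.1 hf.left hf.top hf.hj
      (hf.coord_j.trans h.uv_coord.symm) x y).1 hyx).2 hp

/-- The check finds a mask for `y'` and shows that any two candidates have the same mask.
`exists_mask_eq` turns the mask into a labeling that copies `z` off the square, and `gen_ext` turns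
equality of masks into equality of labelings. -/
theorem existsUnique_faceRel {u v v' w : Cube n} (h : CubeFace u v v' w) {z : K.Gen w}
    {y : K.Gen v} {x : K.Gen u} (hzy : K.edgeMatrix h.vw y z = 1)
    (hyx : K.edgeMatrix h.uv x y = 1) : ∃! y', FaceRel h z y x y' := by
  obtain ⟨o⟩ := K.nonempty_orientation
  let f := h.frame
  obtain ⟨W, hW, hchk⟩ := o.exists_isTable f (by norm_num) allPerms_faceCheck
  have hf : f.FaceAt h 0 1 2 3 0 1 := h.faceAt_frame
  have h1 := imp_iff.1 (allBelow_iff.1 hchk _ (o.typeSet_lt f)) (o.sidesOk hW hf)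
  have h2 := allConst_sound (hW.isPartition (by norm_num)) (o.mask_lt f.coord z)
    (o.const_mask hW (by norm_num) hf.bot z) h1
  have h3 := o.allSucc_of_edge hW hf hzy h2
  have h4 := o.allSucc_of_edge' hW hf hyx h3
  have e := o.edge_faceAt hW hf z y x
  rw [Bool.cond_eq_ite] at h4
  split_ifs at h4 with h5
  rw [allBelow_iff] at h5
  push Not at h5
  obtain ⟨Y, hY, hY'⟩ := h5
  rw [Ne, Bool.not_eq_true, Bool.not_eq_false', Bool.and_eq_true, Bool.and_eq_true,
    Bool.and_eq_true] at hY'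
  obtain ⟨⟨⟨c1, c2⟩, c3⟩, c4⟩ := hY'
  obtain ⟨y', hy', rfl⟩ := o.exists_mask_eq hW hf.lt.2.2.1 hf.right (hf.bot ▸ f.point_mem 0) z hY c1
  have e' := o.edge_faceAt hW hf.symm z y' x
  have hxz : o.AgreeOff f x z := ((e.2.1 hyx).1).trans (e.1.1 hzy).1
  refine ⟨y', ⟨hzy, hyx, e'.1.2 ⟨hy', c2⟩, e'.2.2 ⟨hxz.trans hy'.symm, c3⟩,
    (o.ladyOk_iff hW hf z y x y').1 c4⟩, fun y'' hr => ?_⟩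
  have e'' := o.edge_faceAt hW hf.symm z y'' x
  refine o.gen_ext f (hf.right ▸ f.point_mem 2) (e''.1.1 hr.zy').1 hy' ?_
  have hr' : FaceRel h z y x y' := ⟨hzy, hyx, e'.1.2 ⟨hy', c2⟩,
    e'.2.2 ⟨hxz.trans hy'.symm, c3⟩, (o.ladyOk_iff hW hf z y x y').1 c4⟩
  -- The check compares every pair of candidates, so it is applied to `y''` first and then to `y'`.
  have h6 := o.allMoves_of_faceRel hW hf hr h4
  have h7 := o.allMoves_of_faceRel hW hf hr' h6
  exact Nat.eq_of_beq_eq_true h7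

end LinkDiagram

end KhBurnside

namespace KhBurnside

open Packed

/-! ## Three-dimensional faces -/

section

variable {n : ℕ} {u v v' v'' w w' w'' z : Cube n}

theorem CubeSolid.coord_ne (h : CubeSolid u v v' v'' w w' w'' z) :
    h.bot₃.vw'.coord ≠ h.bot₃.vw.coord ∧ h.bot₃.vw'.coord ≠ h.bot₁.vw.coord ∧
      h.bot₃.vw.coord ≠ h.bot₁.vw.coord :=
  ⟨h.bot₃.coord_ne.symm, h.bot₂.coord_ne.symm, h.bot₁.coord_ne.symm⟩

/-- The face of the cube given by a three-dimensional face. -/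
noncomputable def CubeSolid.frame (h : CubeSolid u v v' v'' w w' w'' z) : Frame n 3 where
  base := z
  coord j := if j = 0 then h.bot₃.vw'.coord else if j = 1 then h.bot₃.vw.coord
    else h.bot₁.vw.coord
  inj i hi j hj hij := by
    obtain ⟨h1, h2, h3⟩ := h.coord_ne
    interval_cases i <;> interval_cases j <;> simp_all
  base_coord j hj := by
    split_ifs
    · exact h.bot₃.vw'.apply_coord.2
    · exact h.bot₃.vw.apply_coord.2
    · exact h.bot₁.vw.apply_coord.2

theorem CubeSolid.bot₁_faceAt (h : CubeSolid u v v' v'' w w' w'' z) :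
    h.frame.FaceAt h.bot₁ 0 4 2 6 2 1 :=
  Frame.FaceAt.mk' _ _ (by decide) (by decide) (by decide) (by decide) (by decide) (by decide)
    h.frame.point_zero rfl rfl

theorem CubeSolid.bot₂_faceAt (h : CubeSolid u v v' v'' w w' w'' z) :
    h.frame.FaceAt h.bot₂ 0 4 1 5 2 0 :=
  Frame.FaceAt.mk' _ _ (by decide) (by decide) (by decide) (by decide) (by decide) (by decide)
    h.frame.point_zero rfl rfl

theorem CubeSolid.bot₃_faceAt (h : CubeSolid u v v' v'' w w' w'' z) :
    h.frame.FaceAt h.bot₃ 0 2 1 3 1 0 :=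
  Frame.FaceAt.mk' _ _ (by decide) (by decide) (by decide) (by decide) (by decide) (by decide)
    h.frame.point_zero rfl rfl

theorem CubeSolid.top₁_faceAt (h : CubeSolid u v v' v'' w w' w'' z) :
    h.frame.FaceAt h.top₁ 4 6 5 7 1 0 :=
  Frame.FaceAt.mk' _ _ (by decide) (by decide) (by decide) (by decide) (by decide) (by decide)
    h.bot₁_faceAt.left h.bot₁.uv_coord.symm h.bot₂.uv_coord.symm

theorem CubeSolid.top₂_faceAt (h : CubeSolid u v v' v'' w w' w'' z) :
    h.frame.FaceAt h.top₂ 2 6 3 7 2 0 :=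
  Frame.FaceAt.mk' _ _ (by decide) (by decide) (by decide) (by decide) (by decide) (by decide)
    h.bot₁_faceAt.right h.bot₁.uv'_coord.symm h.bot₃.uv_coord.symm

theorem CubeSolid.top₃_faceAt (h : CubeSolid u v v' v'' w w' w'' z) :
    h.frame.FaceAt h.top₃ 1 5 3 7 2 1 :=
  Frame.FaceAt.mk' _ _ (by decide) (by decide) (by decide) (by decide) (by decide) (by decide)
    h.bot₂_faceAt.right h.bot₂.uv'_coord.symm h.bot₃.uv'_coord.symm

end

namespace LinkDiagram

variable {n : ℕ} {K : LinkDiagram n} {u v v' v'' w w' w'' z : Cube n}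

theorem Orientation.isSucc_of_edge' {k : ℕ} (o : K.Orientation) {f : Frame n k} {W : ℕ}
    (hW : o.IsTable f W) {u v v' w : Cube n} {h : CubeFace u v v' w} {S Si Sj Sij i j : ℕ}
    (hf : f.FaceAt h S Si Sj Sij i j) {y : K.Gen v} {x : K.Gen u}
    (hyx : K.edgeMatrix h.uv x y = 1) :
    isSucc W Si Sij (2 * j) (2 * j + 1) (o.mask f.coord (2 * k) y)
      (o.mask f.coord (2 * k) x) = true :=
  isSucc_of_edge (o.isSurgery_faceAt hW hf).2 (o.mask_lt _ _) (o.mask_lt _ _)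
    (o.const_mask hW hf.lt.2.1 hf.left y) (o.const_mask hW hf.lt.1 hf.top x)
    ((o.edgeMatrix_eq_one_iff hW h.uv hf.lt.2.1 hf.left hf.top hf.hj
      (hf.coord_j.trans h.uv_coord.symm) x y).1 hyx).2

/-- The hexagon relation: both ways to move a path across a three-dimensional face agree. -/
theorem hexagon_faceRel (h : CubeSolid u v v' v'' w w' w'' z) {z₀ : K.Gen z} {x₀ : K.Gen u}
    {a₁ : K.Gen w''} {a₂ : K.Gen v} {b₁ : K.Gen w'} {b₂ : K.Gen v''} {b₃ : K.Gen w}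
    {c₁ : K.Gen v'} {c₂ : K.Gen w} {c₃ : K.Gen v''} (h₁ : FaceRel h.bot₁ z₀ a₁ a₂ b₁)
    (h₂ : FaceRel h.top₂ b₁ a₂ x₀ b₂) (h₃ : FaceRel h.bot₃ z₀ b₁ b₂ b₃)
    (h₄ : FaceRel h.top₁ a₁ a₂ x₀ c₁) (h₅ : FaceRel h.bot₂ z₀ a₁ c₁ c₂)
    (h₆ : FaceRel h.top₃ c₂ c₁ x₀ c₃) : b₃ = c₂ ∧ b₂ = c₃ := by
  obtain ⟨o⟩ := K.nonempty_orientation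
  let f := h.frame
  obtain ⟨W, hW, hchk⟩ := o.exists_isTable f (by norm_num) allPerms_hexagonCheck
  have f₁ : f.FaceAt _ _ _ _ _ _ _ := h.bot₁_faceAt
  have f₂ : f.FaceAt _ _ _ _ _ _ _ := h.top₂_faceAt
  have f₃ : f.FaceAt _ _ _ _ _ _ _ := h.bot₃_faceAt
  have f₄ : f.FaceAt _ _ _ _ _ _ _ := h.top₁_faceAt
  have f₅ : f.FaceAt _ _ _ _ _ _ _ := h.bot₂_faceAt
  have f₆ : f.FaceAt _ _ _ _ _ _ _ := h.top₃_faceAt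
  have agree₁ : ∀ {b : K.Gen w}, K.edgeMatrix h.bot₃.vw' b z₀ = 1 → o.AgreeOff f b z₀ :=
    fun hb => ((o.edge_faceAt hW f₃.symm z₀ _ b₂).1.1 hb).1
  have agree₂ : ∀ {c : K.Gen w} {b : K.Gen v''}, K.edgeMatrix h.bot₃.vw' c z₀ = 1 →
      K.edgeMatrix h.bot₃.uv' b c = 1 → o.AgreeOff f b z₀ :=
    fun hc hb => ((o.edge_faceAt hW f₃.symm z₀ _ _).2.1 hb).1.trans (agree₁ hc)
  suffices hm : o.mask f.coord (2 * 3) b₃ = o.mask f.coord (2 * 3) c₂ ∧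
      o.mask f.coord (2 * 3) b₂ = o.mask f.coord (2 * 3) c₃ from
    ⟨o.gen_ext f (f₃.right ▸ f.point_mem 1) (agree₁ h₃.zy') (agree₁ h₅.zy') hm.1,
      o.gen_ext f (f₃.top ▸ f.point_mem 3) (agree₂ h₃.zy' h₃.yx') (agree₂ h₅.zy' h₆.zy') hm.2⟩
  have k₀ := allConst_sound (hW.isPartition (by norm_num)) (o.mask_lt f.coord z₀)
    (o.const_mask hW (by norm_num) f₁.bot z₀) hchk
  have k₁ := o.allSucc_of_edge hW f₁ h₁.zy k₀
  have k₂ := o.allSucc_of_edge' hW f₁ h₁.yx k₁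
  have k₃ := o.allSucc_of_edge' hW f₂ h₂.yx k₂
  -- Both resulting paths run through `w` and `v''`, the vertices numbered 1 and 3, and have the
  -- same ends. If only one such path exists, there is nothing more to compare.
  have paths : ∀ {p : ℕ → ℕ → Bool} {c : K.Gen w} {b : K.Gen v''},
      K.edgeMatrix h.bot₃.vw' c z₀ = 1 → K.edgeMatrix h.bot₃.uv' b c = 1 →
      K.edgeMatrix h.top₃.uv' x₀ b = 1 → allPaths W (o.mask f.coord (2 * 3) z₀)
        (o.mask f.coord (2 * 3) x₀) p = true →
      p (o.mask f.coord (2 * 3) c) (o.mask f.coord (2 * 3) b) = true :=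
    fun hc hb hx hp => imp_iff.1 (o.allSucc_of_edge' hW f₃.symm hb
      (o.allSucc_of_edge hW f₃.symm hc hp)) (o.isSucc_of_edge' hW f₆.symm hx)
  rw [Bool.cond_eq_ite] at k₃
  split_ifs at k₃ with k₄
  · have k₅ := paths h₅.zy' h₆.zy' h₆.yx' (paths h₃.zy' h₃.yx' h₂.yx' k₄)
    rw [Bool.cond_eq_ite] at k₅
    split_ifs at k₅ with k₆
    exact ⟨Nat.eq_of_beq_eq_true k₆, Nat.eq_of_beq_eq_true k₅⟩
  · have k₅ := imp_iff.1 (allBelow_iff.1 k₃ _ (o.typeSet_lt f)) (by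
      rw [o.sidesOk hW f₁, o.sidesOk hW f₂, o.sidesOk hW f₃, o.sidesOk hW f₄, o.sidesOk hW f₅,
        o.sidesOk hW f₆]
      rfl)
    have k₆ := o.allMoves_of_faceRel hW f₆ h₆ (o.allMoves_of_faceRel hW f₅ h₅
      (o.allMoves_of_faceRel hW f₄ h₄ (o.allMoves_of_faceRel hW f₃ h₃
      (o.allMoves_of_faceRel hW f₂ h₂ (o.allMoves_of_faceRel hW f₁ h₁ k₅)))))
    rw [Bool.and_eq_true] at k₆
    exact ⟨Nat.eq_of_beq_eq_true k₆.1, Nat.eq_of_beq_eq_true k₆.2⟩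

end LinkDiagram

end KhBurnside

namespace KhBurnside

namespace LinkDiagram

variable {n : ℕ} {K : LinkDiagram n}

/-! ## The face maps -/

/-- The element of a composition of two edge correspondences given by three generators. -/
def pathElem {u v w : Cube n} {h : CubeEdge u v} {h' : CubeEdge v w} {z : K.Gen w} {y : K.Gen v}
    {x : K.Gen u} (hzy : K.edgeMatrix h' y z = 1) (hyx : K.edgeMatrix h x y = 1) :
    ((K.khEdge h').comp (K.khEdge h)).carrier :=
  ⟨(⟨(z, y), hzy⟩, ⟨(y, x), hyx⟩), rfl⟩

theorem exists_eq_pathElem {u v w : Cube n} {h : CubeEdge u v} {h' : CubeEdge v w}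
    (p : ((K.khEdge h').comp (K.khEdge h)).carrier) :
    ∃ (z : K.Gen w) (y : K.Gen v) (x : K.Gen u) (hzy : K.edgeMatrix h' y z = 1)
      (hyx : K.edgeMatrix h x y = 1), p = pathElem hzy hyx := by
  obtain ⟨⟨⟨⟨z, y⟩, hzy⟩, ⟨⟨y', x⟩, hyx⟩⟩, hp⟩ := p
  obtain rfl : y = y' := hp
  exact ⟨z, y, x, hzy, hyx, rfl⟩

theorem pathElem_congr {u v w : Cube n} {h : CubeEdge u v} {h' : CubeEdge v w} {z : K.Gen w}
    {y y' : K.Gen v} {x : K.Gen u} (hzy : K.edgeMatrix h' y z = 1) (hyx : K.edgeMatrix h x y = 1)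
    (hzy' : K.edgeMatrix h' y' z = 1) (hyx' : K.edgeMatrix h x y' = 1) (hy : y = y') :
    pathElem hzy hyx = pathElem hzy' hyx' := by
  subst hy
  rfl

/-- The face maps are given by the relation `FaceRel`. -/
def IsFaceRel (Φ : K.khVertexEdgeData.FaceMaps) : Prop :=
  ∀ (u v v' w : Cube n) (h : CubeFace u v v' w) (z : K.Gen w) (y : K.Gen v) (x : K.Gen u)
    (y' : K.Gen v') (hr : FaceRel h z y x y'),
    (Φ u v v' w h).toEquiv (pathElem hr.zy hr.yx) = pathElem hr.zy' hr.yx'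

/-- A 2-morphism preserves the ends `z` and `x` of a path, so only the middle labeling is open. The
ladybug condition puts the image into the relation `FaceRel`, where the middle labeling is unique.
-/
theorem isFaceRel_iff (Φ : K.khVertexEdgeData.FaceMaps) :
    IsFaceRel Φ ↔ K.IsLadybugMatching Φ := by
  constructor
  · intro hΦ u v v' w h hl z y x y' hzy hyx hzy' hyx' hz hx heq
    obtain ⟨y'', hr, -⟩ := existsUnique_faceRel h hzy hyx
    have h1 := hΦ u v v' w h z y x y'' hr
    have h2 : pathElem hr.zy' hr.yx' = pathElem hzy' hyx' := h1.symm.trans heq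
    have h3 : y'' = y' := congrArg (fun p => p.1.1.1.2) h2
    exact h3 ▸ hr.ladybug hl hz hx
  · intro hΦ u v v' w h z y x y' hr
    obtain ⟨z', y'', x', hzy, hyx, h1⟩ := exists_eq_pathElem ((Φ u v v' w h).toEquiv
      (pathElem hr.zy hr.yx))
    have hs := (Φ u v v' w h).s_comm (pathElem hr.zy hr.yx)
    have ht := (Φ u v v' w h).t_comm (pathElem hr.zy hr.yx)
    rw [h1] at hs ht
    obtain rfl : x' = x := hs
    obtain rfl : z' = z := ht
    rw [h1]
    refine pathElem_congr _ _ _ _ ((existsUnique_faceRel h hr.zy hr.yx).unique ?_ hr)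
    exact ⟨hr.zy, hr.yx, hzy, hyx, fun hl hz hx =>
      hΦ u v v' w h hl _ _ _ _ hr.zy hr.yx hzy hyx hz hx h1⟩

/-- The unique partners give maps in both directions across each square. They are mutually inverse
because the relation is symmetric. -/
theorem exists_isFaceRel (K : LinkDiagram n) : ∃ Φ : K.khVertexEdgeData.FaceMaps, IsFaceRel Φ := by
  have key : ∀ {u v v' w : Cube n} (h : CubeFace u v v' w)
      (p : ((K.khEdge h.vw).comp (K.khEdge h.uv)).carrier),
      ∃ q : ((K.khEdge h.vw').comp (K.khEdge h.uv')).carrier, ∃ z y x y',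
        ∃ hr : FaceRel h z y x y', p = pathElem hr.zy hr.yx ∧ q = pathElem hr.zy' hr.yx' := by
    intro u v v' w h p
    obtain ⟨z, y, x, hzy, hyx, rfl⟩ := exists_eq_pathElem p
    obtain ⟨y', hr, -⟩ := existsUnique_faceRel h hzy hyx
    exact ⟨_, z, y, x, y', hr, rfl, rfl⟩
  choose φ hφ using @key
  have hval : ∀ {u v v' w : Cube n} (h : CubeFace u v v' w) {z : K.Gen w} {y : K.Gen v}
      {x : K.Gen u} {y' : K.Gen v'} (hr : FaceRel h z y x y'),
      φ h (pathElem hr.zy hr.yx) = pathElem hr.zy' hr.yx' := by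
    intro u v v' w h z y x y' hr
    obtain ⟨z₁, y₁, x₁, y₁', hr₁, h1, h2⟩ := hφ h (pathElem hr.zy hr.yx)
    obtain rfl : z = z₁ := congrArg (fun p => p.1.1.1.1) h1
    obtain rfl : y = y₁ := congrArg (fun p => p.1.1.1.2) h1
    obtain rfl : x = x₁ := congrArg (fun p => p.1.2.1.2) h1
    rw [h2]
    exact pathElem_congr _ _ _ _ ((existsUnique_faceRel h hr.zy hr.yx).unique hr₁ hr)
  have inv : ∀ {u v v' w : Cube n} (h : CubeFace u v v' w)
      (p : ((K.khEdge h.vw).comp (K.khEdge h.uv)).carrier), φ h.symm (φ h p) = p := by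
    intro u v v' w h p
    obtain ⟨z, y, x, y', hr, h1, h2⟩ := hφ h p
    rw [h2, h1]
    exact hval h.symm hr.symm
  -- A square reflected twice is the original one by proof irrelevance, so `inv h.symm` serves as
  -- the other inverse law.
  refine ⟨fun u v v' w h => ⟨⟨φ h, φ h.symm, inv h, inv h.symm⟩, fun p => ?_, fun p => ?_⟩,
    fun u v v' w h z y x y' hr => hval h hr⟩
  · obtain ⟨z, y, x, y', hr, h1, h2⟩ := hφ h p
    change ((K.khEdge h.vw').comp (K.khEdge h.uv')).s (φ h p) = _
    rw [h2, h1]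
    rfl
  · obtain ⟨z, y, x, y', hr, h1, h2⟩ := hφ h p
    change ((K.khEdge h.vw').comp (K.khEdge h.uv')).t (φ h p) = _
    rw [h2, h1]
    rfl

theorem IsFaceRel.eq {Φ Ψ : K.khVertexEdgeData.FaceMaps} (hΦ : IsFaceRel Φ) (hΨ : IsFaceRel Ψ) :
    Ψ = Φ := by
  funext u v v' w h
  refine TwoMor.ext (Equiv.ext fun p => ?_)
  obtain ⟨z, y, x, hzy, hyx, rfl⟩ := exists_eq_pathElem p
  obtain ⟨y', hr, -⟩ := existsUnique_faceRel h hzy hyx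
  exact (hΨ _ _ _ _ h _ _ _ _ hr).trans (hΦ _ _ _ _ h _ _ _ _ hr).symm

theorem IsFaceRel.matching {Φ : K.khVertexEdgeData.FaceMaps} (hΦ : IsFaceRel Φ) :
    (K.khData Φ).Matching := by
  intro u v v' w h
  refine TwoMor.ext (Equiv.ext fun p => ?_)
  obtain ⟨z, y, x, hzy, hyx, rfl⟩ := exists_eq_pathElem (h := h.symm.uv) (h' := h.symm.vw) p
  obtain ⟨y', hr, -⟩ := existsUnique_faceRel h.symm hzy hyx
  refine (hΦ _ _ _ _ h.symm _ _ _ _ hr).trans ?_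
  refine (Equiv.symm_apply_eq _).2 ?_ |>.symm
  exact (hΦ _ _ _ _ h _ _ _ _ hr.symm).symm

/-- Both composites are followed on one path, replacing one middle labeling at a time;
`hexagon_faceRel` identifies the two outcomes. -/
theorem IsFaceRel.hexagon {Φ : K.khVertexEdgeData.FaceMaps} (hΦ : IsFaceRel Φ) :
    (K.khData Φ).Hexagon := by
  intro u v v' v'' w w' w'' z h
  refine TwoMor.ext (Equiv.ext fun p => ?_)
  obtain ⟨⟨q, ⟨⟨a, x⟩, hax⟩⟩, hp⟩ := p
  obtain ⟨z₀, a₁, a₂, hz, ha, rfl⟩ := exists_eq_pathElem (h := h.bot₁.uv) (h' := h.bot₁.vw) q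
  obtain rfl : a₂ = a := hp
  obtain ⟨b₁, h₁, -⟩ := existsUnique_faceRel h.bot₁ hz ha
  obtain ⟨b₂, h₂, -⟩ := existsUnique_faceRel h.top₂ h₁.yx' hax
  obtain ⟨b₃, h₃, -⟩ := existsUnique_faceRel h.bot₃ h₁.zy' h₂.zy'
  obtain ⟨c₁, h₄, -⟩ := existsUnique_faceRel h.top₁ ha hax
  obtain ⟨c₂, h₅, -⟩ := existsUnique_faceRel h.bot₂ hz h₄.zy'
  obtain ⟨c₃, h₆, -⟩ := existsUnique_faceRel h.top₃ h₅.yx' h₄.yx'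
  obtain ⟨rfl, rfl⟩ := hexagon_faceRel h h₁ h₂ h₃ h₄ h₅ h₆
  have e₁ := hΦ _ _ _ _ _ _ _ _ _ h₁
  have e₂ := hΦ _ _ _ _ _ _ _ _ _ h₂
  have e₃ := hΦ _ _ _ _ _ _ _ _ _ h₃
  have e₄ := hΦ _ _ _ _ _ _ _ _ _ h₄
  have e₅ := hΦ _ _ _ _ _ _ _ _ _ h₅
  have e₆ := hΦ _ _ _ _ _ _ _ _ _ h₆
  have l₁ : (TwoMor.whiskerRight (Φ _ _ _ _ h.bot₁) (K.khEdge h.top₁.uv)).toEquiv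
      ⟨(pathElem hz ha, ⟨(a₂, x), hax⟩), rfl⟩ =
      ⟨(pathElem h₁.zy' h₁.yx', ⟨(a₂, x), hax⟩), rfl⟩ := Subtype.ext (Prod.ext e₁ rfl)
  have l₂ : (TwoMor.whiskerLeft (K.khEdge h.bot₁.vw') (Φ _ _ _ _ h.top₂)).toEquiv
      ⟨(⟨(z₀, b₁), h₁.zy'⟩, pathElem h₁.yx' hax), rfl⟩ =
      ⟨(⟨(z₀, b₁), h₁.zy'⟩, pathElem h₂.zy' h₂.yx'), rfl⟩ := Subtype.ext (Prod.ext rfl e₂)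
  have l₃ : (TwoMor.whiskerRight (Φ _ _ _ _ h.bot₃) (K.khEdge h.top₂.uv')).toEquiv
      ⟨(pathElem h₁.zy' h₂.zy', ⟨(b₂, x), h₂.yx'⟩), rfl⟩ =
      ⟨(pathElem h₃.zy' h₃.yx', ⟨(b₂, x), h₂.yx'⟩), rfl⟩ := Subtype.ext (Prod.ext e₃ rfl)
  have r₁ : (TwoMor.whiskerLeft (K.khEdge h.bot₁.vw) (Φ _ _ _ _ h.top₁)).toEquiv
      ⟨(⟨(z₀, a₁), hz⟩, pathElem ha hax), rfl⟩ =
      ⟨(⟨(z₀, a₁), hz⟩, pathElem h₄.zy' h₄.yx'), rfl⟩ := Subtype.ext (Prod.ext rfl e₄)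
  have r₂ : (TwoMor.whiskerRight (Φ _ _ _ _ h.bot₂) (K.khEdge h.top₁.uv')).toEquiv
      ⟨(pathElem hz h₄.zy', ⟨(c₁, x), h₄.yx'⟩), rfl⟩ =
      ⟨(pathElem h₅.zy' h₅.yx', ⟨(c₁, x), h₄.yx'⟩), rfl⟩ := Subtype.ext (Prod.ext e₅ rfl)
  have r₃ : (TwoMor.whiskerLeft (K.khEdge h.bot₂.vw') (Φ _ _ _ _ h.top₃)).toEquiv
      ⟨(⟨(z₀, b₃), h₅.zy'⟩, pathElem h₅.yx' h₄.yx'), rfl⟩ =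
      ⟨(⟨(z₀, b₃), h₅.zy'⟩, pathElem h₆.zy' h₆.yx'), rfl⟩ := Subtype.ext (Prod.ext rfl e₆)
  have l := (congrArg (fun q => (TwoMor.whiskerRight (Φ _ _ _ _ h.bot₃)
    (K.khEdge h.top₂.uv')).toEquiv ((TwoMor.assoc (K.khEdge h.bot₁.vw') (K.khEdge h.top₂.vw')
      (K.khEdge h.top₂.uv')).symm.toEquiv ((TwoMor.whiskerLeft (K.khEdge h.bot₁.vw')
      (Φ _ _ _ _ h.top₂)).toEquiv ((TwoMor.assoc (K.khEdge h.bot₁.vw') (K.khEdge h.bot₁.uv')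
      (K.khEdge h.top₁.uv)).toEquiv q)))) l₁).trans
    ((congrArg (fun q => (TwoMor.whiskerRight (Φ _ _ _ _ h.bot₃)
    (K.khEdge h.top₂.uv')).toEquiv ((TwoMor.assoc (K.khEdge h.bot₁.vw') (K.khEdge h.top₂.vw')
      (K.khEdge h.top₂.uv')).symm.toEquiv q)) l₂).trans l₃)
  have r := (congrArg (fun q => (TwoMor.assoc (K.khEdge h.bot₂.vw') (K.khEdge h.top₃.vw')
      (K.khEdge h.top₃.uv')).symm.toEquiv ((TwoMor.whiskerLeft (K.khEdge h.bot₂.vw')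
      (Φ _ _ _ _ h.top₃)).toEquiv ((TwoMor.assoc (K.khEdge h.bot₂.vw') (K.khEdge h.bot₂.uv')
      (K.khEdge h.top₁.uv')).toEquiv ((TwoMor.whiskerRight (Φ _ _ _ _ h.bot₂)
      (K.khEdge h.top₁.uv')).toEquiv ((TwoMor.assoc (K.khEdge h.bot₁.vw) (K.khEdge h.top₁.vw')
      (K.khEdge h.top₁.uv')).symm.toEquiv q))))) r₁).trans
    ((congrArg (fun q => (TwoMor.assoc (K.khEdge h.bot₂.vw') (K.khEdge h.top₃.vw')
      (K.khEdge h.top₃.uv')).symm.toEquiv ((TwoMor.whiskerLeft (K.khEdge h.bot₂.vw')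
      (Φ _ _ _ _ h.top₃)).toEquiv ((TwoMor.assoc (K.khEdge h.bot₂.vw') (K.khEdge h.bot₂.uv')
      (K.khEdge h.top₁.uv')).toEquiv q))) r₂).trans
    (congrArg (fun q => (TwoMor.assoc (K.khEdge h.bot₂.vw') (K.khEdge h.top₃.vw')
      (K.khEdge h.top₃.uv')).symm.toEquiv q) r₃))
  exact l.trans r.symm

end LinkDiagram

end KhBurnside

namespace KhBurnside

/-! ## Edges and squares of the cube -/

section

variable {n : ℕ}

/-- The sum of the weights of the coordinates of a vertex. -/
def weight (θ : Fin n → ℕ) (v : Cube n) : ℕ := ∑ i, if v i then θ i else 0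

theorem weight_eq_add (θ : Fin n → ℕ) {u v : Cube n} {c : Fin n} (hu : u c = true)
    (hv : v c = false) (h : ∀ i, i ≠ c → u i = v i) : weight θ u = weight θ v + θ c := by
  unfold weight
  rw [← Finset.add_sum_erase _ _ (Finset.mem_univ c), ← Finset.add_sum_erase _ (fun i => if v i
    then θ i else 0) (Finset.mem_univ c), hu, hv,
    Finset.sum_congr rfl fun i hi => by rw [h i (Finset.ne_of_mem_erase hi)]]
  simp only [if_true, Bool.false_eq_true, if_false]
  omega

theorem CubeEdge.weight_eq (θ : Fin n → ℕ) {u v : Cube n} (h : CubeEdge u v) :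
    weight θ u = weight θ v + θ h.coord :=
  weight_eq_add θ h.apply_coord.1 h.apply_coord.2 fun _ hi => h.apply_eq hi

theorem grade_eq_weight (v : Cube n) : grade v = weight (fun _ => 1) v :=
  Finset.sum_congr rfl fun i _ => by cases v i <;> rfl

theorem grade_le (v : Cube n) : grade v ≤ n := by
  refine (Finset.sum_le_card_nsmul _ _ 1 fun i _ => Bool.toNat_le _).trans ?_
  simp

theorem toNat_mono : ∀ a b : Bool, a ≤ b → a.toNat ≤ b.toNat := by decide

theorem grade_mono {u v : Cube n} (h : v ≤ u) : grade v ≤ grade u :=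
  Finset.sum_le_sum fun i _ => toNat_mono _ _ (h i)

theorem eq_of_le_of_grade_le {u v : Cube n} (h : v ≤ u) (hg : grade u ≤ grade v) : v = u := by
  have hle : ∀ i ∈ Finset.univ, (v i).toNat ≤ (u i).toNat := fun i _ => toNat_mono _ _ (h i)
  have := (Finset.sum_eq_sum_iff_of_le hle).1 (le_antisymm (grade_mono h) hg)
  funext i
  have := this i (Finset.mem_univ i)
  revert this
  cases v i <;> cases u i <;> simp

theorem grade_lt {u v : Cube n} (h : v < u) : grade v < grade u :=
  lt_of_not_ge fun hg => h.ne (eq_of_le_of_grade_le h.le hg)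

theorem cubeEdge_of_apply {u v : Cube n} {c : Fin n} (hu : u c = true)
    (hv : v c = false) (h : ∀ i, i ≠ c → u i = v i) : CubeEdge u v where
  le i := by
    by_cases hi : i = c
    · rw [hi, hv]
      exact Bool.false_le _
    · exact (h i hi).ge
  grade_eq := by
    rw [grade_eq_weight, grade_eq_weight, weight_eq_add _ hu hv h]

theorem CubeEdge.ext_of_coord_eq {u v v' : Cube n} (h : CubeEdge v u) (h' : CubeEdge v' u)
    (hc : h.coord = h'.coord) : v = v' := by
  funext i
  by_cases hi : i = h.coord
  · rw [hi, h.apply_coord.1, hc, h'.apply_coord.1]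
  · rw [h.apply_eq hi, h'.apply_eq (hc ▸ hi)]

theorem CubeEdge.exists_face {u v w : Cube n} (h : CubeEdge u v) (h' : CubeEdge v w) :
    ∃ v', CubeFace u v v' w := by
  have hne : h.coord ≠ h'.coord := fun heq => by
    have := h.apply_coord.2
    rw [heq, h'.apply_coord.1] at this
    exact Bool.noConfusion this
  have hw : w h.coord = false := by rw [← h'.apply_eq hne, h.apply_coord.2]
  have e1 : CubeEdge (Function.update w h.coord true) w :=
    cubeEdge_of_apply (Function.update_self ..) hw fun i hi => Function.update_of_ne hi ..
  refine ⟨Function.update w h.coord true, h, cubeEdge_of_apply (c := h'.coord) ?_ ?_ ?_, h', e1, ?_⟩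
  · rw [h.apply_eq hne.symm, h'.apply_coord.1]
  · rw [Function.update_of_ne hne.symm, h'.apply_coord.2]
  · intro i hi
    by_cases hi' : i = h.coord
    · rw [hi', h.apply_coord.1, Function.update_self]
    · rw [Function.update_of_ne hi', h.apply_eq hi', h'.apply_eq hi]
  · intro heq
    have := congrFun heq h.coord
    rw [h.apply_coord.2, Function.update_self] at this
    exact Bool.noConfusion this

end

namespace LinkDiagram

variable {n : ℕ} {K : LinkDiagram n}

/-! ## Moving paths across squares -/

/-- All generators. -/
abbrev Pt (K : LinkDiagram n) : Type := Σ v : Cube n, K.Gen v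

/-- There is an element of an edge correspondence from `a` to `b`. -/
def Step (a b : K.Pt) : Prop := ∃ h : CubeEdge a.1 b.1, K.edgeMatrix h a.2 b.2 = 1

theorem Step.ne {a b : K.Pt} (h : Step a b) : a ≠ b := by
  rintro rfl
  exact h.1.lt.ne rfl

/-- The paths `a, b, c` and `a, b', c` correspond under a face map. -/
def Diam (a b c b' : K.Pt) : Prop := ∃ h : CubeFace a.1 b.1 b'.1 c.1, FaceRel h c.2 b.2 a.2 b'.2

theorem Diam.symm {a b c b' : K.Pt} (h : Diam a b c b') : Diam a b' c b := ⟨h.1.symm, h.2.symm⟩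

theorem Diam.up {a b c b' : K.Pt} (h : Diam a b c b') : Step a b := ⟨_, h.2.yx⟩

theorem Diam.down {a b c b' : K.Pt} (h : Diam a b c b') : Step b c := ⟨_, h.2.zy⟩

theorem exists_diam {a b c : K.Pt} (h : Step a b) (h' : Step b c) : ∃ b', Diam a b c b' := by
  obtain ⟨v', hf⟩ := h.1.exists_face h'.1
  obtain ⟨y', hr, -⟩ := existsUnique_faceRel hf h'.2 h.2
  exact ⟨⟨v', y'⟩, hf, hr⟩

/-- The second middle vertex of a square is determined by the other three: its edge to the bottom
changes the coordinate that the opposite edge changes. -/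
theorem Diam.fst_unique {a b c b' a₁ b₁ c₁ b₁' : K.Pt} (h : Diam a b c b')
    (h' : Diam a₁ b₁ c₁ b₁') (ha : a.1 = a₁.1) (hb : b.1 = b₁.1) (hc : c.1 = c₁.1) :
    b'.1 = b₁'.1 := by
  obtain ⟨a, x⟩ := a
  obtain ⟨b, y⟩ := b
  obtain ⟨c, z⟩ := c
  obtain rfl : a = a₁.1 := ha
  obtain rfl : b = b₁.1 := hb
  obtain rfl : c = c₁.1 := hc
  exact h.1.vw'.ext_of_coord_eq h'.1.vw' (h.1.uv_coord.symm.trans h'.1.uv_coord)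

theorem Diam.unique {a b c b' b'' : K.Pt} (h : Diam a b c b') (h' : Diam a b c b'') :
    b' = b'' := by
  have hv := h.fst_unique h' rfl rfl rfl
  obtain ⟨v, y⟩ := b'
  obtain ⟨v', y'⟩ := b''
  obtain rfl : v = v' := hv
  obtain ⟨hf, hr⟩ := h
  obtain ⟨hf', hr'⟩ := h'
  obtain rfl := (existsUnique_faceRel hf hr.zy hr.yx).unique hr hr'
  rfl

/-- The move decreases the weight of the middle vertex. -/
def Diam.Dec {a b c b' : K.Pt} (h : Diam a b c b') (θ : Fin n → ℕ) : Prop :=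
  θ h.1.vw'.coord < θ h.1.vw.coord

theorem Diam.dec_congr {a b c b' a₁ b₁ c₁ b₁' : K.Pt} (h : Diam a b c b')
    (h' : Diam a₁ b₁ c₁ b₁') (ha : a.1 = a₁.1) (hb : b.1 = b₁.1) (hc : c.1 = c₁.1)
    (θ : Fin n → ℕ) (hd : h.Dec θ) : h'.Dec θ := by
  have hb' := h.fst_unique h' ha hb hc
  obtain ⟨a, x⟩ := a
  obtain ⟨b, y⟩ := b
  obtain ⟨c, z⟩ := c
  obtain ⟨b', y'⟩ := b'
  obtain rfl : a = a₁.1 := ha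
  obtain rfl : b = b₁.1 := hb
  obtain rfl : c = c₁.1 := hc
  obtain rfl : b' = b₁'.1 := hb'
  exact hd

/-- The local confluence of moves at adjacent positions. -/
theorem Diam.hexagon {θ : Fin n → ℕ} {a b c d b' c' : K.Pt} (h₁ : Diam b c d c')
    (h₄ : Diam a b c b') (d₁ : h₁.Dec θ) (d₄ : h₄.Dec θ) :
    ∃ b₂ c₂, ∃ (h₂ : Diam a b c' b₂) (h₃ : Diam b₂ c' d c₂) (h₅ : Diam b' c d c₂)
      (h₆ : Diam a b' c₂ b₂), h₂.Dec θ ∧ h₃.Dec θ ∧ h₅.Dec θ ∧ h₆.Dec θ := by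
  obtain ⟨b₂, h₂⟩ := exists_diam h₄.up h₁.symm.up
  obtain ⟨c₂, h₃⟩ := exists_diam h₂.symm.down h₁.symm.down
  obtain ⟨c₃, h₅⟩ := exists_diam h₄.symm.down h₁.down
  obtain ⟨b₃, h₆⟩ := exists_diam h₄.symm.up h₅.symm.up
  -- Let the path change the coordinates `α, β, γ` from the top down. Then `d₄` and `d₁` say `θ α <
  -- θ β < θ γ`, so each of the six moves exchanges neighbours in the decreasing direction, as in
  -- the braid relation for sorting.
  have e₂ : h₂.1.vw'.coord = h₄.1.vw'.coord := h₂.1.uv_coord.symm.trans h₄.1.uv_coord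
  have e₃ : h₃.1.vw'.coord = h₄.1.vw'.coord := h₃.1.uv_coord.symm.trans e₂
  have e₅ : h₅.1.vw'.coord = h₄.1.vw'.coord := h₅.1.uv_coord.symm
  have e₆ : h₆.1.vw'.coord = h₁.1.vw'.coord :=
    h₆.1.uv_coord.symm.trans (h₄.1.uv'_coord.trans h₁.1.uv_coord)
  have e₆' : h₆.1.vw.coord = h₁.1.vw.coord := h₅.1.uv'_coord
  have e₂' : h₂.1.vw.coord = h₁.1.vw.coord := h₁.1.uv'_coord
  have e₄ : h₄.1.vw.coord = h₁.1.vw'.coord := h₁.1.uv_coord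
  have d₂ : h₂.Dec θ := by
    unfold Diam.Dec at d₁ d₄ ⊢
    rw [e₄] at d₄
    rw [e₂, e₂']
    exact d₄.trans d₁
  have d₃ : h₃.Dec θ := by
    unfold Diam.Dec at d₄ ⊢
    rw [e₄] at d₄
    rw [e₃]
    exact d₄
  have d₅ : h₅.Dec θ := by
    unfold Diam.Dec at d₁ d₄ ⊢
    rw [e₄] at d₄
    rw [e₅]
    exact d₄.trans d₁
  have d₆ : h₆.Dec θ := by
    unfold Diam.Dec at d₁ ⊢
    rw [e₆, e₆']
    exact d₁
  have hc : c₂.1 = c₃.1 := h₃.1.vw'.ext_of_coord_eq h₅.1.vw' (e₃.trans e₅.symm)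
  have hb : b₂.1 = b₃.1 := by
    have e₃' : h₃.1.uv'.coord = h₁.1.vw'.coord := h₃.1.uv'_coord
    have e := e₃'.trans e₆.symm
    obtain ⟨c₂, y⟩ := c₂
    obtain rfl : c₂ = c₃.1 := hc
    exact h₃.1.uv'.ext_of_coord_eq h₆.1.vw' e
  have hs : b₂ = b₃ ∧ c₂ = c₃ := by
    obtain ⟨b₂, y₁⟩ := b₂
    obtain ⟨b₃, y₂⟩ := b₃
    obtain ⟨c₂, y₃⟩ := c₂
    obtain ⟨c₃, y₄⟩ := c₃
    obtain rfl : b₂ = b₃ := hb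
    obtain rfl : c₂ = c₃ := hc
    obtain ⟨rfl, rfl⟩ := hexagon_faceRel ⟨h₄.1, h₂.1, h₆.1, h₁.1, h₅.1, h₃.1⟩ h₁.2 h₂.2 h₃.2 h₄.2
      h₅.2 h₆.2
    exact ⟨rfl, rfl⟩
  obtain ⟨rfl, rfl⟩ := hs
  exact ⟨_, _, h₂, h₃, h₅, h₆, d₂, d₃, d₅, d₆⟩

end LinkDiagram

end KhBurnside

namespace KhBurnside

/-- Newman's lemma. -/
theorem exists_reflTransGen_of_local {α : Type*} {r : α → α → Prop} (wf : WellFounded (flip r))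
    (h : ∀ a b c, r a b → r a c →
      ∃ d, Relation.ReflTransGen r b d ∧ Relation.ReflTransGen r c d) (a : α) :
    ∀ b c, Relation.ReflTransGen r a b → Relation.ReflTransGen r a c →
      ∃ d, Relation.ReflTransGen r b d ∧ Relation.ReflTransGen r c d := by
  induction a using wf.induction with
  | _ a ih =>
    intro b c hb hc
    rcases hb.cases_head with rfl | ⟨b₁, hb₁, hb⟩
    · exact ⟨c, hc, .refl⟩
    rcases hc.cases_head with rfl | ⟨c₁, hc₁, hc⟩
    · exact ⟨b, .refl, hb.head hb₁⟩
    obtain ⟨d, hd, hd'⟩ := h a b₁ c₁ hb₁ hc₁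
    obtain ⟨e, he, he'⟩ := ih b₁ hb₁ b d hb hd
    obtain ⟨f, hf, hf'⟩ := ih c₁ hc₁ c e hc (hd'.trans he')
    exact ⟨f, he.trans hf', hf⟩

namespace LinkDiagram

variable {n : ℕ} {K : LinkDiagram n}

/-! ## Paths in the cube -/

/-- The sequence `p` runs through the vertices of a path from `a` to `b`, indexed by the grading,
and is constant outside. -/
structure IsPath (a b : K.Pt) (p : ℕ → K.Pt) : Prop where
  top : ∀ g, grade a.1 ≤ g → p g = a
  bot : ∀ g, g ≤ grade b.1 → p g = b
  step : ∀ g, grade b.1 ≤ g → g < grade a.1 → Step (p (g + 1)) (p g)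

/-- The paths from `a` to `b`. -/
abbrev Path (a b : K.Pt) : Type := {p : ℕ → K.Pt // IsPath a b p}

variable {a b : K.Pt} {p : ℕ → K.Pt}

theorem IsPath.grade_le (h : IsPath a b p) : grade b.1 ≤ grade a.1 := by
  by_contra hlt
  have h1 := h.top (grade a.1) le_rfl
  rw [h.bot _ (by omega)] at h1
  exact hlt (h1 ▸ le_rfl)

theorem IsPath.grade_eq (h : IsPath a b p) {g : ℕ} (hg : grade b.1 ≤ g) (hg' : g ≤ grade a.1) :
    grade (p g).1 = g := by
  induction g, hg using Nat.le_induction with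
  | base => rw [h.bot _ le_rfl]
  | succ g hg ih => rw [(h.step g hg hg').1.grade_eq, ih (by omega)]

/-- Outside the range of gradings of its ends a path is constant, whereas a square requires two
proper steps. -/
theorem IsPath.bounds (h : IsPath a b p) {g : ℕ} {b' : K.Pt}
    (hd : Diam (p (g + 2)) (p (g + 1)) (p g) b') : grade b.1 ≤ g ∧ g + 2 ≤ grade a.1 := by
  constructor
  · by_contra hlt
    exact hd.down.ne ((h.bot _ (by omega)).trans (h.bot _ (by omega)).symm)
  · by_contra hlt
    exact hd.up.ne ((h.top _ (by omega)).trans (h.top _ (by omega)).symm)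

theorem IsPath.update (h : IsPath a b p) {g : ℕ} {b' : K.Pt}
    (hd : Diam (p (g + 2)) (p (g + 1)) (p g) b') :
    IsPath a b (Function.update p (g + 1) b') := by
  obtain ⟨h1, h2⟩ := h.bounds hd
  refine ⟨fun g' hg' => ?_, fun g' hg' => ?_, fun g' hg' hg'' => ?_⟩
  · rw [Function.update_of_ne (by omega), h.top g' hg']
  · rw [Function.update_of_ne (by omega), h.bot g' hg']
  · rcases eq_or_ne g' g with rfl | hne
    · rw [Function.update_self, Function.update_of_ne (by omega)]
      exact hd.symm.down
    rcases eq_or_ne g' (g + 1) with rfl | hne'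
    · rw [Function.update_self, Function.update_of_ne (by omega)]
      exact hd.symm.up
    · rw [Function.update_of_ne (by omega), Function.update_of_ne hne']
      exact h.step g' hg' hg''

/-! ### Moves, confluence and normal forms of paths. -/

/-- The path `q` arises from `p` by a move across a square. -/
def Swap (p q : Path a b) : Prop :=
  ∃ g b', Diam (p.1 (g + 2)) (p.1 (g + 1)) (p.1 g) b' ∧ q.1 = Function.update p.1 (g + 1) b'

/-- The path `q` arises from `p` by a move across a square that decreases the weight. -/
def Red (θ : Fin n → ℕ) (p q : Path a b) : Prop :=
  ∃ g b', ∃ h : Diam (p.1 (g + 2)) (p.1 (g + 1)) (p.1 g) b', h.Dec θ ∧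
    q.1 = Function.update p.1 (g + 1) b'

theorem Red.swap {θ : Fin n → ℕ} {p q : Path a b} (h : Red θ p q) : Swap p q := by
  obtain ⟨g, b', h, -, hq⟩ := h
  exact ⟨g, b', h, hq⟩

/-- The two coordinates of a square have different weights when `θ` is injective, so each move or
its reverse is decreasing. -/
theorem Swap.red_or {θ : Fin n → ℕ} (hθ : Function.Injective θ) {p q : Path a b} (h : Swap p q) :
    Red θ p q ∨ Red θ q p := by
  obtain ⟨g, b', h, hq⟩ := h
  rcases lt_or_gt_of_ne fun he => h.1.coord_ne (hθ he) with hd | hd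
  · right
    have e0 : q.1 g = p.1 g := by rw [hq, Function.update_of_ne (by omega)]
    have e1 : q.1 (g + 1) = b' := by rw [hq, Function.update_self]
    have e2 : q.1 (g + 2) = p.1 (g + 2) := by rw [hq, Function.update_of_ne (by omega)]
    refine ⟨g, p.1 (g + 1), e0.symm ▸ e1.symm ▸ e2.symm ▸ h.symm, ?_, ?_⟩
    · exact h.symm.dec_congr _ (by rw [e2]) (by rw [e1]) (by rw [e0]) θ hd
    · rw [hq, Function.update_idem, Function.update_eq_self]
  · exact Or.inl ⟨g, b', h, hd, hq⟩

theorem exists_red_of_diam {θ : Fin n → ℕ} (p : Path a b) {g : ℕ} {x y z b' : K.Pt}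
    (h : Diam x y z b') (hd : h.Dec θ) (hx : p.1 (g + 2) = x) (hy : p.1 (g + 1) = y)
    (hz : p.1 g = z) : ∃ q : Path a b, q.1 = Function.update p.1 (g + 1) b' ∧ Red θ p q := by
  subst hx hy hz
  exact ⟨⟨_, p.2.update h⟩, rfl, g, b', h, hd, rfl⟩

/-- Two moves at the same position coincide by uniqueness of partners, at neighbouring positions
they are joined by the hexagon, and at distant positions they commute. -/
theorem red_local {θ : Fin n → ℕ} (p q r : Path a b) (hq : Red θ p q) (hr : Red θ p r) :
    ∃ s, Relation.ReflTransGen (Red θ) q s ∧ Relation.ReflTransGen (Red θ) r s := by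
  have key : ∀ {g g' : ℕ} {b' b'' : K.Pt} {q r : Path a b}, g ≤ g' →
      ∀ (h : Diam (p.1 (g + 2)) (p.1 (g + 1)) (p.1 g) b')
      (h' : Diam (p.1 (g' + 2)) (p.1 (g' + 1)) (p.1 g') b''), h.Dec θ → h'.Dec θ →
      q.1 = Function.update p.1 (g + 1) b' → r.1 = Function.update p.1 (g' + 1) b'' →
      ∃ s, Relation.ReflTransGen (Red θ) q s ∧ Relation.ReflTransGen (Red θ) r s := by
    intro g g' b' b'' q r hg h h' hd hd' hq hr
    rcases Nat.eq_or_lt_of_le hg with rfl | hg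
    · obtain rfl := h.unique h'
      obtain rfl : q = r := Subtype.ext (hq.trans hr.symm)
      exact ⟨q, .refl, .refl⟩
    rcases Nat.eq_or_lt_of_le hg with rfl | hg
    · obtain ⟨b₂, c₂, h₂, h₃, h₅, h₆, d₂, d₃, d₅, d₆⟩ := h.hexagon h' hd hd'
      obtain ⟨q₁, e₁, r₁⟩ := exists_red_of_diam q (g := g + 1) h₂ d₂
        (by rw [hq, Function.update_of_ne (by omega)])
        (by rw [hq, Function.update_of_ne (by omega)]) (by rw [hq, Function.update_self])
      obtain ⟨q₂, e₂, r₂⟩ := exists_red_of_diam q₁ (g := g) h₃ d₃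
        (by rw [e₁, Function.update_self])
        (by rw [e₁, Function.update_of_ne (by omega), hq, Function.update_self])
        (by rw [e₁, Function.update_of_ne (by omega), hq, Function.update_of_ne (by omega)])
      obtain ⟨q₃, e₃, r₃⟩ := exists_red_of_diam r (g := g) h₅ d₅
        (by rw [hr, Function.update_self]) (by rw [hr, Function.update_of_ne (by omega)])
        (by rw [hr, Function.update_of_ne (by omega)])
      obtain ⟨q₄, e₄, r₄⟩ := exists_red_of_diam q₃ (g := g + 1) h₆ d₆
        (by rw [e₃, Function.update_of_ne (by omega), hr, Function.update_of_ne (by omega)])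
        (by rw [e₃, Function.update_of_ne (by omega), hr, Function.update_self])
        (by rw [e₃, Function.update_self])
      have he : q₂ = q₄ := by
        refine Subtype.ext ?_
        rw [e₂, e₁, hq, e₄, e₃, hr]
        funext i
        simp only [Function.update_apply]
        split_ifs <;> first | rfl | omega
      exact ⟨q₂, .tail (.single r₁) r₂, he ▸ .tail (.single r₃) r₄⟩
    · obtain ⟨q₁, e₁, r₁⟩ := exists_red_of_diam q (g := g') h' hd'
        (by rw [hq, Function.update_of_ne (by omega)])
        (by rw [hq, Function.update_of_ne (by omega)])
        (by rw [hq, Function.update_of_ne (by omega)])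
      obtain ⟨q₂, e₂, r₂⟩ := exists_red_of_diam r (g := g) h hd
        (by rw [hr, Function.update_of_ne (by omega)])
        (by rw [hr, Function.update_of_ne (by omega)])
        (by rw [hr, Function.update_of_ne (by omega)])
      have he : q₁ = q₂ := by
        refine Subtype.ext ?_
        rw [e₁, hq, e₂, hr, Function.update_comm (by omega)]
      exact ⟨q₁, .single r₁, he ▸ .single r₂⟩
  obtain ⟨g, b', h, hd, hq⟩ := hq
  obtain ⟨g', b'', h', hd', hr⟩ := hr
  rcases le_total g g' with hg | hg
  · exact key hg h h' hd hd' hq hr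
  · obtain ⟨s, h1, h2⟩ := key hg h' h hd' hd hr hq
    exact ⟨s, h2, h1⟩

theorem wellFounded_red (θ : Fin n → ℕ) : WellFounded (flip (Red (a := a) (b := b) θ)) := by
  -- A move changes one vertex and lowers its weight. All gradings are at most `n`, so the finite
  -- sum sees every vertex that can be moved.
  let μ : Path a b → ℕ := fun p => ∑ g ∈ Finset.range (n + 1), weight θ (p.1 g).1
  refine Subrelation.wf (r := InvImage (· < ·) μ) ?_ (InvImage.wf μ wellFounded_lt)
  rintro q p ⟨g, b', h, hd, hq⟩
  have hg : g + 1 ∈ Finset.range (n + 1) := by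
    have h1 := (p.2.bounds h).2
    have h2 := KhBurnside.grade_le a.1
    rw [Finset.mem_range]
    omega
  change μ q < μ p
  refine Finset.sum_lt_sum (fun i _ => ?_) ⟨g + 1, hg, ?_⟩
  · rw [hq, Function.update_apply]
    split_ifs with hi
    · rw [hi, h.1.vw'.weight_eq, h.1.vw.weight_eq]
      exact Nat.add_le_add_left hd.le _
    · exact le_rfl
  · rw [hq, Function.update_self, h.1.vw'.weight_eq, h.1.vw.weight_eq]
    exact Nat.add_lt_add_left hd _

theorem exists_irreducible (θ : Fin n → ℕ) (p : Path a b) :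
    ∃ q, Relation.ReflTransGen (Red θ) p q ∧ ∀ r, ¬ Red θ q r := by
  induction p using (wellFounded_red θ).induction with
  | _ p ih =>
    by_cases h : ∃ r, Red θ p r
    · obtain ⟨r, hr⟩ := h
      obtain ⟨q, hq, hq'⟩ := ih r hr
      exact ⟨q, hq.head hr, hq'⟩
    · push Not at h
      exact ⟨p, .refl, h⟩

theorem eqvGen_swap_of_red {θ : Fin n → ℕ} {p q : Path a b}
    (h : Relation.ReflTransGen (Red θ) p q) : Relation.EqvGen Swap p q := by
  induction h with
  | refl => exact .refl _
  | tail _ h ih => exact .trans _ _ _ ih (.rel _ _ h.swap)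

theorem join_of_eqvGen {θ : Fin n → ℕ} (hθ : Function.Injective θ) {p q : Path a b}
    (h : Relation.EqvGen Swap p q) :
    ∃ s, Relation.ReflTransGen (Red θ) p s ∧ Relation.ReflTransGen (Red θ) q s := by
  induction h with
  | rel p q h =>
    rcases h.red_or hθ with h | h
    · exact ⟨q, .single h, .refl⟩
    · exact ⟨p, .refl, .single h⟩
  | refl p => exact ⟨p, .refl, .refl⟩
  | symm p q _ ih =>
    obtain ⟨s, h1, h2⟩ := ih
    exact ⟨s, h2, h1⟩
  | trans p q r _ _ ih ih' =>
    obtain ⟨s, h1, h2⟩ := ih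
    obtain ⟨t, h3, h4⟩ := ih'
    obtain ⟨d, h5, h6⟩ := exists_reflTransGen_of_local (wellFounded_red θ) red_local q s t h2 h3
    exact ⟨d, h1.trans h5, h4.trans h6⟩

/-- Whether a decreasing move exists depends only on the vertices, as `exists_diam` supplies the
labels. A move is undone by the reverse move, whence the last clause. -/
theorem Red.lift {θ : Fin n → ℕ} {a' b' : K.Pt} {p q : Path a b} {p' : Path a' b'}
    (h : Red θ p q)
    (hc : ∀ g, (p.1 g).1 = (p'.1 g).1) : ∃ q' : Path a' b', Red θ p' q' ∧
      (∀ g, (q.1 g).1 = (q'.1 g).1) ∧ (q.1 = q'.1 → p.1 = p'.1) := by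
  obtain ⟨g, c, h, hd, hq⟩ := h
  have hs : Step (p'.1 (g + 2)) (p'.1 (g + 1)) ∧ Step (p'.1 (g + 1)) (p'.1 g) := by
    have hb := p.2.bounds h
    have h1 := h.1.uv.grade_eq
    have h2 := h.1.vw.grade_eq
    rw [hc, hc] at h1 h2
    constructor
    · refine p'.2.step (g + 1) ?_ ?_
      · by_contra hlt
        rw [p'.2.bot g (by omega), p'.2.bot (g + 1) (by omega)] at h2
        omega
      · by_contra hlt
        rw [p'.2.top (g + 2) (by omega), p'.2.top (g + 1) (by omega)] at h1
        omega
    · refine p'.2.step g ?_ ?_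
      · by_contra hlt
        rw [p'.2.bot g (by omega), p'.2.bot (g + 1) (by omega)] at h2
        omega
      · by_contra hlt
        rw [p'.2.top (g + 2) (by omega), p'.2.top (g + 1) (by omega)] at h1
        omega
  obtain ⟨c', h'⟩ := exists_diam hs.1 hs.2
  have hcc := h.fst_unique h' (hc _) (hc _) (hc _)
  refine ⟨⟨_, p'.2.update h'⟩, ⟨g, c', h', h.dec_congr h' (hc _) (hc _) (hc _) θ hd, rfl⟩,
    fun i => ?_, fun he => ?_⟩
  · rw [hq]
    simp only [Function.update_apply]
    split_ifs
    · exact hcc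
    · exact hc i
  · rw [hq] at he
    change Function.update p.1 (g + 1) c = Function.update p'.1 (g + 1) c' at he
    have hi : ∀ i, i ≠ g + 1 → p.1 i = p'.1 i := fun i hi => by
      have := congrFun he i
      rwa [Function.update_of_ne hi, Function.update_of_ne hi] at this
    have hc' : c = c' := by
      have := congrFun he (g + 1)
      rwa [Function.update_self, Function.update_self] at this
    funext i
    by_cases hi' : i = g + 1
    · rw [hi']
      refine Diam.unique (a := p.1 (g + 2)) (b := c) (c := p.1 g) h.symm ?_
      rw [hi _ (by omega), hi _ (by omega), hc']
      exact h'.symm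
    · exact hi i hi'

theorem lift_reflTransGen {θ : Fin n → ℕ} {p q p' : Path a b}
    (h : Relation.ReflTransGen (Red θ) p q) (hc : ∀ g, (p.1 g).1 = (p'.1 g).1) :
    ∃ q', Relation.ReflTransGen (Red θ) p' q' ∧ (∀ g, (q.1 g).1 = (q'.1 g).1) ∧
      (q = q' → p = p') := by
  induction h with
  | refl => exact ⟨p', .refl, hc, id⟩
  | tail _ h ih =>
    obtain ⟨q', h1, h2, h3⟩ := ih
    obtain ⟨r', h4, h5, h6⟩ := h.lift h2
    exact ⟨r', h1.tail h4, h5, fun he => h3 (Subtype.ext (h6 (congrArg Subtype.val he)))⟩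

/-- Two paths through the same vertices are equal if they are connected by moves. -/
theorem eq_of_eqvGen_swap {p p' : Path a b} (h : Relation.EqvGen Swap p p')
    (hc : ∀ g, (p.1 g).1 = (p'.1 g).1) : p = p' := by
  have hθ : Function.Injective (Fin.val : Fin n → ℕ) := Fin.val_injective
  -- Reduce `p` to an irreducible path and repeat the same moves on `p'`. The two results are
  -- irreducible and equivalent, so confluence makes them equal, and undoing the moves gives `p =
  -- p'`.
  obtain ⟨q, hq, hirr⟩ := exists_irreducible Fin.val p
  obtain ⟨q', hq', hc', he⟩ := lift_reflTransGen hq hc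
  have hirr' : ∀ r, ¬ Red Fin.val q' r := fun r hr => by
    obtain ⟨r', hr', -⟩ := hr.lift (p' := q) fun g => (hc' g).symm
    exact hirr r' hr'
  obtain ⟨s, h1, h2⟩ := join_of_eqvGen hθ
    (.trans _ _ _ (.symm _ _ (eqvGen_swap_of_red hq)) (.trans _ _ _ h (eqvGen_swap_of_red hq')))
  refine he ?_
  rcases h1.cases_head with rfl | ⟨_, h, -⟩
  · rcases h2.cases_head with rfl | ⟨_, h, -⟩
    · rfl
    · exact absurd h (hirr' _)
  · exact absurd h (hirr _)

/-- On an irreducible path the coordinates change in the order of their weights, the smallest at the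
bottom; otherwise the square at this position would give a decreasing move. -/
theorem coord_le_of_irreducible {θ : Fin n → ℕ} {p : Path a b} (hirr : ∀ r, ¬ Red θ p r) {g : ℕ}
    (h₁ : Step (p.1 (g + 2)) (p.1 (g + 1))) (h₀ : Step (p.1 (g + 1)) (p.1 g)) :
    θ h₀.1.coord ≤ θ h₁.1.coord := by
  by_contra hlt
  obtain ⟨b', h⟩ := exists_diam h₁ h₀
  have hd : h.Dec θ := by
    have e : h₁.1.coord = h.1.vw'.coord := h.1.uv_coord
    unfold Diam.Dec
    rw [← e]
    exact not_le.1 hlt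
  exact hirr ⟨_, p.2.update h⟩ ⟨g, b', h, hd, rfl⟩

theorem IsPath.apply_or (h : IsPath a b p) {g : ℕ} (hg : grade b.1 ≤ g) (hg' : g < grade a.1)
    (i : Fin n) (hi : (p (g + 1)).1 i = true) : (p g).1 i = true ∨ i = (h.step g hg hg').1.coord := by
  by_cases hc : i = (h.step g hg hg').1.coord
  · exact Or.inr hc
  · rw [(h.step g hg hg').1.apply_eq hc] at hi
    exact Or.inl hi

/-- Every path can be moved through a given intermediate vertex. -/
theorem exists_through (p : Path a b) {v : Cube n} (hbv : b.1 ≤ v) (hva : v ≤ a.1) :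
    ∃ q : Path a b, Relation.EqvGen Swap p q ∧ (q.1 (grade v)).1 = v := by
  -- With this weight an irreducible path, read from the bottom, first switches on the coordinates
  -- of `v` and then the others, so it passes through `v`.
  let θ : Fin n → ℕ := fun i => if v i then 0 else 1
  obtain ⟨q, hq, hirr⟩ := exists_irreducible θ p
  refine ⟨q, eqvGen_swap_of_red hq, ?_⟩
  -- Below the first coordinate outside `v` that is switched on, all of `v` is already present:
  -- every later edge changes a coordinate outside `v`. The induction on `k` descends from the top.
  have h1 : ∀ k g (hg : grade b.1 ≤ g) (hg' : g < grade a.1), grade a.1 = g + 1 + k →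
      v (q.2.step g hg hg').1.coord = false → ∀ i, v i = true → (q.1 g).1 i = true := by
    intro k
    induction k with
    | zero =>
      intro g hg hg' hk hc i hi
      refine (q.2.apply_or hg hg' i ?_).resolve_right fun h => ?_
      · rw [q.2.top (g + 1) (by omega)]
        have := hva i
        rw [hi] at this
        exact top_le_iff.1 this
      · rw [← h, hi] at hc
        exact Bool.noConfusion hc
    | succ k ih =>
      intro g hg hg' hk hc i hi
      refine (q.2.apply_or hg hg' i ?_).resolve_right fun h => ?_
      · refine ih (g + 1) (by omega) (by omega) (by omega) ?_ i hi
        have := coord_le_of_irreducible hirr (q.2.step (g + 1) (by omega) (by omega))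
          (q.2.step g hg hg')
        by_contra hv
        rw [Bool.not_eq_false] at hv
        simp [θ, hv, hc] at this
      · rw [← h, hi] at hc
        exact Bool.noConfusion hc
  have h2 : ∀ g, grade b.1 ≤ g → g ≤ grade a.1 → (q.1 g).1 ≤ v ∨ v ≤ (q.1 g).1 := by
    intro g hg
    induction g, hg using Nat.le_induction with
    | base =>
      intro _
      rw [q.2.bot _ le_rfl]
      exact Or.inl hbv
    | succ g hg ih =>
      intro hg'
      have hs := q.2.step g hg hg'
      rcases ih (by omega) with h | h
      · cases hc : v (q.2.step g hg hg').1.coord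
        · right
          refine le_trans (fun i => ?_) hs.1.le
          cases hi : v i
          · exact Bool.false_le _
          · exact (h1 (grade a.1 - (g + 1)) g hg hg' (by omega) hc i hi).ge
        · left
          intro i
          cases hi : (q.1 (g + 1)).1 i
          · exact Bool.false_le _
          · rcases q.2.apply_or hg hg' i hi with h' | h'
            · have := h i
              rwa [h'] at this
            · rw [h', hc]
      · exact Or.inr (h.trans hs.1.le)
  have hg := q.2.grade_eq (grade_mono hbv) (grade_mono hva)
  rcases h2 _ (grade_mono hbv) (grade_mono hva) with h | h
  · exact eq_of_le_of_grade_le h hg.ge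
  · exact (eq_of_le_of_grade_le h hg.le).symm

/-- Irreducible paths between the same vertices run through the same vertices. -/
theorem fst_eq_of_irreducible {a b a' b' : K.Pt} {p : Path a b} {p' : Path a' b'}
    (ha : a.1 = a'.1) (hb : b.1 = b'.1) (h : ∀ r, ¬ Red Fin.val p r)
    (h' : ∀ r, ¬ Red Fin.val p' r) (g : ℕ) : (p.1 g).1 = (p'.1 g).1 := by
  -- Going up, an irreducible path always switches on the smallest coordinate still missing. This
  -- determines its vertices.
  have h1 : ∀ {a b : K.Pt} (q : Path a b), (∀ r, ¬ Red Fin.val q r) → ∀ k g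
      (hg : grade b.1 ≤ g) (hg' : g < grade a.1), grade a.1 = g + 1 + k → ∀ i, a.1 i = true →
      (q.1 g).1 i = false → (q.2.step g hg hg').1.coord ≤ i := by
    intro a b q hirr k
    induction k with
    | zero =>
      intro g hg hg' hk i hi hi'
      refine (Or.resolve_left (q.2.apply_or hg hg' i ?_) fun h => ?_).ge
      · rwa [q.2.top (g + 1) (by omega)]
      · rw [hi'] at h
        exact Bool.noConfusion h
    | succ k ih =>
      intro g hg hg' hk i hi hi'
      cases hc : (q.1 (g + 1)).1 i
      · have := ih (g + 1) (by omega) (by omega) (by omega) i hi hc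
        exact le_trans (coord_le_of_irreducible hirr (q.2.step (g + 1) (by omega) (by omega))
          (q.2.step g hg hg')) this
      · refine (Or.resolve_left (q.2.apply_or hg hg' i hc) fun h => ?_).ge
        rw [hi'] at h
        exact Bool.noConfusion h
  have htop : ∀ {a b : K.Pt} (q : Path a b) k g, grade b.1 ≤ g → grade a.1 = g + k →
      (q.1 g).1 ≤ a.1 := by
    intro a b q k
    induction k with
    | zero =>
      intro g _ hk
      rw [q.2.top g (by omega)]
    | succ k ih =>
      intro g hg hk
      exact (q.2.step g hg (by omega)).1.le.trans (ih (g + 1) (by omega) (by omega))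
  have hga : grade a.1 = grade a'.1 := congrArg grade ha
  have hgb : grade b.1 = grade b'.1 := congrArg grade hb
  rcases le_total g (grade b.1) with hg | hg
  · rw [p.2.bot g hg, p'.2.bot g (hgb ▸ hg), hb]
  induction g, hg using Nat.le_induction with
  | base => rw [p.2.bot _ le_rfl, p'.2.bot _ hgb.le, hb]
  | succ g hg ih =>
    rcases Nat.lt_or_ge g (grade a.1) with hg' | hg'
    · have hs := p.2.step g hg hg'
      have hs' := p'.2.step g (hgb ▸ hg) (hga ▸ hg')
      have hup : ∀ {a b : K.Pt} (q : Path a b) (hg : grade b.1 ≤ g) (hg' : g < grade a.1),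
          a.1 (q.2.step g hg hg').1.coord = true := by
        intro a b q hg hg'
        have e := htop q (grade a.1 - (g + 1)) (g + 1) (by omega) (by omega)
          (q.2.step g hg hg').1.coord
        rw [(q.2.step g hg hg').1.apply_coord.1] at e
        exact top_le_iff.1 e
      have e1 : hs.1.coord ≤ hs'.1.coord := by
        refine h1 p h (grade a.1 - (g + 1)) g hg hg' (by omega) _ ?_ ?_
        · rw [ha]
          exact hup p' (hgb ▸ hg) (hga ▸ hg')
        · rw [ih]
          exact hs'.1.apply_coord.2
      have e2 : hs'.1.coord ≤ hs.1.coord := by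
        refine h1 p' h' (grade a'.1 - (g + 1)) g (hgb ▸ hg) (hga ▸ hg') (by omega) _ ?_ ?_
        · rw [← ha]
          exact hup p hg hg'
        · rw [← ih]
          exact hs.1.apply_coord.2
      have e := le_antisymm e1 e2
      funext i
      by_cases hi : i = hs.1.coord
      · rw [hi, hs.1.apply_coord.1, e, hs'.1.apply_coord.1]
      · rw [hs.1.apply_eq hi, hs'.1.apply_eq (e ▸ hi), ih]
    · rw [p.2.top _ (by omega), p'.2.top _ (by omega), ha]

end LinkDiagram

end KhBurnside

namespace KhBurnside

variable {n : ℕ}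

/-! ## Functors on elements -/

namespace CubeFunctor

variable (F G : CubeFunctor n) {u v w z : Cube n}

/-- The composition of elements of the correspondences of a functor. -/
def mul {huv : v < u} {hvw : w < v} (b : (F.map hvw).carrier) (a : (F.map huv).carrier)
    (h : (F.map hvw).s b = (F.map huv).t a) : (F.map (hvw.trans huv)).carrier :=
  (F.mapComp huv hvw).toEquiv ⟨(b, a), h⟩

variable {F} {huv : v < u} {hvw : w < v} {hwz : z < w}

theorem s_mul (b : (F.map hvw).carrier) (a : (F.map huv).carrier) (h) :
    (F.map (hvw.trans huv)).s (F.mul b a h) = (F.map huv).s a :=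
  (F.mapComp huv hvw).s_comm _

theorem t_mul (b : (F.map hvw).carrier) (a : (F.map huv).carrier) (h) :
    (F.map (hvw.trans huv)).t (F.mul b a h) = (F.map hvw).t b :=
  (F.mapComp huv hvw).t_comm _

theorem mul_congr {b b' : (F.map hvw).carrier} {a a' : (F.map huv).carrier} (hb : b = b')
    (ha : a = a') (h h') : F.mul b a h = F.mul b' a' h' := by
  subst hb ha
  rfl

theorem mul_inj {b b' : (F.map hvw).carrier} {a a' : (F.map huv).carrier} {h h'}
    (he : F.mul b a h = F.mul b' a' h') : b = b' ∧ a = a' := by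
  have := congrArg Subtype.val ((F.mapComp huv hvw).toEquiv.injective he)
  exact ⟨congrArg Prod.fst this, congrArg Prod.snd this⟩

theorem exists_mul (huv : v < u) (hvw : w < v) (x : (F.map (hvw.trans huv)).carrier) :
    ∃ (b : (F.map hvw).carrier) (a : (F.map huv).carrier) (h : _), x = F.mul b a h := by
  obtain ⟨⟨⟨b, a⟩, h⟩, rfl⟩ := (F.mapComp huv hvw).toEquiv.surjective x
  exact ⟨b, a, h, rfl⟩

theorem mul_assoc (c : (F.map hwz).carrier) (b : (F.map hvw).carrier) (a : (F.map huv).carrier)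
    (h₁ h₂ h₃ h₄) : F.mul (F.mul c b h₁) a h₂ = F.mul c (F.mul b a h₃) h₄ :=
  (congrArg (fun f => f.toEquiv ⟨(⟨(c, b), h₁⟩, a), h₃⟩) (F.coherence huv hvw hwz)).symm

end CubeFunctor

/-! ### Replacing the edge correspondences of a functor. -/

/-- The composition of 2-morphisms along an object. -/
def TwoMor.hcomp {A B C : Type} {Y Y' : Corr B C} {X X' : Corr A B} (g : TwoMor Y Y')
    (f : TwoMor X X') : TwoMor (Y.comp X) (Y'.comp X') :=
  (g.whiskerRight X).trans (f.whiskerLeft Y')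

/-- A functor can be replaced by one with prescribed isomorphic edge correspondences. -/
theorem CubeFunctor.exists_toCubeData_eq (G : CubeFunctor n)
    (edge : ∀ {u v : Cube n}, CubeEdge u v → Corr (G.obj u) (G.obj v))
    (face : VertexEdgeData.FaceMaps ⟨G.obj, G.finite_obj, edge⟩)
    (θ : ∀ {u v : Cube n} (h : CubeEdge u v), TwoMor (edge h) (G.map h.lt))
    (hface : ∀ (u v v' w : Cube n) (h : CubeFace u v v' w)
      (p : ((edge h.vw).comp (edge h.uv)).carrier),
      (G.mapComp h.uv'.lt h.vw'.lt).toEquiv (((θ h.vw').hcomp (θ h.uv')).toEquiv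
        ((face u v v' w h).toEquiv p)) =
      (G.mapComp h.uv.lt h.vw.lt).toEquiv (((θ h.vw).hcomp (θ h.uv)).toEquiv p)) :
    ∃ F : CubeFunctor n, F.toCubeData = ⟨⟨G.obj, G.finite_obj, edge⟩, face⟩ := by
  classical
  -- Over edges take the prescribed correspondence, over longer morphisms keep that of `G`, and
  -- conjugate the structure maps by the identifications.
  let c : ∀ {u v : Cube n} (h : v < u), Σ X : Corr (G.obj u) (G.obj v), TwoMor X (G.map h) :=
    fun {u v} h => if he : CubeEdge u v then ⟨edge he, θ he⟩
      else ⟨G.map h, Equiv.refl _, fun _ => rfl, fun _ => rfl⟩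
  let F : CubeFunctor n :=
    { obj := G.obj
      finite_obj := G.finite_obj
      map := fun h => (c h).1
      mapComp := fun huv hvw => (((c hvw).2.hcomp (c huv).2).trans (G.mapComp huv hvw)).trans
        (c (hvw.trans huv)).2.symm
      coherence := by
        intro u v w z huv hvw hwz
        refine TwoMor.ext (Equiv.ext ?_)
        rintro ⟨⟨⟨⟨r, b⟩, h₁⟩, a⟩, h₂⟩
        refine congrArg (c ((hwz.trans hvw).trans huv)).2.toEquiv.symm ?_
        have k₁ : (G.map hwz).s ((c hwz).2.toEquiv r) = (G.map hvw).t ((c hvw).2.toEquiv b) :=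
          ((c hwz).2.s_comm r).trans (h₁.trans ((c hvw).2.t_comm b).symm)
        have k₂ : (G.map hvw).s ((c hvw).2.toEquiv b) = (G.map huv).t ((c huv).2.toEquiv a) :=
          ((c hvw).2.s_comm b).trans (h₂.trans ((c huv).2.t_comm a).symm)
        have e₁ := (c (hvw.trans huv)).2.toEquiv.apply_symm_apply
          (G.mul ((c hvw).2.toEquiv b) ((c huv).2.toEquiv a) k₂)
        have e₂ := (c (hwz.trans hvw)).2.toEquiv.apply_symm_apply
          (G.mul ((c hwz).2.toEquiv r) ((c hvw).2.toEquiv b) k₁)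
        refine (CubeFunctor.mul_congr rfl e₁ _ (k₁.trans (CubeFunctor.t_mul _ _ k₂).symm)).trans
          ((CubeFunctor.mul_assoc _ _ _ k₁ ((CubeFunctor.s_mul _ _ k₁).trans k₂) k₂ _).symm.trans
          (CubeFunctor.mul_congr e₂.symm rfl _ _)) }
  -- The resulting data as a function of the chosen correspondences and identifications together;
  -- then the case distinction in `c` can be removed by rewriting the argument, without casts.
  let D : (∀ {u v : Cube n} (h : CubeEdge u v), Σ X : Corr (G.obj u) (G.obj v),
      TwoMor X (G.map h.lt)) → CubeData n := fun e =>
    { obj := G.obj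
      finite_obj := G.finite_obj
      edge := fun h => (e h).1
      face := fun _ _ _ _ h =>
        (((e h.vw).2.hcomp (e h.uv).2).trans (G.mapComp h.uv.lt h.vw.lt)).trans
          (((e h.vw').2.hcomp (e h.uv').2).trans (G.mapComp h.uv'.lt h.vw'.lt)).symm }
  refine ⟨F, ?_⟩
  have h₁ : F.toCubeData = D fun h => c h.lt := by
    refine congrArg (CubeData.mk _) ?_
    funext u v v' w h
    refine TwoMor.ext (Equiv.ext fun p => ?_)
    refine ((F.mapComp h.uv'.lt h.vw'.lt).toEquiv.symm_apply_eq).2 ?_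
    exact congrArg (c (h.vw.lt.trans h.uv.lt)).2.toEquiv.symm
      ((((c h.vw'.lt).2.hcomp (c h.uv'.lt).2).trans
        (G.mapComp h.uv'.lt h.vw'.lt)).toEquiv.apply_symm_apply _).symm
  have h₂ : (fun {u v : Cube n} (h : CubeEdge u v) => c h.lt) =
      fun {u v : Cube n} (h : CubeEdge u v) => ⟨edge h, θ h⟩ := by
    funext u v h
    exact dif_pos h
  rw [h₁, h₂]
  refine congrArg (CubeData.mk _) ?_
  funext u v v' w h
  refine TwoMor.ext (Equiv.ext fun p => ?_)
  exact ((((θ h.vw').hcomp (θ h.uv')).trans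
    (G.mapComp h.uv'.lt h.vw'.lt)).toEquiv.symm_apply_eq).2 (hface u v v' w h p).symm

/-! ### Extending an isomorphism from edges to all morphisms. -/

namespace CubeFunctor

variable {F G : CubeFunctor n}

/-- Bijections between the values of two functors at the vertices and edges that are compatible
with the two-dimensional faces. -/
structure EdgeIso (F G : CubeFunctor n) where
  obj : ∀ v, F.obj v ≃ G.obj v
  edge : ∀ {u v : Cube n} (h : CubeEdge u v), (F.map h.lt).carrier ≃ (G.map h.lt).carrier
  s_comm : ∀ {u v : Cube n} (h : CubeEdge u v) (x : (F.map h.lt).carrier),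
    (G.map h.lt).s (edge h x) = obj u ((F.map h.lt).s x)
  t_comm : ∀ {u v : Cube n} (h : CubeEdge u v) (x : (F.map h.lt).carrier),
    (G.map h.lt).t (edge h x) = obj v ((F.map h.lt).t x)
  mul_eq : ∀ {u v v' w : Cube n} (h : CubeFace u v v' w) (b : (F.map h.vw.lt).carrier)
    (a : (F.map h.uv.lt).carrier) (b' : (F.map h.vw'.lt).carrier) (a' : (F.map h.uv'.lt).carrier)
    (k k' l l'), F.mul b a k = F.mul b' a' k' →
    G.mul (edge h.vw b) (edge h.uv a) l = G.mul (edge h.vw' b') (edge h.uv' a') l'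

/-- The equality includes equality of types. With both sides variable it can be substituted, so that
identities serve as the bijections and later arguments need no transport. -/
theorem exists_equiv_of_eq {D D' : CubeData n} (h : D = D') :
    ∃ (obj : ∀ v, D.obj v ≃ D'.obj v)
      (edge : ∀ {u v : Cube n} (h : CubeEdge u v), (D.edge h).carrier ≃ (D'.edge h).carrier)
      (_ : ∀ {u v : Cube n} (h : CubeEdge u v) (x : (D.edge h).carrier),
        (D'.edge h).s (edge h x) = obj u ((D.edge h).s x))
      (_ : ∀ {u v : Cube n} (h : CubeEdge u v) (x : (D.edge h).carrier),
        (D'.edge h).t (edge h x) = obj v ((D.edge h).t x)),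
      ∀ {u v v' w : Cube n} (h : CubeFace u v v' w) (b : (D.edge h.vw).carrier)
        (a : (D.edge h.uv).carrier) (b' : (D.edge h.vw').carrier) (a' : (D.edge h.uv').carrier)
        (k k' l l'), (D.face u v v' w h).toEquiv ⟨(b, a), k⟩ = ⟨(b', a'), k'⟩ →
        (D'.face u v v' w h).toEquiv ⟨(edge h.vw b, edge h.uv a), l⟩ =
          ⟨(edge h.vw' b', edge h.uv' a'), l'⟩ := by
  subst h
  exact ⟨fun v => .refl _, fun h => .refl _, fun _ _ => rfl, fun _ _ => rfl,
    fun h b a b' a' k k' l l' he => he⟩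

theorem nonempty_edgeIso (h : F.toCubeData = G.toCubeData) : Nonempty (EdgeIso F G) := by
  obtain ⟨obj, edge, hs, ht, hf⟩ := exists_equiv_of_eq h
  refine ⟨⟨obj, edge, hs, ht, fun h b a b' a' k k' l l' he => ?_⟩⟩
  exact (Equiv.symm_apply_eq _).1 (hf h b a b' a' k k' l l' ((Equiv.symm_apply_eq _).2 he))

/-- The inverse bijections. -/
def EdgeIso.symm (I : EdgeIso F G) : EdgeIso G F where
  obj v := (I.obj v).symm
  edge h := (I.edge h).symm
  s_comm h x := by
    rw [Equiv.eq_symm_apply, ← I.s_comm h, Equiv.apply_symm_apply]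
  t_comm h x := by
    rw [Equiv.eq_symm_apply, ← I.t_comm h, Equiv.apply_symm_apply]
  mul_eq h b a b' a' k k' l l' he := by
    obtain ⟨r, s, m, hm⟩ := exists_mul h.uv'.lt h.vw'.lt
      (F.mul ((I.edge h.vw).symm b) ((I.edge h.uv).symm a) l)
    have m' : (G.map h.vw'.lt).s (I.edge h.vw' r) = (G.map h.uv'.lt).t (I.edge h.uv' s) := by
      rw [I.s_comm, m, I.t_comm]
    have h1 := I.mul_eq h _ _ r s l m (by rwa [Equiv.apply_symm_apply, Equiv.apply_symm_apply]) m' hm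
    have h2 : G.mul b' a' k' = G.mul (I.edge h.vw' r) (I.edge h.uv' s) m' := by
      rw [← he, ← h1]
      exact mul_congr (Equiv.apply_symm_apply _ _).symm (Equiv.apply_symm_apply _ _).symm _ _
    obtain ⟨h3, h4⟩ := mul_inj h2
    rw [hm]
    exact mul_congr ((Equiv.eq_symm_apply _).2 h3.symm) ((Equiv.eq_symm_apply _).2 h4.symm) _ _

/-- The elements of the correspondences of two functors that correspond to each other. -/
inductive EdgeIso.Rel (I : EdgeIso F G) :
    ∀ {u w : Cube n} (h : w < u), (F.map h).carrier → (G.map h).carrier → Prop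
  | edge {u v : Cube n} (h : CubeEdge u v) (x : (F.map h.lt).carrier) : Rel I h.lt x (I.edge h x)
  | step {u v w : Cube n} (huv : CubeEdge u v) (hvw : w < v) (a : (F.map huv.lt).carrier)
      (b : (F.map hvw).carrier) (b' : (G.map hvw).carrier) (h : (F.map hvw).s b = (F.map huv.lt).t a)
      (h' : (G.map hvw).s b' = (G.map huv.lt).t (I.edge huv a)) :
      Rel I hvw b b' → Rel I (hvw.trans huv.lt) (F.mul b a h) (G.mul b' (I.edge huv a) h')

variable {I : EdgeIso F G} {u v w : Cube n}

theorem EdgeIso.Rel.cases_eq {h : w < u} {x : (F.map h).carrier} {y : (G.map h).carrier}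
    (hr : I.Rel h x y) : (∃ he : CubeEdge u w, y = I.edge he x) ∨
      ∃ (v : Cube n) (huv : CubeEdge u v) (hvw : w < v) (a : (F.map huv.lt).carrier)
        (b : (F.map hvw).carrier) (b' : (G.map hvw).carrier) (k k' : _),
        I.Rel hvw b b' ∧ x = F.mul b a k ∧ y = G.mul b' (I.edge huv a) k' := by
  cases hr with
  | edge he => exact Or.inl ⟨he, rfl⟩
  | step huv hvw a b b' k k' hb => exact Or.inr ⟨_, huv, hvw, a, b, b', k, k', hb, rfl, rfl⟩

theorem EdgeIso.Rel.s_comm {h : w < u} {x : (F.map h).carrier} {y : (G.map h).carrier}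
    (hr : I.Rel h x y) : (G.map h).s y = I.obj u ((F.map h).s x) := by
  induction hr with
  | edge he => exact I.s_comm he _
  | step huv hvw a b b' k k' hb ih => rw [s_mul, s_mul, I.s_comm]

theorem EdgeIso.Rel.t_comm {h : w < u} {x : (F.map h).carrier} {y : (G.map h).carrier}
    (hr : I.Rel h x y) : (G.map h).t y = I.obj w ((F.map h).t x) := by
  induction hr with
  | edge he => exact I.t_comm he _
  | step huv hvw a b b' k k' hb ih => rw [t_mul, t_mul, ih]

theorem EdgeIso.Rel.symm {h : w < u} {x : (F.map h).carrier} {y : (G.map h).carrier}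
    (hr : I.Rel h x y) : I.symm.Rel h y x := by
  induction hr with
  | edge he x =>
    have := EdgeIso.Rel.edge (I := I.symm) he (I.edge he x)
    rwa [show I.symm.edge he (I.edge he x) = x from Equiv.symm_apply_apply _ _] at this
  | step huv hvw a b b' k k' hb ih =>
    have e : I.symm.edge huv (I.edge huv a) = a := Equiv.symm_apply_apply _ _
    have := EdgeIso.Rel.step (I := I.symm) huv hvw (I.edge huv a) b' b k' (by rw [e, k]) ih
    rwa [mul_congr rfl e _ k] at this

theorem exists_cubeEdge_of_lt (h : w < u) : ∃ v, CubeEdge u v ∧ w ≤ v := by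
  obtain ⟨hle, i, hi⟩ := Pi.lt_def.1 h
  have hu : u i = true := by
    cases hu : u i
    · rw [hu] at hi
      exact absurd hi (by cases w i <;> decide)
    · rfl
  have hw : w i = false := by
    cases hw : w i
    · rfl
    · rw [hw, hu] at hi
      exact absurd hi (by decide)
  refine ⟨Function.update u i false, cubeEdge_of_apply hu (Function.update_self ..) fun j hj =>
    (Function.update_of_ne hj ..).symm, fun j => ?_⟩
  by_cases hj : j = i
  · rw [hj, hw]
    exact Bool.false_le _
  · rw [Function.update_of_ne hj]
    exact hle j

theorem exists_face_of_cubeEdge {v' : Cube n} (h : CubeEdge u v) (h' : CubeEdge u v') (hne : v ≠ v')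
    (hw : w ≤ v) (hw' : w ≤ v') : ∃ m, CubeFace u v v' m ∧ w ≤ m := by
  have hc : h'.coord ≠ h.coord := by
    intro hc
    refine hne (funext fun i => ?_)
    by_cases hi : i = h.coord
    · rw [hi, h.apply_coord.2, ← hc, h'.apply_coord.2]
    · rw [← h.apply_eq hi, ← h'.apply_eq (hc ▸ hi)]
  refine ⟨Function.update v h'.coord false, ⟨h, h', cubeEdge_of_apply (c := h'.coord) ?_
    (Function.update_self ..) fun i hi => (Function.update_of_ne hi ..).symm,
    cubeEdge_of_apply (c := h.coord) ?_ ?_ ?_, hne⟩, fun i => ?_⟩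
  · rw [← h.apply_eq hc, h'.apply_coord.1]
  · rw [← h'.apply_eq hc.symm, h.apply_coord.1]
  · rw [Function.update_of_ne hc.symm, h.apply_coord.2]
  · intro i hi
    by_cases hi' : i = h'.coord
    · rw [hi', h'.apply_coord.2, Function.update_self]
    · rw [Function.update_of_ne hi', ← h'.apply_eq hi', h.apply_eq hi]
  · by_cases hi : i = h'.coord
    · rw [hi, Function.update_self, ← h'.apply_coord.2]
      exact hw' _
    · rw [Function.update_of_ne hi]
      exact hw i

theorem EdgeIso.exists_rel (I : EdgeIso F G) {u w : Cube n} (h : w < u) (x : (F.map h).carrier) :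
    ∃ y, I.Rel h x y := by
  induction hd : grade u using Nat.strong_induction_on generalizing u with
  | _ d ih =>
    obtain ⟨v, huv, hwv⟩ := exists_cubeEdge_of_lt h
    rcases hwv.eq_or_lt with rfl | hwv
    · exact ⟨_, .edge huv x⟩
    · obtain ⟨b, a, k, rfl⟩ := exists_mul huv.lt hwv x
      obtain ⟨b', hb⟩ := ih (grade v) (hd ▸ grade_lt huv.lt) hwv b rfl
      refine ⟨_, .step huv hwv a b b' k ?_ hb⟩
      rw [hb.s_comm, k, I.t_comm]

/-- Two factorizations with the same first edge have the same factors. If the first edges differ,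
they span a square above the target; both elements are refactored through its bottom vertex, and
compatibility with this square together with associativity identifies the images. -/
theorem EdgeIso.Rel.unique {u w : Cube n} {h : w < u} {x : (F.map h).carrier}
    {y y' : (G.map h).carrier} (hy : I.Rel h x y) (hy' : I.Rel h x y') : y = y' := by
  induction hd : grade u using Nat.strong_induction_on generalizing u with
  | _ d ih =>
    have hno : CubeEdge u w → ∀ v, CubeEdge u v → w < v → False := fun he v hv hw => by
      have h1 := he.grade_eq
      have h2 := hv.grade_eq
      have h3 := grade_lt hw
      omega
    rcases hy.cases_eq with ⟨he, rfl⟩ | ⟨v, huv, hvw, a, b, c, k, l, hb, rfl, rfl⟩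
    · rcases hy'.cases_eq with ⟨he', rfl⟩ | ⟨v, huv, hvw, -⟩
      · rfl
      · exact (hno he v huv hvw).elim
    rcases hy'.cases_eq with ⟨he', -⟩ | ⟨v', huv', hvw', a', b', c', k', l', hb', he, rfl⟩
    · exact (hno he' v huv hvw).elim
    by_cases hv : v = v'
    · subst hv
      obtain ⟨rfl, rfl⟩ := mul_inj he
      exact mul_congr (ih _ (hd ▸ grade_lt huv.lt) hb hb' rfl) rfl _ _
    obtain ⟨m, hm, hwm⟩ := exists_face_of_cubeEdge huv huv' hv hvw.le hvw'.le
    rcases hwm.eq_or_lt with rfl | hwm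
    · obtain rfl := ih _ (hd ▸ grade_lt huv.lt) hb (.edge hm.vw b) rfl
      obtain rfl := ih _ (hd ▸ grade_lt huv'.lt) hb' (.edge hm.vw' b') rfl
      exact I.mul_eq hm b a b' a' k k' l l' he
    -- Write `b = r s` through the bottom `m` of the square. Moving `s a` across the square to `s'
    -- a''` gives `b' = r s'` and `a' = a''`, so both images contain the same image `r'` of `r`.
    · obtain ⟨r, s, k₁, rfl⟩ := exists_mul hm.vw.lt hwm b
      have k₂ : (F.map hm.vw.lt).s s = (F.map huv.lt).t a := (s_mul _ _ k₁).symm.trans k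
      obtain ⟨s', a'', k₃, e₃⟩ := exists_mul hm.uv'.lt hm.vw'.lt (F.mul s a k₂)
      have k₄ : (F.map hwm).s r = (F.map hm.vw'.lt).t s' := by
        rw [k₁, ← t_mul s a k₂, e₃, t_mul]
      have e₄ : F.mul b' a' k' = F.mul (F.mul r s' k₄) a'' ((s_mul _ _ k₄).trans k₃) := by
        rw [← he, mul_assoc r s a k₁ k k₂ (k₁.trans (t_mul s a k₂).symm),
          mul_assoc r s' a'' k₄ _ k₃ (k₄.trans (t_mul s' a'' k₃).symm)]
        exact mul_congr rfl e₃ _ _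
      obtain ⟨rfl, rfl⟩ := mul_inj e₄
      obtain ⟨r', hr⟩ := I.exists_rel hwm r
      have j₁ : (G.map hwm).s r' = (G.map hm.vw.lt).t (I.edge hm.vw s) := by
        rw [hr.s_comm, k₁, I.t_comm]
      have j₂ : (G.map hwm).s r' = (G.map hm.vw'.lt).t (I.edge hm.vw' s') := by
        rw [hr.s_comm, k₄, I.t_comm]
      obtain rfl := ih _ (hd ▸ grade_lt huv.lt) hb (.step hm.vw hwm s r r' k₁ j₁ hr) rfl
      obtain rfl := ih _ (hd ▸ grade_lt huv'.lt) hb' (.step hm.vw' hwm s' r r' k₄ j₂ hr) rfl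
      have j₃ : (G.map hm.vw.lt).s (I.edge hm.vw s) = (G.map huv.lt).t (I.edge huv a) := by
        rw [I.s_comm, k₂, I.t_comm]
      have j₄ : (G.map hm.vw'.lt).s (I.edge hm.vw' s') = (G.map huv'.lt).t (I.edge huv' a') := by
        rw [I.s_comm, k₃, I.t_comm]
      rw [mul_assoc _ _ _ j₁ l j₃ (j₁.trans (t_mul _ _ j₃).symm),
        mul_assoc _ _ _ j₂ l' j₄ (j₂.trans (t_mul _ _ j₄).symm)]
      exact mul_congr rfl (I.mul_eq hm s a s' a' k₂ k₃ j₃ j₄ e₃) _ _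

/-- The relation is generated by adding edges at the top. A product is reduced to this by
reassociating along the factorization of its upper factor. -/
theorem EdgeIso.Rel.mul {huv : v < u} {hvw : w < v} {b : (F.map hvw).carrier}
    {b' : (G.map hvw).carrier} {a : (F.map huv).carrier} {a' : (G.map huv).carrier}
    (hb : I.Rel hvw b b') (ha : I.Rel huv a a') (h h') :
    I.Rel (hvw.trans huv) (F.mul b a h) (G.mul b' a' h') := by
  induction ha generalizing w with
  | edge huv a => exact .step huv hvw a b b' h h' hb
  | step huv hvw' a c c' k k' hc ih =>
    have k₁ : (F.map hvw).s b = (F.map hvw').t c := h.trans (t_mul _ _ k)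
    have k₂ : (G.map hvw).s b' = (G.map hvw').t c' := h'.trans (t_mul _ _ k')
    rw [← mul_assoc b c a k₁ ((s_mul _ _ k₁).trans k) k h,
      ← mul_assoc b' c' _ k₂ ((s_mul _ _ k₂).trans k') k' h']
    exact .step huv _ _ _ _ _ _ (ih hb k₁ k₂)

/-- Two functors with the same vertex, edge and face data are naturally isomorphic. -/
theorem nonempty_natIso (h : F.toCubeData = G.toCubeData) : Nonempty (NatIso F G) := by
  obtain ⟨I⟩ := nonempty_edgeIso h
  choose τ hτ using @fun u w (h : w < u) x => I.exists_rel h x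
  choose σ hσ using @fun u w (h : w < u) x => I.symm.exists_rel h x
  refine ⟨⟨I.obj, fun h => ⟨τ _ _ h, σ _ _ h, fun x => ?_, fun y => ?_⟩,
    fun h x => (hτ _ _ h x).s_comm, fun h x => (hτ _ _ h x).t_comm, fun huv hvw p => ?_⟩⟩
  · exact (hσ _ _ h (τ _ _ h x)).unique (hτ _ _ h x).symm
  · exact (hτ _ _ h (σ _ _ h y)).unique (hσ _ _ h y).symm
  · exact (hτ _ _ _ _).unique ((hτ _ _ hvw p.1.1).mul (hτ _ _ huv p.1.2) p.2 _)

end CubeFunctor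

end KhBurnside

namespace KhBurnside

namespace LinkDiagram

variable {n : ℕ} {K : LinkDiagram n}

/-! ## The functor of classes of paths -/

instance : Finite K.Pt := inferInstanceAs (Finite (Σ v : Cube n, K.Gen v))

instance (a b : K.Pt) : Finite (Path a b) := by
  refine Finite.of_injective (fun (p : Path a b) (g : Fin (n + 1)) => p.1 g) fun p q h => ?_
  refine Subtype.ext (funext fun g => ?_)
  rcases Nat.lt_or_ge g (n + 1) with hg | hg
  · exact congrFun h ⟨g, hg⟩
  · have := KhBurnside.grade_le a.1
    rw [p.2.top g (by omega), q.2.top g (by omega)]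

theorem IsPath.concat {a b c : K.Pt} {p q : ℕ → K.Pt} (hp : IsPath a b p) (hq : IsPath b c q) :
    IsPath a c fun g => if grade b.1 ≤ g then p g else q g := by
  have h1 := hp.grade_le
  have h2 := hq.grade_le
  refine ⟨fun g hg => ?_, fun g hg => ?_, fun g hg hg' => ?_⟩
  · rw [if_pos (by omega), hp.top g hg]
  · split_ifs with h
    · rw [hp.bot g (by omega), ← hq.top g h, hq.bot g hg]
    · exact hq.bot g hg
  · rcases Nat.lt_trichotomy (g + 1) (grade b.1) with h | h | h
    · rw [if_neg (by omega), if_neg (by omega)]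
      exact hq.step g hg (by omega)
    · rw [if_pos (by omega), if_neg (by omega), h, hp.bot _ le_rfl, ← hq.top _ le_rfl, ← h]
      exact hq.step g hg (by omega)
    · rw [if_pos (by omega), if_pos (by omega)]
      exact hp.step g (by omega) hg'

/-- The concatenation of paths. -/
def Path.concat {a b c : K.Pt} (p : Path a b) (q : Path b c) : Path a c :=
  ⟨_, p.2.concat q.2⟩

theorem IsPath.upper {a c : K.Pt} {p : ℕ → K.Pt} (hp : IsPath a c p) {g₀ : ℕ}
    (h : grade c.1 ≤ g₀) (h' : g₀ ≤ grade a.1) : IsPath a (p g₀) fun g => p (max g g₀) := by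
  have e := hp.grade_eq h h'
  refine ⟨fun g hg => hp.top _ (le_max_of_le_left hg), fun g hg => ?_, fun g hg hg' => ?_⟩
  · rw [max_eq_right (hg.trans e.le)]
  · rw [max_eq_left (by omega), max_eq_left (by omega)]
    exact hp.step g (by omega) hg'

theorem IsPath.lower {a c : K.Pt} {p : ℕ → K.Pt} (hp : IsPath a c p) {g₀ : ℕ}
    (h : grade c.1 ≤ g₀) (h' : g₀ ≤ grade a.1) : IsPath (p g₀) c fun g => p (min g g₀) := by
  have e := hp.grade_eq h h'
  refine ⟨fun g hg => ?_, fun g hg => hp.bot _ (min_le_of_left_le hg), fun g hg hg' => ?_⟩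
  · rw [min_eq_right (by omega)]
  · rw [min_eq_left (by omega), min_eq_left (by omega)]
    exact hp.step g hg (by omega)

theorem Swap.concat_left {a b c : K.Pt} {p p' : Path a b} (h : Swap p p') (q : Path b c) :
    Swap (p.concat q) (p'.concat q) := by
  obtain ⟨g, d, hd, he⟩ := h
  have hb := p.2.bounds hd
  have e : ∀ i, grade b.1 ≤ i → (p.concat q).1 i = p.1 i := fun i hi => if_pos hi
  refine ⟨g, d, ?_, funext fun i => ?_⟩
  · rwa [e _ (by omega), e _ (by omega), e _ (by omega)]
  · change (if grade b.1 ≤ i then p'.1 i else q.1 i) = _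
    rw [he]
    simp only [Function.update_apply]
    split_ifs with h1 h2 h3
    · rfl
    · exact (e i h1).symm
    · omega
    · exact (if_neg h1).symm

theorem Swap.concat_right {a b c : K.Pt} (p : Path a b) {q q' : Path b c} (h : Swap q q') :
    Swap (p.concat q) (p.concat q') := by
  obtain ⟨g, d, hd, he⟩ := h
  have hb := q.2.bounds hd
  have e : ∀ i, i ≤ grade b.1 → (p.concat q).1 i = q.1 i := fun i hi => by
    change (if grade b.1 ≤ i then p.1 i else q.1 i) = _
    split_ifs with h
    · rw [p.2.bot i hi, q.2.top i h]
    · rfl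
  refine ⟨g, d, ?_, funext fun i => ?_⟩
  · rwa [e _ (by omega), e _ (by omega), e _ (by omega)]
  · change (if grade b.1 ≤ i then p.1 i else q'.1 i) = _
    rw [he]
    simp only [Function.update_apply]
    split_ifs with h1 h2 h3
    · omega
    · exact (if_pos h1).symm
    · rfl
    · exact (if_neg h1).symm

/-- The classes of paths under moves across squares. -/
def PathClass (a b : K.Pt) : Type := Quot (Swap : Path a b → Path a b → Prop)

instance (a b : K.Pt) : Finite (PathClass a b) := inferInstanceAs (Finite (Quot _))

/-- The class of a path. -/
def Path.cls {a b : K.Pt} (p : Path a b) : PathClass a b := Quot.mk _ p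

theorem PathClass.exists_irreducible {a b : K.Pt} (A : PathClass a b) :
    ∃ p : Path a b, p.cls = A ∧ ∀ r, ¬ Red Fin.val p r := by
  induction A using Quot.ind with
  | mk p =>
    obtain ⟨q, hq, hirr⟩ := LinkDiagram.exists_irreducible Fin.val p
    exact ⟨q, (Quot.eqvGen_sound (eqvGen_swap_of_red hq)).symm, hirr⟩

/-- The concatenation of classes of paths. -/
def PathClass.concat {a b c : K.Pt} (A : PathClass a b) (B : PathClass b c) : PathClass a c :=
  Quot.map₂ Path.concat (fun p _ _ h => h.concat_right p) (fun _ _ q h => h.concat_left q) A B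

variable (K) in
/-- The correspondence of classes of paths between two vertices. -/
def pathCorr (u w : Cube n) : Corr (K.Gen u) (K.Gen w) where
  carrier := Σ (x : K.Gen u) (z : K.Gen w), PathClass (⟨u, x⟩ : K.Pt) ⟨w, z⟩
  finite_carrier := inferInstance
  s p := p.1
  t p := p.2.1

variable {u v w : Cube n}

/-- The concatenation of classes of paths, as a map between correspondences. -/
def pathMul (p : ((K.pathCorr v w).comp (K.pathCorr u v)).carrier) : (K.pathCorr u w).carrier :=
  ⟨p.1.2.1, p.1.1.2.1, p.1.2.2.2.concat
    (cast (congrArg (fun y => PathClass (⟨v, y⟩ : K.Pt) ⟨w, p.1.1.2.1⟩) p.2) p.1.1.2.2)⟩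

/-- Surjectivity holds because every path can be moved through `v`. For injectivity, irreducible
representatives of the factors make the two concatenations run through the same vertices; being
equivalent, they are equal, and they can be cut at `v`. -/
theorem pathMul_bijective (hvu : v ≤ u) (hwv : w ≤ v) : Function.Bijective
    (pathMul : ((K.pathCorr v w).comp (K.pathCorr u v)).carrier → (K.pathCorr u w).carrier) := by
  constructor
  · rintro ⟨⟨⟨y, z, B⟩, ⟨x, y', A⟩⟩, h⟩ ⟨⟨⟨y₁, z₁, B₁⟩, ⟨x₁, y₁', A₁⟩⟩, h₁⟩ he
    obtain rfl : y = y' := h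
    obtain rfl : y₁ = y₁' := h₁
    obtain rfl : x = x₁ := congrArg Sigma.fst he
    obtain rfl : z = z₁ := congrArg (fun p => p.2.1) he
    obtain ⟨α, rfl, hα⟩ := A.exists_irreducible
    obtain ⟨β, rfl, hβ⟩ := B.exists_irreducible
    obtain ⟨α₁, rfl, hα₁⟩ := A₁.exists_irreducible
    obtain ⟨β₁, rfl, hβ₁⟩ := B₁.exists_irreducible
    have hc : (α.concat β).cls = (α₁.concat β₁).cls :=
      eq_of_heq (Sigma.mk.inj (eq_of_heq (Sigma.mk.inj he).2)).2
    have hp : α.concat β = α₁.concat β₁ := by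
      refine eq_of_eqvGen_swap (Quot.eqvGen_exact hc) fun g => ?_
      change (if grade v ≤ g then α.1 g else β.1 g).1 = (if grade v ≤ g then α₁.1 g else β₁.1 g).1
      split_ifs
      · exact fst_eq_of_irreducible (p := α) (p' := α₁) rfl rfl hα hα₁ g
      · exact fst_eq_of_irreducible (p := β) (p' := β₁) rfl rfl hβ hβ₁ g
    have hg : ∀ g, (if grade v ≤ g then α.1 g else β.1 g) =
        if grade v ≤ g then α₁.1 g else β₁.1 g := fun g => congrFun (congrArg Subtype.val hp) g
    have hy : (⟨v, y⟩ : K.Pt) = ⟨v, y₁⟩ := by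
      have := hg (grade v)
      rwa [if_pos le_rfl, if_pos le_rfl, α.2.bot _ le_rfl, α₁.2.bot _ le_rfl] at this
    obtain rfl := eq_of_heq (Sigma.mk.inj hy).2
    obtain rfl : α = α₁ := by
      refine Subtype.ext (funext fun g => ?_)
      rcases le_total g (grade v) with h | h
      · rw [α.2.bot g h, α₁.2.bot g h]
      · have := hg g
        rwa [if_pos h, if_pos h] at this
    obtain rfl : β = β₁ := by
      refine Subtype.ext (funext fun g => ?_)
      rcases Nat.lt_or_ge g (grade v) with h | h
      · have := hg g
        rwa [if_neg (not_le.2 h), if_neg (not_le.2 h)] at this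
      · rw [β.2.top g h, β₁.2.top g h]
    rfl
  · rintro ⟨x, z, C⟩
    induction C using Quot.ind with
    | mk γ =>
      obtain ⟨δ, hδ, hv⟩ := exists_through γ hwv hvu
      obtain ⟨y, hy⟩ : ∃ y, δ.1 (grade v) = ⟨v, y⟩ := by
        generalize δ.1 (grade v) = q at hv
        obtain ⟨v', y⟩ := q
        obtain rfl : v' = v := hv
        exact ⟨y, rfl⟩
      have h1 := δ.2.upper (grade_mono hwv) (grade_mono hvu)
      have h2 := δ.2.lower (grade_mono hwv) (grade_mono hvu)
      rw [hy] at h1 h2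
      refine ⟨⟨(⟨y, z, Path.cls ⟨_, h2⟩⟩, ⟨x, y, Path.cls ⟨_, h1⟩⟩), rfl⟩, ?_⟩
      have he : Path.concat ⟨_, h1⟩ ⟨_, h2⟩ = δ := by
        refine Subtype.ext (funext fun g => ?_)
        change (if grade v ≤ g then δ.1 (max g (grade v)) else δ.1 (min g (grade v))) = δ.1 g
        split_ifs with h
        · rw [max_eq_left h]
        · rw [min_eq_left (by omega)]
      change (⟨x, z, (Path.concat ⟨_, h1⟩ ⟨_, h2⟩).cls⟩ : (K.pathCorr u w).carrier) = ⟨x, z, γ.cls⟩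
      rw [he]
      exact congrArg (fun C => (⟨x, z, C⟩ : (K.pathCorr u w).carrier))
        (Quot.eqvGen_sound hδ).symm

variable (K) in
/-- The functor of classes of paths. -/
noncomputable def pathFunctor : CubeFunctor n where
  obj := K.Gen
  finite_obj _ := inferInstance
  map {u v} _ := K.pathCorr u v
  mapComp huv hvw := ⟨Equiv.ofBijective _ (pathMul_bijective huv.le hvw.le), fun _ => rfl,
    fun _ => rfl⟩
  coherence := by
    intro u v w z huv hvw hwz
    refine TwoMor.ext (Equiv.ext ?_)
    rintro ⟨⟨⟨⟨⟨c, d, C⟩, ⟨b, c', B⟩⟩, h₁⟩, ⟨a, b', A⟩⟩, h₂⟩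
    obtain rfl : c = c' := h₁
    obtain rfl : b = b' := h₂
    induction A using Quot.ind with
    | mk p =>
    induction B using Quot.ind with
    | mk q =>
    induction C using Quot.ind with
    | mk r =>
    have h : (p.concat q).concat r = p.concat (q.concat r) := by
      refine Subtype.ext (funext fun g => ?_)
      change (if grade w ≤ g then if grade v ≤ g then p.1 g else q.1 g else r.1 g) =
        if grade v ≤ g then p.1 g else if grade w ≤ g then q.1 g else r.1 g
      have := grade_lt hvw
      split_ifs <;> first | rfl | omega
    exact congrArg (fun p => (⟨a, d, Path.cls p⟩ : (K.pathCorr u z).carrier)) h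

/-- The path along an edge. -/
def edgePath {a b : K.Pt} (h : Step a b) : Path a b :=
  ⟨fun g => if grade a.1 ≤ g then a else b, fun g hg => if_pos hg, fun g hg => if_neg (by
    have := h.1.grade_eq
    omega), fun g hg hg' => by
    have := h.1.grade_eq
    rw [if_pos (by omega), if_neg (by omega)]
    exact h⟩

theorem eq_edgePath {a b : K.Pt} (hab : CubeEdge a.1 b.1) (p : Path a b) :
    ∃ h : Step a b, p = edgePath h := by
  have hg := hab.grade_eq
  have hs := p.2.step (grade b.1) le_rfl (by omega)
  rw [p.2.bot _ le_rfl, p.2.top _ hg.le] at hs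
  refine ⟨hs, Subtype.ext (funext fun g => ?_)⟩
  change p.1 g = if grade a.1 ≤ g then a else b
  split_ifs with h
  · exact p.2.top g h
  · exact p.2.bot g (by omega)

/-- An edge correspondence consists of the paths along the edge. -/
noncomputable def edgeTwoMor (h : CubeEdge u v) : TwoMor (K.khEdge h) (K.pathCorr u v) where
  toEquiv := Equiv.ofBijective (fun p => ⟨p.1.2, p.1.1, (edgePath ⟨h, p.2⟩).cls⟩) (by
    constructor
    · rintro ⟨⟨y, x⟩, h₁⟩ ⟨⟨y', x'⟩, h₂⟩ he
      obtain rfl : x = x' := congrArg Sigma.fst he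
      obtain rfl : y = y' := congrArg (fun p => p.2.1) he
      rfl
    · rintro ⟨x, y, C⟩
      induction C using Quot.ind with
      | mk γ =>
        obtain ⟨hs, rfl⟩ := eq_edgePath h γ
        exact ⟨⟨(y, x), hs.2⟩, rfl⟩)
  s_comm _ := rfl
  t_comm _ := rfl

/-- The functor of path classes is transported to the Khovanov edge correspondences. The face
condition holds because partner paths around a square differ by one move and hence have the same
class. -/
theorem IsFaceRel.exists_functor {Φ : K.khVertexEdgeData.FaceMaps} (hΦ : IsFaceRel Φ) :
    ∃ F : CubeFunctor n, F.toCubeData = K.khData Φ := by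
  refine CubeFunctor.exists_toCubeData_eq K.pathFunctor (fun h => K.khEdge h) Φ
    (fun h => edgeTwoMor h) fun u v v' w h p => ?_
  obtain ⟨z, y, x, hzy, hyx, rfl⟩ := exists_eq_pathElem p
  obtain ⟨y', hr, -⟩ := existsUnique_faceRel h hzy hyx
  have e := hΦ _ _ _ _ h _ _ _ _ hr
  refine (congrArg (fun q => (K.pathFunctor.mapComp h.uv'.lt h.vw'.lt).toEquiv
    (((edgeTwoMor h.vw').hcomp (edgeTwoMor h.uv')).toEquiv q)) e).trans ?_
  have hs : Swap ((edgePath (a := ⟨u, x⟩) (b := ⟨v, y⟩) ⟨h.uv, hyx⟩).concat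
      (edgePath (b := ⟨w, z⟩) ⟨h.vw, hzy⟩))
      ((edgePath (a := ⟨u, x⟩) (b := ⟨v', y'⟩) ⟨h.uv', hr.yx'⟩).concat
      (edgePath (b := ⟨w, z⟩) ⟨h.vw', hr.zy'⟩)) := by
    have g₁ := h.uv.grade_eq
    have g₂ := h.vw.grade_eq
    have g₃ := h.vw'.grade_eq
    -- The move takes place at grading `grade w + 1`, that of both middle vertices; elsewhere the
    -- two concatenated edge paths agree.
    refine ⟨grade w, ⟨v', y'⟩, ?_, funext fun i => ?_⟩
    · have e₀ : (if grade v ≤ grade w then if grade u ≤ grade w then (⟨u, x⟩ : K.Pt) else ⟨v, y⟩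
          else if grade v ≤ grade w then ⟨v, y⟩ else ⟨w, z⟩) = ⟨w, z⟩ := by
        rw [if_neg (by omega), if_neg (by omega)]
      have e₁ : (if grade v ≤ grade w + 1 then if grade u ≤ grade w + 1 then (⟨u, x⟩ : K.Pt)
          else ⟨v, y⟩ else if grade v ≤ grade w + 1 then ⟨v, y⟩ else ⟨w, z⟩) = ⟨v, y⟩ := by
        rw [if_pos (by omega), if_neg (by omega)]
      have e₂ : (if grade v ≤ grade w + 2 then if grade u ≤ grade w + 2 then (⟨u, x⟩ : K.Pt)
          else ⟨v, y⟩ else if grade v ≤ grade w + 2 then ⟨v, y⟩ else ⟨w, z⟩) = ⟨u, x⟩ := by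
        rw [if_pos (by omega), if_pos (by omega)]
      have hd : ∀ {a b c d e f g : K.Pt}, a = d → b = e → c = f → Diam d e f g → Diam a b c g := by
        rintro _ _ _ _ _ _ _ rfl rfl rfl h
        exact h
      exact hd e₂ e₁ e₀ ⟨h, hr⟩
    · change (if grade v' ≤ i then if grade u ≤ i then (⟨u, x⟩ : K.Pt) else ⟨v', y'⟩
          else if grade v' ≤ i then ⟨v', y'⟩ else ⟨w, z⟩) = _
      rw [Function.update_apply]
      change _ = if i = grade w + 1 then (⟨v', y'⟩ : K.Pt) else
        (if grade v ≤ i then if grade u ≤ i then (⟨u, x⟩ : K.Pt) else ⟨v, y⟩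
          else if grade v ≤ i then ⟨v, y⟩ else ⟨w, z⟩)
      split_ifs <;> first | rfl | omega
  exact congrArg (fun C => (⟨x, z, C⟩ : (K.pathCorr u w).carrier)) (Quot.sound hs).symm

end LinkDiagram

end KhBurnside

theorem mainTheorem2 (n : ℕ) (K : KhBurnside.LinkDiagram n) :
    ∃ Φ : K.khVertexEdgeData.FaceMaps,
      K.IsLadybugMatching Φ ∧
      (∀ Ψ : K.khVertexEdgeData.FaceMaps, K.IsLadybugMatching Ψ → Ψ = Φ) ∧
      (K.khData Φ).Matching ∧
      (K.khData Φ).Hexagon ∧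
      ∃ F : KhBurnside.CubeFunctor n,
        F.toCubeData = K.khData Φ ∧
        ∀ G : KhBurnside.CubeFunctor n, G.toCubeData = K.khData Φ →
          Nonempty (KhBurnside.CubeFunctor.NatIso F G) := by
  obtain ⟨Φ, hΦ⟩ := KhBurnside.LinkDiagram.exists_isFaceRel K
  obtain ⟨F, hF⟩ := hΦ.exists_functor
  exact ⟨Φ, (KhBurnside.LinkDiagram.isFaceRel_iff Φ).1 hΦ,
    fun Ψ hΨ => hΦ.eq ((KhBurnside.LinkDiagram.isFaceRel_iff Ψ).2 hΨ), hΦ.matching, hΦ.hexagon,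
    F, hF, fun G hG => KhBurnside.CubeFunctor.nonempty_natIso (hF.trans hG.symm)⟩
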